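/- Let $\mathbb T^3=\mathbb R^3/(2\pi\mathbb Z)^3$. For $\theta\in(0,1)$ write $\|f\|_{C^0}=\sup|f|$, $[f]_{C^\theta}=\sup_{x\ne y}|f(x)-f(y)|/|x-y|^\theta$, $\|f\|_{C^\theta}=\|f\|_{C^0}+[f]_{C^\theta}$, and $\|f\|_{C^{1,\theta}}=\|f\|_{C^0}+\sup_k\|\partial_k f\|_{C^0}+\sup_k[\partial_k f]_{C^\theta}$, all on $\mathbb T^3$. Let $v,w,z\in C^0(\mathbb T^3;\mathbb R^3)$ be solenoidal, i.e. divergence free in the sense of distributions. Then there are unique distributions $p$ and $q$ on $\mathbb T^3$ with zero average such that $$-\Delta p=\operatorname{div}\operatorname{div}(v\otimes w)=\partial_i\partial_j(v^iw^j),\qquad -\Delta q=\operatorname{div}\operatorname{div}\operatorname{div}(v\otimes w\otimes z)=\partial_i\partial_j\partial_k(v^iw^jz^k)\qquad\text{on }\mathbb T^3.$$ Moreover, for all $\beta,\gamma\in(0,1)$ there is a constant $C_{\beta,\gamma}>0$, depending only on $\beta$ and $\gamma$, such that for all such $v,w,z$ the following hold. (i) If $\beta+\gamma<1$, $v\in C^\beta$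 and $w\in C^\gamma$, then $p$ is a function in $C^{\beta+\gamma}(\mathbb T^3)$ and $$\|p\|_{C^{\beta+\gamma}}\le C_{\beta,\gamma}\|v\|_{C^\beta}\|w\|_{C^\gamma}.$$ (ii) If $1<\beta+\gamma<2$, $v\in C^\beta$ and $w\in C^\gamma$, then $p$ is a function in $C^{1,\beta+\gamma-1}(\mathbb T^3)$ and $$\|p\|_{C^{1,\beta+\gamma-1}}\le C_{\beta,\gamma}\|v\|_{C^\beta}\|w\|_{C^\gamma}.$$ (iii) If $1<\beta+\gamma<2$, $v\in C^\beta$, $w\in C^\beta\cap C^\gamma$ and $z\in C^\gamma$, then $q$ is a function in $C^{\beta+\gamma-1}(\mathbb T^3)$ and $$\|q\|_{C^{\beta+\gamma-1}}\le C_{\beta,\gamma}\|v\|_{C^0}\|w\|_{C^\beta}\|z\|_{C^\gamma}+C_{\beta,\gamma}\|v\|_{C^\beta}\big(\|w\|_{C^0}\|z\|_{C^\gamma}+\|w\|_{C^\gamma}\|z\|_{C^0}\big).$$ -/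

import Mathlib

open MeasureTheory
open scoped ENNReal NNReal ContDiff

noncomputable section

namespace Torus3

/-- The Euclidean space `ℝ³`. Functions on the torus `𝕋³ = ℝ³ / (2πℤ)³` are represented by
their `2π`-periodic lifts to `ℝ³`. -/
abbrev E3 : Type := EuclideanSpace ℝ (Fin 3)

/-- The standard basis vector `e i`. -/
def e (i : Fin 3) : E3 := EuclideanSpace.single i (1 : ℝ)

/-- `2π`-periodicity in each of the three coordinate directions. -/
def IsPeriodic {F : Type} (f : E3 → F) : Prop :=
  ∀ (i : Fin 3) (x : E3), f (x + (2 * Real.pi) • e i) = f x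

/-- The fundamental cell `[-π, π)³` of the torus. -/
def cell : Set E3 := {x | ∀ i, x i ∈ Set.Ico (-Real.pi) Real.pi}

/-- The partial derivative `∂ᵢ f`. -/
def pderiv (i : Fin 3) (f : E3 → ℝ) : E3 → ℝ := fun x => fderiv ℝ f x (e i)

/-! ### Hölder norms, with values in `[0, ∞]`

For a periodic function the suprema over `ℝ³` below are the ones over `𝕋³` (with the quotient
distance, which is the smallest distance between representatives). -/

/-- `‖f‖_{C⁰} = sup |f|`. -/
def supNorm {F : Type} [NormedAddCommGroup F] (f : E3 → F) : ℝ≥0∞ := ⨆ x, ‖f x‖ₑ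

/-- `[f]_{C^θ} = sup_{x ≠ y} |f x - f y| / |x - y|^θ`. -/
def holderSeminorm {F : Type} [NormedAddCommGroup F] (θ : ℝ) (f : E3 → F) : ℝ≥0∞ :=
  ⨆ (x : E3) (y : E3) (_ : x ≠ y), ‖f x - f y‖ₑ / ‖x - y‖ₑ ^ θ

/-- `‖f‖_{C^θ} = ‖f‖_{C⁰} + [f]_{C^θ}`, for `θ ∈ (0,1)`. -/
def holderNorm {F : Type} [NormedAddCommGroup F] (θ : ℝ) (f : E3 → F) : ℝ≥0∞ :=
  supNorm f + holderSeminorm θ f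

/-- `‖f‖_{C^{1,θ}} = ‖f‖_{C⁰} + sup_k ‖∂ₖ f‖_{C⁰} + sup_k [∂ₖ f]_{C^θ}`; meant for `f` of
class `C¹`. -/
def c1HolderNorm (θ : ℝ) (f : E3 → ℝ) : ℝ≥0∞ :=
  supNorm f + (⨆ k, supNorm (pderiv k f)) + ⨆ k, holderSeminorm θ (pderiv k f)

/-! ### Test functions and distributions on the torus -/

/-- `C^∞(𝕋³)`: the smooth periodic real functions. -/
def TestFunction : Submodule ℝ (E3 → ℝ) where
  carrier := {φ | ContDiff ℝ ∞ φ ∧ IsPeriodic φ}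
  add_mem' := by
    rintro φ ψ ⟨h1, h2⟩ ⟨h3, h4⟩
    exact ⟨h1.add h3, fun i x => by simp [h2 i x, h4 i x]⟩
  zero_mem' := ⟨contDiff_const, fun _ _ => rfl⟩
  smul_mem' := by
    rintro c φ ⟨h1, h2⟩
    exact ⟨h1.const_smul c, fun i x => by simp [h2 i x]⟩

theorem pderiv_mem (i : Fin 3) {φ : E3 → ℝ} (hφ : φ ∈ TestFunction) :
    pderiv i φ ∈ TestFunction := by
  obtain ⟨h1, h2⟩ := hφ
  refine ⟨(h1.fderiv_right (m := ∞) (by simp)).clm_apply contDiff_const, fun j x => ?_⟩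
  have h : (fun y => φ (y + (2 * Real.pi) • e j)) = φ := funext (h2 j)
  have h3 := fderiv_comp_add_right (𝕜 := ℝ) (f := φ) (x := x) ((2 * Real.pi) • e j)
  rw [h] at h3
  simp only [pderiv, h3]

/-- The constant test function `1`. -/
def testOne : TestFunction := ⟨fun _ => 1, contDiff_const, fun _ _ => rfl⟩

/-- `∂ᵢ` on test functions. -/
def testD (i : Fin 3) (φ : TestFunction) : TestFunction :=
  ⟨pderiv i φ.1, pderiv_mem i φ.2⟩

/-- The Laplacian `Δ = ∑ᵢ ∂ᵢ∂ᵢ` on test functions. -/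
def testLap (φ : TestFunction) : TestFunction := ∑ i, testD i (testD i φ)

/-- A distribution on `𝕋³`: a linear functional on `C^∞(𝕋³)` that is continuous, that is, bounded
by a multiple of some `C^N` norm. -/
@[ext]
structure PeriodicDistribution where
  toFun : TestFunction →ₗ[ℝ] ℝ
  bounded : ∃ (N : ℕ) (C : ℝ), ∀ (φ : TestFunction) (M : ℝ),
    (∀ n ≤ N, ∀ x, ‖iteratedFDeriv ℝ n φ.1 x‖ ≤ M) → |toFun φ| ≤ C * M

/-- The distribution `P` is (integration against) the continuous periodic function `f`. -/
structure PeriodicDistribution.IsFunction (P : PeriodicDistribution) (f : E3 → ℝ) : Prop where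
  continuous : Continuous f
  periodic : IsPeriodic f
  eq_integral : ∀ φ : TestFunction, P.toFun φ = ∫ x in cell, f x * φ.1 x

/-- A continuous vector field on `𝕋³` which is solenoidal: `div v = 0` in the sense of
distributions. -/
structure IsSolenoidal (v : E3 → E3) : Prop where
  continuous : Continuous v
  periodic : IsPeriodic v
  div_eq_zero : ∀ φ : TestFunction, ∫ x in cell, ∑ i, v x i * (testD i φ).1 x = 0

/-- `P` is a zero-average distributional solution of `-Δ P = div div (v ⊗ w)` on `𝕋³`. -/
structure IsDoubleSolution (v w : E3 → E3) (P : PeriodicDistribution) : Prop where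
  average : P.toFun testOne = 0
  eqn : ∀ φ : TestFunction, -P.toFun (testLap φ) =
    ∫ x in cell, ∑ i, ∑ j, v x i * w x j * (testD j (testD i φ)).1 x

/-- `Q` is a zero-average distributional solution of `-Δ Q = div div div (v ⊗ w ⊗ z)` on `𝕋³`.
Three integrations by parts produce the sign on the right-hand side. -/
structure IsTripleSolution (v w z : E3 → E3) (Q : PeriodicDistribution) : Prop where
  average : Q.toFun testOne = 0
  eqn : ∀ φ : TestFunction, -Q.toFun (testLap φ) =
    -∫ x in cell, ∑ i, ∑ j, ∑ k, v x i * w x j * z x k * (testD k (testD j (testD i φ))).1 x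

end Torus3

end

open Torus3

noncomputable section

namespace Torus3

/-! The argument avoids Fourier series and the periodic Green function: it inverts the Laplacian by
a sum over dyadic scales in which every term is a convolution with a smooth compactly supported
kernel.

The kernel `1/|x|` is cut into annular pieces, all rescalings of one smooth `h` with `Δh = 8ρ(2·) -
ρ`, where `ρ` is an even mollifier. Summed over the scales `r_k = R 2^{-k}`, these identities
telescope, so the resulting operator `potential` sends `Δf` to `f - ρ_R * f`
(`laplacian_potential`). For `R` large, `smear f = ρ_R * f - mean f` has norm at most `1/2` in the
sup norm (`exists_contraction_scale`), so `1 - smear` has an inverse, `resolvent`, which differs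
from the identity by a smoothing operator. Then `invLap = potential ∘ resolvent` inverts `Δ` up to
means and commutes with derivatives. Existence and uniqueness of `p` and `q` follow by transposition
(`existsUnique_solvesDiv`), and by duality the solution is `resolvent` of a sum of dyadic pieces as
soon as their sup norms are summable (`SolvesDiv.isFunction`).

The gain in regularity comes from cancellation. Convolving a solenoidal field with a gradient
kernel, summed over the index, gives zero (`IsSolenoidal.sum_scaledConv_eq_zero`). So when `v ⊗ w`
is expanded around the point `x` of evaluation, the constant and linear terms contribute nothing,
and only `(v - v(x)) ⊗ (w - w(x))` remains, of size `r^{β+γ}` at scale `r`. For three factors, what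
survives contains at least two increments, and again has size `r^{β+γ}` (`abs_divConv_double_le`,
`abs_divConv_triple_le`). With `m` derivatives in the equation, the piece at scale `r` is
`O(r^{β+γ+2-m})`, and each further derivative costs `r⁻¹`. Such sums have Hölder regularity
`β+γ+2-m` (`exists_holderBound_tsum`), which is the claim for `m = 2` and `m = 3`; when the exponent
exceeds `1`, the series is first differentiated term by term. -/

/-- Continuous periodic real functions on `ℝ³`, that is, continuous functions on the torus. -/
structure IsPC (f : E3 → ℝ) : Prop where
  continuous : Continuous f
  periodic : IsPeriodic f

/-! ### The fundamental cell -/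

/-- The basis `2π eᵢ` of the period lattice. -/
def latticeBasis : Module.Basis (Fin 3) ℝ E3 :=
  ((EuclideanSpace.basisFun (Fin 3) ℝ).toBasis).isUnitSMul (w := fun _ => 2 * Real.pi)
    (fun _ => (by positivity : (2 * Real.pi) ≠ 0).isUnit)

lemma latticeBasis_apply (i : Fin 3) : latticeBasis i = (2 * Real.pi) • e i := by
  simp [latticeBasis, Module.Basis.isUnitSMul_apply, e]

lemma latticeBasis_repr (x : E3) (i : Fin 3) :
    latticeBasis.repr x i = (2 * Real.pi)⁻¹ * x i := by
  rw [latticeBasis, Module.Basis.repr_isUnitSMul]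
  simp [Units.smul_def, IsUnit.unit]

/-- The period lattice `(2πℤ)³`. -/
abbrev periodLattice : Submodule ℤ E3 := Submodule.span ℤ (Set.range latticeBasis)

lemma IsPeriodic.add_lattice {F : Type} {f : E3 → F} (hf : IsPeriodic f) {g : E3}
    (hg : g ∈ periodLattice) (x : E3) : f (g + x) = f x := by
  induction hg using Submodule.span_induction generalizing x with
  | mem y hy =>
    obtain ⟨i, rfl⟩ := hy
    rw [latticeBasis_apply, add_comm]
    exact hf i x
  | zero => simp
  | add y z _ _ hy hz => rw [add_assoc, hy, hz]
  | smul n y _ hy =>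
    induction n using Int.induction_on generalizing x with
    | zero => simp
    | succ n ih => rw [add_smul, one_smul, add_assoc, ih, hy]
    | pred n ih =>
      rw [← hy, ← add_assoc, sub_smul, one_smul, add_sub_cancel, ih]

instance : VAddInvariantMeasure periodLattice E3 volume :=
  ⟨fun c _ _ => measure_preimage_add volume (c : E3) _⟩

/-- The translate by `a` of the standard fundamental domain of the period lattice. -/
def shiftedCell (a : E3) : Set E3 := {x | x - a ∈ ZSpan.fundamentalDomain latticeBasis}

lemma isAddFundamentalDomain_shiftedCell (a : E3) :
    IsAddFundamentalDomain periodLattice (shiftedCell a) (volume : Measure E3) := by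
  refine IsAddFundamentalDomain.mk' ?_ fun x => ?_
  · exact ((ZSpan.fundamentalDomain_measurableSet latticeBasis).preimage
      (measurable_id.sub_const a)).nullMeasurableSet
  · obtain ⟨g, hg, hu⟩ := ZSpan.exist_unique_vadd_mem_fundamentalDomain latticeBasis (x - a)
    refine ⟨g, ?_, fun y hy => hu y ?_⟩
    · change (g : E3) + x - a ∈ ZSpan.fundamentalDomain latticeBasis
      rw [add_sub_assoc]
      exact hg
    · change (y : E3) + (x - a) ∈ ZSpan.fundamentalDomain latticeBasis
      rw [← add_sub_assoc]
      exact hy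

lemma cell_eq_shiftedCell :
    cell = shiftedCell (WithLp.toLp 2 fun _ => -Real.pi) := by
  ext x
  simp only [cell, shiftedCell, ZSpan.mem_fundamentalDomain, latticeBasis_repr, Set.mem_ofPred_eq,
    Set.mem_Ico]
  refine forall_congr' fun i => ?_
  have hp := Real.pi_pos
  simp only [PiLp.sub_apply, sub_neg_eq_add]
  rw [inv_mul_lt_iff₀ (by positivity), le_inv_mul_iff₀ (by positivity)]
  constructor <;> rintro ⟨h1, h2⟩ <;> constructor <;> linarith

/-- A translated cell is another fundamental domain of the same lattice, and a periodic function has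
the same integral over both. -/
lemma setIntegral_cell_add {f : E3 → ℝ} (hf : IsPeriodic f) (a : E3) :
    ∫ x in cell, f (x + a) = ∫ x in cell, f x := by
  rw [cell_eq_shiftedCell]
  set c : E3 := WithLp.toLp 2 fun _ => -Real.pi
  have h : shiftedCell c = (fun x => x + a) ⁻¹' shiftedCell (c + a) := by
    ext x
    simp [shiftedCell]
  conv_lhs => rw [h]
  rw [(measurePreserving_add_right (volume : Measure E3) a).setIntegral_preimage_emb
    (measurableEmbedding_addRight a)]
  exact (isAddFundamentalDomain_shiftedCell _).setIntegral_eq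
    (isAddFundamentalDomain_shiftedCell _) fun g x => hf.add_lattice g.2 x

lemma setIntegral_cell_sub {f : E3 → ℝ} (hf : IsPeriodic f) (a : E3) :
    ∫ x in cell, f (x - a) = ∫ x in cell, f x := by
  simpa [sub_eq_add_neg] using setIntegral_cell_add hf (-a)

lemma exists_mem_cell (x : E3) : ∃ g ∈ periodLattice, g + x ∈ cell := by
  rw [cell_eq_shiftedCell]
  obtain ⟨g, hg, -⟩ := ZSpan.exist_unique_vadd_mem_fundamentalDomain latticeBasis
    (x - WithLp.toLp 2 fun _ => -Real.pi)
  refine ⟨g, g.2, ?_⟩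
  change (g : E3) + x - _ ∈ ZSpan.fundamentalDomain latticeBasis
  rw [add_sub_assoc]
  exact hg

/-- The sharp radius is `√3 π < 6`; only some explicit bound is needed. -/
lemma norm_le_of_mem_cell {x : E3} (hx : x ∈ cell) : ‖x‖ ≤ 6 := by
  rw [EuclideanSpace.norm_eq, Real.sqrt_le_left (by norm_num)]
  have h : ∀ i, ‖x i‖ ^ 2 ≤ 12 := fun i => by
    have hi : |x i| ≤ 3.15 := by
      have := hx i
      have hp := Real.pi_lt_d2
      rw [abs_le]; constructor <;> linarith [this.1, this.2]
    rw [Real.norm_eq_abs]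
    nlinarith [abs_nonneg (x i)]
  calc ∑ i, ‖x i‖ ^ 2 ≤ ∑ _i : Fin 3, (12 : ℝ) := Finset.sum_le_sum fun i _ => h i
    _ = 6 ^ 2 := by simp; norm_num

lemma measurableSet_cell : MeasurableSet cell := by
  rw [cell_eq_shiftedCell]
  exact (ZSpan.fundamentalDomain_measurableSet latticeBasis).preimage (measurable_id.sub_const _)

lemma cell_subset_closedBall : cell ⊆ Metric.closedBall 0 6 := fun x hx => by
  simpa using norm_le_of_mem_cell hx

lemma volume_cell_lt_top : volume cell < ⊤ :=
  (measure_mono cell_subset_closedBall).trans_lt measure_closedBall_lt_top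

instance : IsFiniteMeasure (volume.restrict cell : Measure E3) :=
  ⟨by simpa using volume_cell_lt_top⟩

lemma IsPC.exists_bound {f : E3 → ℝ} (hf : IsPC f) : ∃ M, 0 ≤ M ∧ ∀ x, |f x| ≤ M := by
  obtain ⟨M, hM⟩ := (isCompact_closedBall (0 : E3) 6).exists_bound_of_continuousOn
    hf.continuous.continuousOn
  refine ⟨M, (norm_nonneg _).trans (hM 0 (by simp)), fun x => ?_⟩
  obtain ⟨g, hg, hx⟩ := exists_mem_cell x
  rw [← hf.periodic.add_lattice hg x]
  exact hM _ (cell_subset_closedBall hx)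

lemma IsPC.integrableOn {f : E3 → ℝ} (hf : IsPC f) : IntegrableOn f cell :=
  (hf.continuous.continuousOn.integrableOn_compact (isCompact_closedBall (0 : E3) 6)).mono_set
    cell_subset_closedBall

lemma volume_real_cell_pos : 0 < volume.real cell := by
  rw [Measure.real, ENNReal.toReal_pos_iff]
  refine ⟨?_, volume_cell_lt_top⟩
  refine lt_of_lt_of_le (Metric.measure_ball_pos volume (0 : E3) one_pos) (measure_mono ?_)
  intro x hx i
  have h1 : |x i| ≤ ‖x‖ := by simpa using PiLp.norm_apply_le x i
  have h2 : ‖x‖ < 1 := by simpa using hx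
  have := abs_lt.1 (h1.trans_lt h2)
  constructor <;> linarith [Real.pi_gt_three, this.1, this.2]

/-- The cell is not open, so a.e. vanishing on it says nothing directly at its boundary points.
Translating any given point to the origin, which is interior, removes this difficulty. -/
lemma IsPC.eq_zero_of_integral_sq {f : E3 → ℝ} (hf : IsPC f)
    (h : ∫ x in cell, f x * f x = 0) : f = 0 := by
  have hff : IsPC fun x => f x * f x :=
    ⟨hf.continuous.mul hf.continuous, fun i x => by simp [hf.periodic i x]⟩
  have hz : ∀ a, ∀ᵐ x ∂(volume.restrict cell), f (x + a) = 0 := by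
    intro a
    have hp : IsPC fun x => f (x + a) * f (x + a) :=
      ⟨hff.continuous.comp (continuous_add_const a), fun i x => by
        have := hff.periodic i (x + a)
        simpa [add_right_comm] using this⟩
    have h2 : ∫ x in cell, f (x + a) * f (x + a) = 0 := by
      rw [setIntegral_cell_add (f := fun x => f x * f x) hff.periodic a, h]
    rw [setIntegral_eq_zero_iff_of_nonneg_ae (Filter.Eventually.of_forall fun x =>
      mul_self_nonneg _) hp.integrableOn] at h2
    filter_upwards [h2] with x hx
    simpa using hx
  ext a
  by_contra hne
  have hopen : IsOpen ({x | f (x + a) ≠ 0} ∩ Metric.ball 0 1) :=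
    (isOpen_ne_fun (hf.continuous.comp (continuous_add_const a)) continuous_const).inter
      Metric.isOpen_ball
  have hpos := hopen.measure_pos volume ⟨0, by simpa using hne, by simp⟩
  have hsub : Metric.ball (0 : E3) 1 ⊆ cell := by
    intro x hx i
    have h1 : |x i| ≤ ‖x‖ := by simpa using PiLp.norm_apply_le x i
    have h2 : ‖x‖ < 1 := by simpa using hx
    have := abs_lt.1 (h1.trans_lt h2)
    constructor <;> linarith [Real.pi_gt_three, this.1, this.2]
  have h0 := hz a
  rw [ae_restrict_iff' measurableSet_cell, ae_iff] at h0
  refine hpos.ne' (measure_mono_null ?_ h0)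
  rintro x ⟨h1, h2⟩
  simpa using ⟨hsub h2, h1⟩

/-! ### Partial derivatives -/

lemma fderiv_apply_eq_sum (f : E3 → ℝ) (x v : E3) :
    fderiv ℝ f x v = ∑ i, v i * pderiv i f x := by
  have hv : v = ∑ i, v i • e i := by
    ext j
    simp [e, Fin.sum_univ_three]
    fin_cases j <;> simp
  conv_lhs => rw [hv]
  simp [pderiv]

lemma norm_fderiv_le {f : E3 → ℝ} {x : E3} {M : ℝ} (h : ∀ i, |pderiv i f x| ≤ M) :
    ‖fderiv ℝ f x‖ ≤ 3 * M := by
  have hM : 0 ≤ M := (abs_nonneg _).trans (h 0)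
  refine ContinuousLinearMap.opNorm_le_bound _ (by positivity) fun v => ?_
  rw [fderiv_apply_eq_sum, Real.norm_eq_abs]
  calc |∑ i, v i * pderiv i f x| ≤ ∑ i, |v i * pderiv i f x| := Finset.abs_sum_le_sum_abs _ _
    _ ≤ ∑ _i : Fin 3, ‖v‖ * M := by
      refine Finset.sum_le_sum fun i _ => ?_
      rw [abs_mul]
      exact mul_le_mul (by simpa using PiLp.norm_apply_le v i) (h i) (abs_nonneg _) (norm_nonneg _)
    _ = 3 * M * ‖v‖ := by simp; ring

lemma abs_sub_le_of_pderiv_le {f : E3 → ℝ} (hf : Differentiable ℝ f) {M : ℝ}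
    (h : ∀ i x, |pderiv i f x| ≤ M) (x y : E3) : |f x - f y| ≤ 3 * M * ‖x - y‖ :=
  convex_univ.norm_image_sub_le_of_norm_fderiv_le (fun z _ => hf z)
    (fun z _ => norm_fderiv_le fun i => h i z) (Set.mem_univ y) (Set.mem_univ x)

lemma abs_pderiv_le (f : E3 → ℝ) (i : Fin 3) (x : E3) : |pderiv i f x| ≤ ‖fderiv ℝ f x‖ := by
  simpa [e, pderiv] using (fderiv ℝ f x).le_opNorm (e i)

lemma fderiv_eq_sum_smulRight (f : E3 → ℝ) :
    fderiv ℝ f = fun x => ∑ i, pderiv i f x • (EuclideanSpace.proj i : E3 →L[ℝ] ℝ) := by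
  ext x v
  simp [fderiv_apply_eq_sum, mul_comm]

lemma contDiff_pderiv {f : E3 → ℝ} (hf : ContDiff ℝ ∞ f) (i : Fin 3) :
    ContDiff ℝ ∞ (pderiv i f) :=
  (hf.fderiv_right (m := ∞) (by simp)).clm_apply contDiff_const

lemma contDiff_one_of_pderiv {f : E3 → ℝ} (hf : Differentiable ℝ f)
    (h : ∀ i, Continuous (pderiv i f)) : ContDiff ℝ 1 f := by
  rw [contDiff_one_iff_fderiv]
  refine ⟨hf, ?_⟩
  rw [fderiv_eq_sum_smulRight]
  exact continuous_finsetSum _ fun i _ => (h i).smul continuous_const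

/-- A family of differentiable functions that is stable under partial derivatives consists of
smooth functions. -/
lemma contDiff_of_stable {S : Set (E3 → ℝ)} (hd : ∀ f ∈ S, Differentiable ℝ f)
    (hp : ∀ f ∈ S, ∀ i, pderiv i f ∈ S) {f : E3 → ℝ} (hf : f ∈ S) : ContDiff ℝ ∞ f := by
  rw [contDiff_infty]
  intro n
  induction n generalizing f with
  | zero => exact contDiff_zero.2 (hd f hf).continuous
  | succ n ih =>
    rw [Nat.cast_add, Nat.cast_one, contDiff_succ_iff_fderiv]
    refine ⟨hd f hf, by simp, ?_⟩
    rw [fderiv_eq_sum_smulRight]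
    exact ContDiff.sum fun i _ => (ih (hp f hf i)).smul contDiff_const

lemma pderiv_comm {f : E3 → ℝ} (hf : ContDiff ℝ ∞ f) (i j : Fin 3) :
    pderiv i (pderiv j f) = pderiv j (pderiv i f) := by
  have key : ∀ a b x, pderiv a (pderiv b f) x = fderiv ℝ (fderiv ℝ f) x (e a) (e b) := by
    intro a b x
    have hd : DifferentiableAt ℝ (fderiv ℝ f) x :=
      (hf.fderiv_right (m := ∞) (by simp)).differentiable (by simp) x
    change fderiv ℝ (fun y => fderiv ℝ f y (e b)) x (e a) = _
    rw [fderiv_clm_apply hd (differentiableAt_const _)]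
    simp
  ext x
  rw [key, key]
  have hs : IsSymmSndFDerivAt ℝ f x :=
    hf.contDiffAt.isSymmSndFDerivAt
      (by rw [minSmoothness_of_isRCLikeNormedField]; exact WithTop.coe_le_coe.2 le_top)
  exact hs (e i) (e j)

lemma pderiv_add {f g : E3 → ℝ} (hf : Differentiable ℝ f) (hg : Differentiable ℝ g) (i : Fin 3) :
    pderiv i (fun x => f x + g x) = fun x => pderiv i f x + pderiv i g x := by
  ext x
  simp only [pderiv]
  rw [fderiv_fun_add (hf x) (hg x)]
  rfl

lemma pderiv_sub {f g : E3 → ℝ} (hf : Differentiable ℝ f) (hg : Differentiable ℝ g) (i : Fin 3) :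
    pderiv i (fun x => f x - g x) = fun x => pderiv i f x - pderiv i g x := by
  ext x
  simp only [pderiv]
  rw [fderiv_fun_sub (hf x) (hg x)]
  rfl

lemma pderiv_const_mul {f : E3 → ℝ} (hf : Differentiable ℝ f) (c : ℝ) (i : Fin 3) :
    pderiv i (fun x => c * f x) = fun x => c * pderiv i f x := by
  ext x
  simp only [pderiv]
  rw [fderiv_const_mul (hf x)]
  rfl

lemma pderiv_const (c : ℝ) (i : Fin 3) : pderiv i (fun _ => c) = fun _ => 0 := by
  ext x
  simp [pderiv]

lemma pderiv_sum {ι : Type*} (s : Finset ι) {f : ι → E3 → ℝ}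
    (hf : ∀ a ∈ s, Differentiable ℝ (f a)) (i : Fin 3) :
    pderiv i (fun x => ∑ a ∈ s, f a x) = fun x => ∑ a ∈ s, pderiv i (f a) x := by
  ext x
  simp only [pderiv]
  rw [fderiv_fun_sum fun a ha => hf a ha x]
  simp

lemma IsPeriodic.pderiv {f : E3 → ℝ} (hf : IsPeriodic f) (i : Fin 3) :
    IsPeriodic (pderiv i f) := by
  intro j x
  have h : (fun y => f (y + (2 * Real.pi) • e j)) = f := funext (hf j)
  have h3 := fderiv_comp_add_right (𝕜 := ℝ) (f := f) (x := x) ((2 * Real.pi) • e j)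
  rw [h] at h3
  simp only [Torus3.pderiv, h3]

/-! ### Kernels and scaled convolutions -/

/-- Smooth functions supported in the closed unit ball. -/
structure IsKernel (κ : E3 → ℝ) : Prop where
  smooth : ContDiff ℝ ∞ κ
  eq_zero : ∀ y, 1 < ‖y‖ → κ y = 0

namespace IsKernel

variable {κ : E3 → ℝ}

lemma pderiv (hκ : IsKernel κ) (i : Fin 3) : IsKernel (pderiv i κ) := by
  refine ⟨contDiff_pderiv hκ.smooth i, fun y hy => ?_⟩
  have h : κ =ᶠ[nhds y] fun _ => 0 := by
    filter_upwards [(isOpen_lt continuous_const continuous_norm).mem_nhds hy] with z hz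
    exact hκ.eq_zero z hz
  simp [Torus3.pderiv, h.fderiv_eq]

lemma hasCompactSupport (hκ : IsKernel κ) : HasCompactSupport κ :=
  HasCompactSupport.intro (isCompact_closedBall (0 : E3) 1) fun y hy =>
    hκ.eq_zero y (by simpa using hy)

lemma integrable (hκ : IsKernel κ) : Integrable κ :=
  hκ.smooth.continuous.integrable_of_hasCompactSupport hκ.hasCompactSupport

lemma integrable_mul (hκ : IsKernel κ) {g : E3 → ℝ} (hg : Continuous g) :
    Integrable fun y => κ y * g y :=
  (hκ.smooth.continuous.mul hg).integrable_of_hasCompactSupport hκ.hasCompactSupport.mul_right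

lemma differentiable (hκ : IsKernel κ) : Differentiable ℝ κ := hκ.smooth.differentiable (by simp)

lemma integral_pderiv (hκ : IsKernel κ) (i : Fin 3) : ∫ y, Torus3.pderiv i κ y = 0 := by
  have h := integral_mul_fderiv_eq_neg_fderiv_mul_of_integrable (μ := (volume : Measure E3))
    (f := fun _ => (1 : ℝ)) (g := κ) (v := e i) (by simp)
    (by simp only [one_mul]; exact (hκ.pderiv i).integrable) (by simpa using hκ.integrable)
    (fun x _ => differentiableAt_const _) (fun x _ => hκ.differentiable x)
  simpa [Torus3.pderiv] using h

end IsKernel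

/-- The `L¹` norm of a kernel. -/
def l1Norm (κ : E3 → ℝ) : ℝ := ∫ y, |κ y|

lemma l1Norm_nonneg (κ : E3 → ℝ) : 0 ≤ l1Norm κ := integral_nonneg fun _ => abs_nonneg _

lemma IsKernel.abs_integral_le {κ : E3 → ℝ} (hκ : IsKernel κ) {g : E3 → ℝ} {M : ℝ}
    (h : ∀ y, ‖y‖ ≤ 1 → |g y| ≤ M) : |∫ y, κ y * g y| ≤ l1Norm κ * M := by
  rw [l1Norm, ← integral_mul_const, ← Real.norm_eq_abs]
  refine norm_integral_le_of_norm_le (hκ.integrable.abs.mul_const M) (Filter.Eventually.of_forall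
    fun y => ?_)
  rw [Real.norm_eq_abs, abs_mul]
  rcases le_or_gt ‖y‖ 1 with hy | hy
  · exact mul_le_mul_of_nonneg_left (h y hy) (abs_nonneg _)
  · simp [hκ.eq_zero y hy]

/-- The convolution of `f` with the rescaled kernel `r⁻³ κ (· / r)`. -/
def scaledConv (κ f : E3 → ℝ) (r : ℝ) (x : E3) : ℝ := ∫ y, κ y * f (x - r • y)

section scaledConv

variable {κ f g : E3 → ℝ}

lemma IsKernel.integrable_conv (hκ : IsKernel κ) (hf : Continuous f) (r : ℝ) (x : E3) :
    Integrable fun y => κ y * f (x - r • y) :=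
  hκ.integrable_mul (g := fun y => f (x - r • y)) (by fun_prop)

lemma abs_scaledConv_le (hκ : IsKernel κ) {M : ℝ} (h : ∀ x, |f x| ≤ M) (r : ℝ) (x : E3) :
    |scaledConv κ f r x| ≤ l1Norm κ * M :=
  hκ.abs_integral_le fun _ _ => h _

lemma scaledConv_add (hκ : IsKernel κ) (hf : Continuous f) (hg : Continuous g) (r : ℝ) (x : E3) :
    scaledConv κ (fun z => f z + g z) r x = scaledConv κ f r x + scaledConv κ g r x := by
  simp only [scaledConv, mul_add]
  exact integral_add (hκ.integrable_conv hf r x) (hκ.integrable_conv hg r x)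

lemma scaledConv_const_mul (c : ℝ) (r : ℝ) (x : E3) :
    scaledConv κ (fun z => c * f z) r x = c * scaledConv κ f r x := by
  simp only [scaledConv, ← integral_const_mul]
  congr 1 with y
  ring

lemma scaledConv_const (c : ℝ) (r : ℝ) (x : E3) :
    scaledConv κ (fun _ => c) r x = c * ∫ y, κ y := by
  simp only [scaledConv, ← integral_const_mul]
  congr 1 with y
  ring

lemma scaledConv_neg_of_even (h : ∀ y, κ (-y) = κ y) (r : ℝ) (x : E3) :
    scaledConv κ f (-r) x = scaledConv κ f r x := by
  rw [scaledConv, scaledConv, ← integral_neg_eq_self]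
  simp [h]

lemma continuous_scaledConv (hκ : IsKernel κ) (hf : Continuous f) (r : ℝ) :
    Continuous (scaledConv κ f r) := by
  have h : ∀ x, scaledConv κ f r x = ∫ y in Metric.closedBall (0 : E3) 1, κ y * f (x - r • y) := by
    intro x
    rw [setIntegral_eq_integral_of_forall_compl_eq_zero]
    · rfl
    · intro y hy
      rw [hκ.eq_zero y (by simpa using hy), zero_mul]
  rw [funext h]
  refine continuous_parametric_integral_of_continuous (f := fun x y => κ y * f (x - r • y)) ?_
    (isCompact_closedBall (0 : E3) 1)
  have := hκ.smooth.continuous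
  unfold Function.uncurry
  fun_prop

lemma IsPC.scaledConv (hf : IsPC f) (hκ : IsKernel κ) (r : ℝ) : IsPC (scaledConv κ f r) := by
  refine ⟨continuous_scaledConv hκ hf.continuous r, fun i x => ?_⟩
  simp only [Torus3.scaledConv]
  congr 1 with y
  rw [add_sub_right_comm, hf.periodic]

/-- The derivative falls on the function. -/
lemma hasFDerivAt_scaledConv (hκ : IsKernel κ) (hf : ContDiff ℝ 1 f) {M : ℝ}
    (hM : ∀ x, ‖fderiv ℝ f x‖ ≤ M) (r : ℝ) (x : E3) :
    HasFDerivAt (scaledConv κ f r) (∫ y, κ y • fderiv ℝ f (x - r • y)) x := by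
  have hc := hκ.smooth.continuous
  have hf' := hf.continuous_fderiv one_ne_zero
  refine hasFDerivAt_integral_of_dominated_of_fderiv_le (s := Set.univ)
    (bound := fun y => |κ y| * M) (F := fun x y => κ y * f (x - r • y))
    (F' := fun x y => κ y • fderiv ℝ f (x - r • y)) Filter.univ_mem ?_
    (hκ.integrable_conv hf.continuous r x) ?_ ?_ (hκ.integrable.abs.mul_const M) ?_
  · exact Filter.Eventually.of_forall fun z =>
      (hκ.integrable_conv hf.continuous r z).aestronglyMeasurable
  · exact (hc.smul (hf'.comp (by fun_prop))).aestronglyMeasurable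
  · refine Filter.Eventually.of_forall fun y z _ => ?_
    rw [norm_smul, Real.norm_eq_abs]
    exact mul_le_mul_of_nonneg_left (hM _) (abs_nonneg _)
  · refine Filter.Eventually.of_forall fun y z _ => ?_
    have h1 : HasFDerivAt (fun z => f (z - r • y)) (fderiv ℝ f (z - r • y)) z := by
      have := (hf.differentiable one_ne_zero (z - r • y)).hasFDerivAt.comp z
        ((hasFDerivAt_id z).sub_const (r • y))
      simpa [Function.comp_def] using this
    exact h1.const_mul (κ y)

lemma IsPC.exists_fderiv_bound (hf : IsPC f) (hd : ContDiff ℝ 1 f) :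
    ∃ M, ∀ x, ‖fderiv ℝ f x‖ ≤ M := by
  have h : ∀ i, ∃ M, 0 ≤ M ∧ ∀ x, |pderiv i f x| ≤ M := fun i =>
    IsPC.exists_bound ⟨(hd.continuous_fderiv one_ne_zero).clm_apply continuous_const,
      hf.periodic.pderiv i⟩
  choose M hM0 hM using h
  refine ⟨3 * ∑ i, M i, fun x => norm_fderiv_le fun i => (hM i x).trans ?_⟩
  exact Finset.single_le_sum (fun i _ => hM0 i) (Finset.mem_univ i)

lemma pderiv_scaledConv (hκ : IsKernel κ) (hf : IsPC f) (hd : ContDiff ℝ 1 f) (r : ℝ)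
    (i : Fin 3) : pderiv i (scaledConv κ f r) = scaledConv κ (pderiv i f) r := by
  obtain ⟨M, hM⟩ := hf.exists_fderiv_bound hd
  ext x
  have hc := hκ.smooth.continuous
  have hf' := hd.continuous_fderiv one_ne_zero
  rw [pderiv, (hasFDerivAt_scaledConv hκ hd hM r x).fderiv, ContinuousLinearMap.integral_apply]
  · rfl
  · exact (hc.smul (hf'.comp (by fun_prop))).integrable_of_hasCompactSupport
      hκ.hasCompactSupport.smul_right

lemma scaledConv_eq_convolution {r : ℝ} (hr : r ≠ 0) (x : E3) :
    scaledConv κ f r x = |(r ^ 3)⁻¹| *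
      convolution (fun z => κ (r⁻¹ • z)) f (ContinuousLinearMap.mul ℝ ℝ) volume x := by
  have h := Measure.integral_comp_smul (volume : Measure E3)
    (fun z => κ (r⁻¹ • z) * f (x - z)) r
  simp only [smul_smul, inv_mul_cancel₀ hr, one_smul] at h
  rw [scaledConv, h]
  simp [convolution]

/-- After a change of variables this is an ordinary convolution with a smooth compactly supported
function, so `f` need only be continuous. The factor `r⁻¹` is the chain rule for the rescaled
kernel. -/
lemma hasFDerivAt_scaledConv_kernel (hκ : IsKernel κ) (hf : Continuous f) {r : ℝ} (hr : r ≠ 0)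
    (x : E3) : DifferentiableAt ℝ (scaledConv κ f r) x ∧
      ∀ i, pderiv i (scaledConv κ f r) x = r⁻¹ * scaledConv (pderiv i κ) f r x := by
  set κr : E3 → ℝ := fun z => κ (r⁻¹ • z) with hκr
  have hsm : ContDiff ℝ ∞ κr := hκ.smooth.comp (contDiff_const_smul _)
  have hcs : HasCompactSupport κr := by
    refine hκ.hasCompactSupport.comp_homeomorph (Homeomorph.smulOfNeZero r⁻¹ (inv_ne_zero hr))
  have hd := hcs.hasFDerivAt_convolution_left (ContinuousLinearMap.mul ℝ ℝ) (μ := volume)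
    (hsm.of_le (by simp)) (hf.locallyIntegrable (μ := volume)) x
  have hfun : scaledConv κ f r = fun x => |(r ^ 3)⁻¹| *
      convolution κr f (ContinuousLinearMap.mul ℝ ℝ) volume x :=
    funext fun x => scaledConv_eq_convolution hr x
  have hd2 := hd.const_mul |(r ^ 3)⁻¹|
  rw [← hfun] at hd2
  refine ⟨hd2.differentiableAt, fun i => ?_⟩
  rw [pderiv, hd2.fderiv, scaledConv_eq_convolution hr]
  have hex := (hcs.fderiv (𝕜 := ℝ)).convolutionExists_left
    ((ContinuousLinearMap.mul ℝ ℝ).precompL E3) (μ := volume)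
    (hsm.continuous_fderiv (by simp)) (hf.locallyIntegrable (μ := volume)) x
  have h1 : (convolution (fderiv ℝ κr) f ((ContinuousLinearMap.mul ℝ ℝ).precompL E3) volume x)
      (e i) = r⁻¹ * convolution (fun z => pderiv i κ (r⁻¹ • z)) f
        (ContinuousLinearMap.mul ℝ ℝ) volume x := by
    rw [convolution, ContinuousLinearMap.integral_apply hex, convolution, ← integral_const_mul]
    congr 1 with t
    have h2 : fderiv ℝ κr t (e i) = r⁻¹ * pderiv i κ (r⁻¹ • t) := by
      have h3 : HasFDerivAt κr _ t := (hκ.differentiable (r⁻¹ • t)).hasFDerivAt.comp t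
        ((hasFDerivAt_id t).const_smul r⁻¹)
      rw [h3.fderiv]
      simp [pderiv]
    simp [h2, mul_assoc]
  simp only [smul_apply, smul_eq_mul]
  rw [h1]
  ring

lemma differentiable_scaledConv (hκ : IsKernel κ) (hf : Continuous f) {r : ℝ} (hr : r ≠ 0) :
    Differentiable ℝ (scaledConv κ f r) :=
  fun x => (hasFDerivAt_scaledConv_kernel hκ hf hr x).1

/-- The derivative falls on the kernel. -/
lemma pderiv_scaledConv_kernel (hκ : IsKernel κ) (hf : Continuous f) {r : ℝ} (hr : r ≠ 0)
    (i : Fin 3) : pderiv i (scaledConv κ f r) = fun x => r⁻¹ * scaledConv (pderiv i κ) f r x :=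
  funext fun x => (hasFDerivAt_scaledConv_kernel hκ hf hr x).2 i

/-- Multiples of scaled convolutions of `f`, with varying kernel, form a family closed under partial
derivatives. -/
lemma contDiff_scaledConv (hκ : IsKernel κ) (hf : Continuous f) {r : ℝ} (hr : r ≠ 0) :
    ContDiff ℝ ∞ (scaledConv κ f r) := by
  refine contDiff_of_stable (S := {u | ∃ (c : ℝ) (k : E3 → ℝ), IsKernel k ∧
    u = fun x => c * scaledConv k f r x}) ?_ ?_ ⟨1, κ, hκ, by simp⟩
  · rintro _ ⟨c, k, hk, rfl⟩
    exact (differentiable_scaledConv hk hf hr).const_mul c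
  · rintro _ ⟨c, k, hk, rfl⟩ i
    refine ⟨c * r⁻¹, pderiv i k, hk.pderiv i, ?_⟩
    rw [pderiv_const_mul (differentiable_scaledConv hk hf hr), pderiv_scaledConv_kernel hk hf hr]
    simp [mul_assoc]

lemma scaledConv_mem_test (hκ : IsKernel κ) (hf : IsPC f) {r : ℝ} (hr : r ≠ 0) :
    scaledConv κ f r ∈ TestFunction :=
  ⟨contDiff_scaledConv hκ hf.continuous hr, (hf.scaledConv hκ r).periodic⟩

/-- The adjoint of a scaled convolution on the torus. -/
lemma setIntegral_scaledConv_mul (hκ : IsKernel κ) (hf : IsPC f) (hg : IsPC g) (r : ℝ) :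
    ∫ x in cell, scaledConv κ f r x * g x = ∫ x in cell, f x * scaledConv κ g (-r) x := by
  obtain ⟨A, hA0, hA⟩ := hf.exists_bound
  obtain ⟨B, hB0, hB⟩ := hg.exists_bound
  have hc := hκ.smooth.continuous
  have hfc := hf.continuous
  have hgc := hg.continuous
  have hint : ∀ u : E3 × E3 → ℝ, Continuous u → (∀ p, |u p| ≤ A * B) →
      Integrable (fun p : E3 × E3 => κ p.2 * u p) ((volume.restrict cell).prod volume) := by
    intro u hu hb
    refine ((hκ.integrable.comp_snd (volume.restrict cell : Measure E3)).abs.mul_const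
      (A * B)).mono' ?_ (Filter.Eventually.of_forall fun p => ?_)
    · exact ((hc.comp continuous_snd).mul hu).aestronglyMeasurable
    · rw [Real.norm_eq_abs, abs_mul]
      exact mul_le_mul_of_nonneg_left (hb p) (abs_nonneg _)
  have h1 := hint (fun p => f (p.1 - r • p.2) * g p.1) (by fun_prop) fun p => by
    rw [abs_mul]; exact mul_le_mul (hA _) (hB _) (abs_nonneg _) hA0
  have h2 := hint (fun p => f p.1 * g (p.1 + r • p.2)) (by fun_prop) fun p => by
    rw [abs_mul]; exact mul_le_mul (hA _) (hB _) (abs_nonneg _) hA0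
  calc ∫ x in cell, scaledConv κ f r x * g x
      = ∫ x in cell, ∫ y, κ y * (f (x - r • y) * g x) := by
        simp only [scaledConv, ← integral_mul_const, mul_assoc]
    _ = ∫ y, ∫ x in cell, κ y * (f (x - r • y) * g x) := integral_integral_swap h1
    -- For fixed `y` the integrand is periodic in `x`, so it may be translated by `r • y` without
    -- changing the integral over the cell. This turns `r` into `-r`.
    _ = ∫ y, ∫ x in cell, κ y * (f x * g (x + r • y)) := by
        congr 1 with y
        rw [integral_const_mul, integral_const_mul]
        congr 1
        have := setIntegral_cell_sub (f := fun x => f x * g (x + r • y))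
          (fun i x => by
            change f _ * g _ = f _ * g _
            rw [hf.periodic, add_right_comm, hg.periodic]) (r • y)
        simpa using this
    _ = ∫ x in cell, ∫ y, κ y * (f x * g (x + r • y)) := (integral_integral_swap h2).symm
    _ = _ := by
        congr 1 with x
        rw [scaledConv, ← integral_const_mul]
        congr 1 with y
        simp only [neg_smul, sub_neg_eq_add]
        ring

lemma setIntegral_scaledConv (hκ : IsKernel κ) (hf : IsPC f) (r : ℝ) :
    ∫ x in cell, scaledConv κ f r x = (∫ y, κ y) * ∫ x in cell, f x := by
  have h := setIntegral_scaledConv_mul hκ hf (g := fun _ => 1)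
    ⟨continuous_const, fun _ _ => rfl⟩ r
  simp only [mul_one, scaledConv_const, one_mul, integral_mul_const] at h
  rw [h, mul_comm]

end scaledConv

/-! ### Radial functions -/

/-- The radial function with profile `G`, as a function of the squared norm. -/
def radial (G : ℝ → ℝ) (x : E3) : ℝ := G (‖x‖ ^ 2)

lemma pderiv_radial {G : ℝ → ℝ} (hG : Differentiable ℝ G) (i : Fin 3) :
    pderiv i (radial G) = fun x => 2 * x i * radial (deriv G) x := by
  ext x
  have h2 : HasFDerivAt (fun y : E3 => ‖y‖ ^ 2) (2 • innerSL ℝ x) x :=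
    (hasStrictFDerivAt_norm_sq x).hasFDerivAt
  have h : HasFDerivAt (radial G) (deriv G (‖x‖ ^ 2) • (2 • innerSL ℝ x)) x :=
    (hG (‖x‖ ^ 2)).hasDerivAt.comp_hasFDerivAt x h2
  rw [pderiv, h.fderiv]
  simp [e, radial, EuclideanSpace.inner_single_right]
  ring

lemma contDiff_radial {G : ℝ → ℝ} (hG : ContDiff ℝ ∞ G) : ContDiff ℝ ∞ (radial G) :=
  hG.comp (contDiff_norm_sq ℝ)

/-- Working with `s = ‖x‖²` rather than `‖x‖` keeps radial functions smooth at the origin. The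
coefficient `6` is twice the dimension. -/
lemma sum_pderiv_pderiv_radial {G : ℝ → ℝ} (hG : ContDiff ℝ ∞ G) (x : E3) :
    ∑ i, pderiv i (pderiv i (radial G)) x =
      6 * deriv G (‖x‖ ^ 2) + 4 * ‖x‖ ^ 2 * deriv (deriv G) (‖x‖ ^ 2) := by
  have hd : Differentiable ℝ G := hG.differentiable (by simp)
  have hG1 : ContDiff ℝ ∞ (deriv G) := (contDiff_infty_iff_deriv.1 hG).2
  have hd2 : Differentiable ℝ (deriv G) := hG1.differentiable (by simp)
  have hr : Differentiable ℝ (radial (deriv G)) := (contDiff_radial hG1).differentiable (by simp)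
  have key : ∀ i, pderiv i (pderiv i (radial G)) x =
      2 * deriv G (‖x‖ ^ 2) + 4 * x i ^ 2 * deriv (deriv G) (‖x‖ ^ 2) := by
    intro i
    have hc : HasFDerivAt (fun y : E3 => y i) (EuclideanSpace.proj i : E3 →L[ℝ] ℝ) x :=
      (EuclideanSpace.proj i : E3 →L[ℝ] ℝ).hasFDerivAt
    have hm : HasFDerivAt (fun y : E3 => 2 * y i * radial (deriv G) y) _ x :=
      (hc.const_mul 2).mul (hr x).hasFDerivAt
    rw [pderiv_radial hd, pderiv, hm.fderiv]
    have h3 : fderiv ℝ (radial (deriv G)) x (e i) = 2 * x i * radial (deriv (deriv G)) x :=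
      congrFun (pderiv_radial hd2 i) x
    simp only [add_apply, smul_apply, h3, smul_eq_mul]
    simp [e, radial]
    ring
  simp only [key, Fin.sum_univ_three, EuclideanSpace.norm_sq_eq, Real.norm_eq_abs, sq_abs]
  ring

lemma isKernel_radial {G : ℝ → ℝ} (hG : ContDiff ℝ ∞ G) (h0 : ∀ s, 1 < s → G s = 0) :
    IsKernel (radial G) :=
  ⟨contDiff_radial hG, fun y hy => h0 _ (by nlinarith)⟩

/-! ### A truncated Newtonian potential -/

/-- A smooth cutoff, `1` on `(-∞, 1/4]` and `0` on `[1/2, ∞)`. -/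
def cutoff (s : ℝ) : ℝ := Real.smoothTransition (2 - 4 * s)

lemma contDiff_cutoff : ContDiff ℝ ∞ cutoff :=
  Real.smoothTransition.contDiff.comp (contDiff_const.sub (contDiff_const.mul contDiff_id))

lemma cutoff_eq_one {s : ℝ} (hs : s ≤ 1 / 4) : cutoff s = 1 :=
  Real.smoothTransition.one_of_one_le (by linarith)

lemma cutoff_eq_zero {s : ℝ} (hs : 1 / 2 ≤ s) : cutoff s = 0 :=
  Real.smoothTransition.zero_of_nonpos (by linarith)

/-- The profile of `u (|x|²) / |x|`. -/
def invSqrtMul (u : ℝ → ℝ) (s : ℝ) : ℝ := u s * s ^ (-(1 / 2) : ℝ)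

/-- The singularity of `s ^ (-1/2)` is at `0`, and `u` vanishes near it. -/
lemma contDiff_invSqrtMul {u : ℝ → ℝ} (hu : ContDiff ℝ ∞ u) {ε : ℝ} (hε : 0 < ε)
    (h0 : ∀ s, s < ε → u s = 0) : ContDiff ℝ ∞ (invSqrtMul u) := by
  rw [contDiff_iff_contDiffAt]
  intro s
  rcases lt_or_ge s ε with hs | hs
  · have : invSqrtMul u =ᶠ[nhds s] fun _ => 0 := by
      filter_upwards [Iio_mem_nhds hs] with t ht
      simp [invSqrtMul, h0 t ht]
    exact contDiffAt_const.congr_of_eventuallyEq this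
  · exact hu.contDiffAt.mul (Real.contDiffAt_rpow_const_of_ne (hε.trans_le hs).ne')

/-- The function `1/|x|` is harmonic away from the origin, so the terms with undifferentiated `u`
cancel. When `u` is a cutoff, what is left lives only where `u` is not constant. -/
lemma radial_laplacian_invSqrtMul {u : ℝ → ℝ} (hu : ContDiff ℝ ∞ u) {s : ℝ} (hs : 0 < s) :
    6 * deriv (invSqrtMul u) s + 4 * s * deriv (deriv (invSqrtMul u)) s =
      invSqrtMul (fun s => 4 * s * deriv (deriv u) s + 2 * deriv u s) s := by
  have hu1 : ContDiff ℝ ∞ (deriv u) := (contDiff_infty_iff_deriv.1 hu).2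
  have hd : Differentiable ℝ u := hu.differentiable (by simp)
  have hd1 : Differentiable ℝ (deriv u) := hu1.differentiable (by simp)
  have h1 : ∀ t, 0 < t → HasDerivAt (invSqrtMul u)
      (deriv u t * t ^ (-(1 / 2) : ℝ) + u t * (-(1 / 2) * t ^ (-(1 / 2) - 1 : ℝ))) t :=
    fun t ht => (hd t).hasDerivAt.mul (Real.hasDerivAt_rpow_const (Or.inl ht.ne'))
  have h2 : deriv (invSqrtMul u) =ᶠ[nhds s] fun t =>
      deriv u t * t ^ (-(1 / 2) : ℝ) + u t * (-(1 / 2) * t ^ (-(1 / 2) - 1 : ℝ)) := by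
    filter_upwards [Ioi_mem_nhds hs] with t ht using (h1 t ht).deriv
  have h3 := (((hd1 s).hasDerivAt.mul (Real.hasDerivAt_rpow_const (p := (-(1 / 2) : ℝ))
    (Or.inl hs.ne'))).add ((hd s).hasDerivAt.mul ((Real.hasDerivAt_rpow_const
      (p := (-(1 / 2) - 1 : ℝ)) (Or.inl hs.ne')).const_mul (-(1 / 2)))))
  have h4 : deriv (fun t => deriv u t * t ^ (-(1 / 2) : ℝ) +
      u t * (-(1 / 2) * t ^ (-(1 / 2) - 1 : ℝ))) s = _ := HasDerivAt.deriv h3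
  rw [h2.deriv_eq, (h1 s hs).deriv, h4, invSqrtMul,
    Real.rpow_sub_one hs.ne' (-(1 / 2) - 1 : ℝ), Real.rpow_sub_one hs.ne']
  field_simp
  ring

/-- The difference of two consecutive cutoffs. -/
def cutoffDiff (s : ℝ) : ℝ := cutoff (4 * s) - cutoff s

lemma contDiff_cutoffDiff : ContDiff ℝ ∞ cutoffDiff :=
  (contDiff_cutoff.comp (contDiff_const.mul contDiff_id)).sub contDiff_cutoff

/-- The profile of the Laplacian of the truncated Newtonian potential, before division by the
norm. -/
def massProfile (s : ℝ) : ℝ := 4 * s * deriv (deriv cutoff) s + 2 * deriv cutoff s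

lemma contDiff_deriv_cutoff : ContDiff ℝ ∞ (deriv cutoff) :=
  (contDiff_infty_iff_deriv.1 contDiff_cutoff).2

lemma contDiff_massProfile : ContDiff ℝ ∞ massProfile :=
  ((contDiff_const.mul contDiff_id).mul (contDiff_infty_iff_deriv.1 contDiff_deriv_cutoff).2).add
    (contDiff_const.mul contDiff_deriv_cutoff)

lemma deriv_cutoff_of_lt {s : ℝ} (hs : s < 1 / 4) : deriv cutoff s = 0 := by
  have : cutoff =ᶠ[nhds s] fun _ => 1 := by
    filter_upwards [Iio_mem_nhds hs] with t ht using cutoff_eq_one ht.le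
  simp [this.deriv_eq]

lemma deriv_cutoff_of_gt {s : ℝ} (hs : 1 / 2 < s) : deriv cutoff s = 0 := by
  have : cutoff =ᶠ[nhds s] fun _ => 0 := by
    filter_upwards [Ioi_mem_nhds hs] with t ht using cutoff_eq_zero ht.le
  simp [this.deriv_eq]

lemma massProfile_of_lt {s : ℝ} (hs : s < 1 / 4) : massProfile s = 0 := by
  have : deriv cutoff =ᶠ[nhds s] fun _ => 0 := by
    filter_upwards [Iio_mem_nhds hs] with t ht using deriv_cutoff_of_lt ht
  simp [massProfile, this.deriv_eq, deriv_cutoff_of_lt hs]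

lemma massProfile_of_gt {s : ℝ} (hs : 1 / 2 < s) : massProfile s = 0 := by
  have : deriv cutoff =ᶠ[nhds s] fun _ => 0 := by
    filter_upwards [Ioi_mem_nhds hs] with t ht using deriv_cutoff_of_gt ht
  simp [massProfile, this.deriv_eq, deriv_cutoff_of_gt hs]

lemma cutoffDiff_of_lt {s : ℝ} (hs : s < 1 / 16) : cutoffDiff s = 0 := by
  simp [cutoffDiff, cutoff_eq_one (show 4 * s ≤ 1 / 4 by linarith),
    cutoff_eq_one (show s ≤ 1 / 4 by linarith)]

lemma cutoffDiff_of_gt {s : ℝ} (hs : 1 / 2 < s) : cutoffDiff s = 0 := by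
  simp [cutoffDiff, cutoff_eq_zero (show 1 / 2 ≤ 4 * s by linarith), cutoff_eq_zero hs.le]

lemma deriv_cutoffDiff : deriv cutoffDiff = fun s => 4 * deriv cutoff (4 * s) - deriv cutoff s := by
  have hd : Differentiable ℝ cutoff := contDiff_cutoff.differentiable (by simp)
  ext s
  have h1 := (hd (4 * s)).hasDerivAt.comp s ((hasDerivAt_id s).const_mul 4)
  have h := h1.sub (hd s).hasDerivAt
  refine HasDerivAt.deriv (h.congr_deriv ?_)
  ring

lemma deriv_deriv_cutoffDiff : deriv (deriv cutoffDiff) = fun s =>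
    16 * deriv (deriv cutoff) (4 * s) - deriv (deriv cutoff) s := by
  have hd : Differentiable ℝ (deriv cutoff) := contDiff_deriv_cutoff.differentiable (by simp)
  rw [deriv_cutoffDiff]
  ext s
  have h1 := ((hd (4 * s)).hasDerivAt.comp s ((hasDerivAt_id s).const_mul 4)).const_mul 4
  have h := h1.sub (hd s).hasDerivAt
  refine HasDerivAt.deriv (h.congr_deriv ?_)
  ring

/-- The annular piece of the Newtonian potential. -/
def annularPotential : E3 → ℝ := radial (invSqrtMul cutoffDiff)

/-- The mass of the truncated Newtonian potential, away from the origin. -/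
def potentialMass : E3 → ℝ := radial (invSqrtMul massProfile)

lemma isKernel_annularPotential : IsKernel annularPotential :=
  isKernel_radial (contDiff_invSqrtMul contDiff_cutoffDiff (ε := 1 / 16) (by norm_num)
    fun _ hs => cutoffDiff_of_lt hs) fun s hs => by
      simp [invSqrtMul, cutoffDiff_of_gt (show 1 / 2 < s by linarith)]

lemma contDiff_invSqrtMul_massProfile : ContDiff ℝ ∞ (invSqrtMul massProfile) :=
  contDiff_invSqrtMul contDiff_massProfile (ε := 1 / 4) (by norm_num)
    fun _ hs => massProfile_of_lt hs

lemma isKernel_potentialMass : IsKernel potentialMass :=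
  isKernel_radial contDiff_invSqrtMul_massProfile fun s hs => by
      simp [invSqrtMul, massProfile_of_gt (show 1 / 2 < s by linarith)]

/-- With `F(x) = cutoff(|x|²)/|x|`, homogeneity of `1/|x|` gives `cutoff(4|x|²)/|x| = 2 F(2x)`. Away
from the origin its Laplacian is `2 · 4 · (ΔF)(2x)`, whence the factor `8 = 2³` that preserves the
integral of the rescaled mass. -/
lemma laplacian_annularPotential (x : E3) :
    ∑ i, pderiv i (pderiv i annularPotential) x =
      8 * potentialMass ((2 : ℝ) • x) - potentialMass x := by
  have hsm := contDiff_invSqrtMul contDiff_cutoffDiff (ε := 1 / 16) (by norm_num)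
    fun _ hs => cutoffDiff_of_lt hs
  rw [annularPotential, sum_pderiv_pderiv_radial hsm]
  simp only [potentialMass, radial, norm_smul, mul_pow]
  generalize ‖x‖ ^ 2 = s
  rw [show ‖(2 : ℝ)‖ ^ 2 = 4 by norm_num]
  -- The formula for the Laplacian of a profile with `s ^ (-1/2)` needs `s > 0`; near the origin
  -- everything vanishes.
  rcases lt_or_ge s (1 / 16) with hs | hs
  · have h0 : invSqrtMul cutoffDiff =ᶠ[nhds s] fun _ => 0 := by
      filter_upwards [Iio_mem_nhds hs] with t ht
      simp [invSqrtMul, cutoffDiff_of_lt ht]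
    have h1 := h0.deriv
    rw [h0.deriv_eq, h1.deriv_eq]
    simp [invSqrtMul, massProfile_of_lt (show s < 1 / 4 by linarith),
      massProfile_of_lt (show 4 * s < 1 / 4 by linarith)]
  · have hs0 : 0 < s := by linarith
    rw [radial_laplacian_invSqrtMul contDiff_cutoffDiff hs0]
    have h4 : (4 * s) ^ (-(1 / 2) : ℝ) = 1 / 2 * s ^ (-(1 / 2) : ℝ) := by
      rw [Real.mul_rpow (by norm_num) hs0.le, Real.rpow_neg (by norm_num), ← Real.sqrt_eq_rpow,
        show (4 : ℝ) = 2 ^ 2 by norm_num, Real.sqrt_sq (by norm_num)]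
      norm_num
    simp only [invSqrtMul, massProfile, deriv_deriv_cutoffDiff, h4]
    rw [deriv_cutoffDiff]
    ring

/-- In polar coordinates the radial integrand is an exact derivative, so the mass depends only on
the value of `cutoff` at the origin. Positivity makes normalization to integral one possible. -/
lemma integral_potentialMass_pos : 0 < ∫ x, potentialMass x := by
  have h := integral_fun_norm_addHaar (volume : Measure E3)
    (fun t => invSqrtMul massProfile (t ^ 2))
  have hd : Differentiable ℝ cutoff := contDiff_cutoff.differentiable (by simp)
  have hd1 : Differentiable ℝ (deriv cutoff) := contDiff_deriv_cutoff.differentiable (by simp)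
  -- `W` is a primitive on `(0, ∞)` of `y² · massProfile(y²) / y`. It rises from `-1` at `0` to `0`
  -- at infinity.
  set W : ℝ → ℝ := fun y => 2 * y ^ 2 * deriv cutoff (y ^ 2) - cutoff (y ^ 2) with hW
  have hWs : ContDiff ℝ 1 W := by
    have h1 : ContDiff ℝ 1 cutoff := contDiff_cutoff.of_le (by simp)
    have h2 : ContDiff ℝ 1 (deriv cutoff) := contDiff_deriv_cutoff.of_le (by simp)
    fun_prop
  have hWc : HasCompactSupport W := by
    refine HasCompactSupport.intro (isCompact_Icc (a := (-1 : ℝ)) (b := 1)) fun y hy => ?_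
    have hy2 : 1 < y ^ 2 := by
      rw [Set.mem_Icc, not_and_or] at hy
      rcases hy with hy | hy <;> nlinarith
    simp [hW, cutoff_eq_zero (show 1 / 2 ≤ y ^ 2 by linarith),
      deriv_cutoff_of_gt (show 1 / 2 < y ^ 2 by linarith)]
  have hint := HasCompactSupport.integral_Ioi_deriv_eq hWs hWc 0
  have hW0 : W 0 = -1 := by simp [hW, cutoff_eq_one]
  have heq : ∫ y in Set.Ioi (0 : ℝ), y ^ 2 * invSqrtMul massProfile (y ^ 2) = 1 := by
    rw [hW0, neg_neg] at hint
    rw [← hint]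
    refine setIntegral_congr_fun measurableSet_Ioi fun y hy => ?_
    have hy0 : 0 < y := hy
    have hsq : HasDerivAt (fun y : ℝ => y ^ 2) (2 * y) y := by simpa using hasDerivAt_pow 2 y
    have hWd := ((hsq.const_mul 2).mul ((hd1 (y ^ 2)).hasDerivAt.comp y hsq)).sub
      ((hd (y ^ 2)).hasDerivAt.comp y hsq)
    have hq : (y ^ 2) ^ (-(1 / 2) : ℝ) = y⁻¹ := by
      rw [Real.rpow_neg (by positivity), ← Real.sqrt_eq_rpow, Real.sqrt_sq hy0.le]
    rw [show deriv W y = _ from HasDerivAt.deriv hWd]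
    simp only [invSqrtMul, massProfile, hq, Function.comp_apply]
    field_simp
    ring
  have h2 : ∫ x, potentialMass x = ∫ x : E3, invSqrtMul massProfile (‖x‖ ^ 2) := rfl
  have hdim : Module.finrank ℝ E3 = 3 := by simp
  rw [h2, h, hdim]
  simp only [smul_eq_mul, nsmul_eq_mul]
  rw [show 3 - 1 = 2 from rfl, heq]
  have hv : 0 < volume.real (Metric.ball (0 : E3) 1) := by
    rw [Measure.real, ENNReal.toReal_pos_iff]
    exact ⟨Metric.measure_ball_pos volume (0 : E3) one_pos, measure_ball_lt_top⟩
  positivity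

/-- An even mollifier `ρ` with integral one, and a kernel `h` with `Δ h = 8 ρ (2 ·) - ρ`. -/
lemma exists_mollifier_potential : ∃ ρ h : E3 → ℝ, IsKernel ρ ∧ IsKernel h ∧
    (∀ y, ρ (-y) = ρ y) ∧ ∫ y, ρ y = 1 ∧
    ∀ y, ∑ i, pderiv i (pderiv i h) y = 8 * ρ ((2 : ℝ) • y) - ρ y := by
  set c := (∫ x, potentialMass x)⁻¹
  have hk : ∀ {κ : E3 → ℝ}, IsKernel κ → IsKernel fun y => c * κ y := fun hκ =>
    ⟨contDiff_const.mul hκ.smooth, fun y hy => by simp [hκ.eq_zero y hy]⟩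
  refine ⟨fun y => c * potentialMass y, fun y => c * annularPotential y,
    hk isKernel_potentialMass, hk isKernel_annularPotential, fun y => ?_, ?_, fun y => ?_⟩
  · simp [potentialMass, radial]
  · rw [integral_const_mul]
    exact inv_mul_cancel₀ integral_potentialMass_pos.ne'
  · have h := fun i => isKernel_annularPotential.pderiv i
    simp only [pderiv_const_mul isKernel_annularPotential.differentiable,
      pderiv_const_mul (h _).differentiable, ← Finset.mul_sum, laplacian_annularPotential]
    ring

/-! ### Means, mollification at a large scale, and the resolvent -/

/-- An even mollifier with integral one. -/
def mollifier : E3 → ℝ := exists_mollifier_potential.choose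

/-- A kernel `h` such that `Δ h = 8 ρ (2 ·) - ρ`, where `ρ` is the mollifier. -/
def potentialPiece : E3 → ℝ := exists_mollifier_potential.choose_spec.choose

lemma isKernel_mollifier : IsKernel mollifier :=
  exists_mollifier_potential.choose_spec.choose_spec.1

lemma isKernel_potentialPiece : IsKernel potentialPiece :=
  exists_mollifier_potential.choose_spec.choose_spec.2.1

lemma mollifier_even (y : E3) : mollifier (-y) = mollifier y :=
  exists_mollifier_potential.choose_spec.choose_spec.2.2.1 y

lemma integral_mollifier : ∫ y, mollifier y = 1 :=
  exists_mollifier_potential.choose_spec.choose_spec.2.2.2.1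

lemma laplacian_potentialPiece (y : E3) : ∑ i, pderiv i (pderiv i potentialPiece) y =
    8 * mollifier ((2 : ℝ) • y) - mollifier y :=
  exists_mollifier_potential.choose_spec.choose_spec.2.2.2.2 y

/-- The mean of a function over the torus. -/
def mean (f : E3 → ℝ) : ℝ := (volume.real cell)⁻¹ * ∫ x in cell, f x

lemma mean_const (c : ℝ) : mean (fun _ => c) = c := by
  have := volume_real_cell_pos.ne'
  simp [mean]
  field_simp

lemma mean_add {f g : E3 → ℝ} (hf : IsPC f) (hg : IsPC g) :
    mean (fun x => f x + g x) = mean f + mean g := by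
  rw [mean, integral_add hf.integrableOn hg.integrableOn, mul_add, mean, mean]

lemma mean_sub {f g : E3 → ℝ} (hf : IsPC f) (hg : IsPC g) :
    mean (fun x => f x - g x) = mean f - mean g := by
  rw [mean, integral_sub hf.integrableOn hg.integrableOn, mul_sub, mean, mean]

lemma mean_const_mul (c : ℝ) (f : E3 → ℝ) : mean (fun x => c * f x) = c * mean f := by
  rw [mean, integral_const_mul, mean]
  ring

lemma abs_mean_le {f : E3 → ℝ} {M : ℝ} (h : ∀ x ∈ cell, |f x| ≤ M) : |mean f| ≤ M := by
  rw [mean, abs_mul, abs_of_pos (inv_pos.2 volume_real_cell_pos),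
    inv_mul_le_iff₀ volume_real_cell_pos, mul_comm]
  exact norm_setIntegral_le_of_norm_le_const volume_cell_lt_top (f := f) h

namespace IsPC

variable {f g : E3 → ℝ}

lemma const (c : ℝ) : IsPC fun _ => c := ⟨continuous_const, fun _ _ => rfl⟩

lemma add (hf : IsPC f) (hg : IsPC g) : IsPC fun x => f x + g x :=
  ⟨hf.continuous.add hg.continuous, fun i x => by simp [hf.periodic i x, hg.periodic i x]⟩

lemma sub (hf : IsPC f) (hg : IsPC g) : IsPC fun x => f x - g x :=
  ⟨hf.continuous.sub hg.continuous, fun i x => by simp [hf.periodic i x, hg.periodic i x]⟩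

lemma mul (hf : IsPC f) (hg : IsPC g) : IsPC fun x => f x * g x :=
  ⟨hf.continuous.mul hg.continuous, fun i x => by simp [hf.periodic i x, hg.periodic i x]⟩

lemma const_mul (c : ℝ) (hf : IsPC f) : IsPC fun x => c * f x := (const c).mul hf

lemma sum {ι : Type*} (s : Finset ι) {f : ι → E3 → ℝ} (hf : ∀ a ∈ s, IsPC (f a)) :
    IsPC fun x => ∑ a ∈ s, f a x :=
  ⟨continuous_finsetSum _ fun a ha => (hf a ha).continuous,
    fun i x => Finset.sum_congr rfl fun a ha => (hf a ha).periodic i x⟩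

lemma of_test (hf : f ∈ TestFunction) : IsPC f := ⟨hf.1.continuous, hf.2⟩

lemma tsum {f : ℕ → E3 → ℝ} {u : ℕ → ℝ} (hf : ∀ k, IsPC (f k)) (hu : Summable u)
    (h : ∀ k x, |f k x| ≤ u k) : IsPC fun x => ∑' k, f k x :=
  ⟨continuous_tsum (fun k => (hf k).continuous) hu h,
    fun i x => tsum_congr fun k => (hf k).periodic i x⟩

end IsPC

/-- Mollification preserves the integral. After mollifying, the derivative can be moved to the
kernel, whose derivative has integral zero. -/
lemma mean_pderiv {f : E3 → ℝ} (hf : IsPC f) (hd : ContDiff ℝ 1 f) (i : Fin 3) :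
    mean (pderiv i f) = 0 := by
  have hp : IsPC (pderiv i f) :=
    ⟨(hd.continuous_fderiv one_ne_zero).clm_apply continuous_const, hf.periodic.pderiv i⟩
  have h1 := setIntegral_scaledConv isKernel_mollifier hp 1
  rw [← pderiv_scaledConv isKernel_mollifier hf hd, pderiv_scaledConv_kernel isKernel_mollifier
    hf.continuous one_ne_zero, integral_const_mul,
    setIntegral_scaledConv (isKernel_mollifier.pderiv i) hf, isKernel_mollifier.integral_pderiv,
    integral_mollifier] at h1
  rw [one_mul, zero_mul, mul_zero] at h1
  rw [mean, ← h1, mul_zero]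

/-- Mollifying at scale `R` makes the gradient `O(M/R)` while preserving the mean. On a cell of
bounded diameter the result is therefore close to its mean once `R` is large. -/
lemma exists_contraction_scale : ∃ R : ℝ, 0 < R ∧ ∀ f : E3 → ℝ, IsPC f → ∀ M, (∀ x, |f x| ≤ M) →
    ∀ x, |scaledConv mollifier f R x - mean f| ≤ 1 / 2 * M := by
  set C := ∑ i, l1Norm (pderiv i mollifier) with hC
  have hC0 : 0 ≤ C := Finset.sum_nonneg fun i _ => l1Norm_nonneg _
  have hCi : ∀ i, l1Norm (pderiv i mollifier) ≤ C := fun i =>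
    Finset.single_le_sum (f := fun i => l1Norm (pderiv i mollifier))
      (fun i _ => l1Norm_nonneg _) (Finset.mem_univ i)
  -- The Lipschitz constant is `3CM/R` and two points of the cell are at distance at most `12`, so
  -- `36C/R ≤ 1/2` is required. The `+ 1` keeps `R` positive.
  refine ⟨72 * C + 1, by positivity, fun f hf M hM x => ?_⟩
  set R := 72 * C + 1 with hR
  have hR0 : 0 < R := by positivity
  have hM0 : 0 ≤ M := (abs_nonneg _).trans (hM 0)
  set u := scaledConv mollifier f R with hu
  have hupc : IsPC u := hf.scaledConv isKernel_mollifier R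
  have hder : ∀ i x, |pderiv i u x| ≤ R⁻¹ * (C * M) := by
    intro i x
    rw [hu, pderiv_scaledConv_kernel isKernel_mollifier hf.continuous hR0.ne', abs_mul,
      abs_of_pos (inv_pos.2 hR0)]
    refine mul_le_mul_of_nonneg_left ?_ (inv_pos.2 hR0).le
    exact (abs_scaledConv_le (isKernel_mollifier.pderiv i) hM R x).trans
      (mul_le_mul_of_nonneg_right (hCi i) hM0)
  have hlip := abs_sub_le_of_pderiv_le
    (differentiable_scaledConv isKernel_mollifier hf.continuous hR0.ne') hder
  have hmean : mean u = mean f := by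
    rw [mean, hu, setIntegral_scaledConv isKernel_mollifier hf, integral_mollifier, one_mul, mean]
  have hconst : R⁻¹ * (C * M) * 36 ≤ 1 / 2 * M := by
    rw [inv_mul_eq_div, div_mul_eq_mul_div, div_le_iff₀ hR0, hR]
    nlinarith
  obtain ⟨g, hg, hx⟩ := exists_mem_cell x
  rw [← hupc.periodic.add_lattice hg x, ← hmean, ← mean_const (u (g + x)),
    ← mean_sub (IsPC.const _) hupc]
  refine abs_mean_le fun y hy => (hlip _ _).trans ?_
  have h12 : ‖g + x - y‖ ≤ 12 := (norm_sub_le _ _).trans (by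
    linarith [norm_le_of_mem_cell hx, norm_le_of_mem_cell hy])
  have hRCM : 0 ≤ R⁻¹ * (C * M) := by positivity
  nlinarith

/-- The scale at which mollification is a contraction on functions of mean zero. -/
def baseScale : ℝ := exists_contraction_scale.choose

lemma baseScale_pos : 0 < baseScale := exists_contraction_scale.choose_spec.1

/-- Mollification at the base scale, on the mean-free part. -/
def smear (f : E3 → ℝ) (x : E3) : ℝ := scaledConv mollifier f baseScale x - mean f

lemma abs_smear_le {f : E3 → ℝ} (hf : IsPC f) {M : ℝ} (hM : ∀ x, |f x| ≤ M) (x : E3) :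
    |smear f x| ≤ 1 / 2 * M :=
  exists_contraction_scale.choose_spec.2 f hf M hM x

lemma IsPC.smear {f : E3 → ℝ} (hf : IsPC f) : IsPC (smear f) :=
  (hf.scaledConv isKernel_mollifier _).sub (IsPC.const _)

lemma smear_add {f g : E3 → ℝ} (hf : IsPC f) (hg : IsPC g) (x : E3) :
    smear (fun x => f x + g x) x = smear f x + smear g x := by
  rw [smear, mean_add hf hg, scaledConv_add isKernel_mollifier hf.continuous hg.continuous, smear,
    smear]
  ring

lemma smear_const_mul (c : ℝ) (f : E3 → ℝ) (x : E3) :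
    smear (fun x => c * f x) x = c * smear f x := by
  rw [smear, mean_const_mul, scaledConv_const_mul, smear]
  ring

lemma smear_sub {f g : E3 → ℝ} (hf : IsPC f) (hg : IsPC g) (x : E3) :
    smear (fun x => f x - g x) x = smear f x - smear g x := by
  have h := smear_add hf (hg.const_mul (-1)) x
  rw [smear_const_mul] at h
  simpa [sub_eq_add_neg] using h

lemma setIntegral_smear_mul {f g : E3 → ℝ} (hf : IsPC f) (hg : IsPC g) :
    ∫ x in cell, smear f x * g x = ∫ x in cell, f x * smear g x := by
  have h1 : ∫ x in cell, smear f x * g x =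
      (∫ x in cell, scaledConv mollifier f baseScale x * g x) - mean f * ∫ x in cell, g x := by
    rw [← integral_const_mul, ← integral_sub
      ((hf.scaledConv isKernel_mollifier _).mul hg).integrableOn (hg.const_mul _).integrableOn]
    simp only [smear, sub_mul]
  have h2 : ∫ x in cell, f x * smear g x =
      (∫ x in cell, f x * scaledConv mollifier g baseScale x) - mean g * ∫ x in cell, f x := by
    rw [← integral_const_mul, ← integral_sub
      (hf.mul (hg.scaledConv isKernel_mollifier _)).integrableOn (hf.const_mul _).integrableOn]
    simp only [smear, mul_sub, mul_comm (mean g)]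
  rw [h1, h2, setIntegral_scaledConv_mul isKernel_mollifier hf hg,
    funext (scaledConv_neg_of_even mollifier_even baseScale), mean, mean]
  ring

/-- Continuity of `f` suffices, so `resolvent f - f`, which is a smeared function, is always smooth.
-/
lemma smear_mem_test {f : E3 → ℝ} (hf : IsPC f) : smear f ∈ TestFunction :=
  ⟨(contDiff_scaledConv isKernel_mollifier hf.continuous baseScale_pos.ne').sub contDiff_const,
    hf.smear.periodic⟩

lemma pderiv_smear {f : E3 → ℝ} (hf : f ∈ TestFunction) (i : Fin 3) :
    pderiv i (smear f) = smear (pderiv i f) := by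
  have hpc := IsPC.of_test hf
  have hd : ContDiff ℝ 1 f := hf.1.of_le (by simp)
  have h := pderiv_sub (differentiable_scaledConv isKernel_mollifier hpc.continuous
    baseScale_pos.ne') (differentiable_const (mean f)) i
  rw [pderiv_const, pderiv_scaledConv isKernel_mollifier hpc hd] at h
  ext x
  have h2 := congrFun h x
  simp only [sub_zero] at h2
  rw [smear, mean_pderiv hpc hd, sub_zero, ← h2]
  rfl

lemma smear_fixed_eq_zero {f : E3 → ℝ} (hf : IsPC f) (h : ∀ x, f x = smear f x) : f = 0 := by
  obtain ⟨M, hM0, hM⟩ := hf.exists_bound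
  have hn : ∀ (n : ℕ) x, |f x| ≤ (1 / 2) ^ n * M := by
    intro n
    induction n with
    | zero => simpa using hM
    | succ n ih =>
      intro x
      rw [h x]
      refine (abs_smear_le hf ih x).trans (le_of_eq ?_)
      ring
  ext x
  have ht : Filter.Tendsto (fun n : ℕ => (1 / 2 : ℝ) ^ n * M) Filter.atTop (nhds 0) := by
    simpa using (tendsto_pow_atTop_nhds_zero_of_lt_one (by norm_num)
      (by norm_num : (1 / 2 : ℝ) < 1)).mul_const M
  have := ge_of_tendsto' ht fun n => hn n x
  simpa using this

/-- Banach's fixed point theorem for `u ↦ f + smear u` on the complete space of bounded continuous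
periodic functions, with contraction factor `1/2`. -/
lemma exists_resolvent {f : E3 → ℝ} (hf : IsPC f) :
    ∃ g, IsPC g ∧ ∀ x, g x = f x + smear g x := by
  let X := {u : BoundedContinuousFunction E3 ℝ // IsPeriodic (u : E3 → ℝ)}
  have hclosed : IsClosed {u : BoundedContinuousFunction E3 ℝ | IsPeriodic (u : E3 → ℝ)} := by
    simp only [IsPeriodic, Set.ofPred_forall]
    refine isClosed_iInter fun i => isClosed_iInter fun x => isClosed_eq ?_ ?_
    · exact (ContinuousEvalConst.continuous_eval_const _)
    · exact (ContinuousEvalConst.continuous_eval_const _)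
  have : CompleteSpace X := hclosed.completeSpace_coe
  have hX : ∀ u : X, IsPC (u.1 : E3 → ℝ) := fun u => ⟨u.1.continuous, u.2⟩
  have hmk : ∀ u : E3 → ℝ, IsPC u → ∃ U : X, ∀ x, U.1 x = u x := fun u hu => by
    obtain ⟨M, -, hM⟩ := hu.exists_bound
    exact ⟨⟨BoundedContinuousFunction.ofNormedAddCommGroup u hu.continuous M hM, hu.periodic⟩,
      fun x => rfl⟩
  choose Φ hΦ using fun u : X => hmk _ (hf.add (hX u).smear)
  have : Nonempty X := (hmk f hf).nonempty
  have hcon : ContractingWith (1 / 2) Φ := by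
    refine ⟨by rw [← NNReal.coe_lt_coe]; norm_num, LipschitzWith.of_dist_le_mul fun u v => ?_⟩
    rw [Subtype.dist_eq, BoundedContinuousFunction.dist_le (by positivity)]
    intro x
    rw [hΦ, hΦ, Real.dist_eq, add_sub_add_left_eq_sub, ← smear_sub (hX u) (hX v)]
    have h := abs_smear_le ((hX u).sub (hX v)) (M := dist u v) (fun y => by
      rw [← Real.dist_eq]
      exact BoundedContinuousFunction.dist_coe_le_dist y) x
    simpa using h
  refine ⟨_, hX (ContractingWith.fixedPoint Φ hcon), fun x => ?_⟩
  rw [← hΦ, hcon.fixedPoint_isFixedPt]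

open Classical in
/-- The solution `g` of `g - smear g = f`. -/
def resolvent (f : E3 → ℝ) : E3 → ℝ :=
  if hf : IsPC f then (exists_resolvent hf).choose else 0

lemma IsPC.resolvent {f : E3 → ℝ} (hf : IsPC f) : IsPC (resolvent f) := by
  rw [Torus3.resolvent, dif_pos hf]
  exact (exists_resolvent hf).choose_spec.1

lemma resolvent_eq {f : E3 → ℝ} (hf : IsPC f) (x : E3) :
    resolvent f x = f x + smear (resolvent f) x := by
  rw [resolvent, dif_pos hf]
  exact (exists_resolvent hf).choose_spec.2 x

/-- The difference of two solutions is fixed by the contraction. This uniqueness is how linearity of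
`resolvent` and its commutation with derivatives are obtained. -/
lemma eq_resolvent {f g : E3 → ℝ} (hf : IsPC f) (hg : IsPC g)
    (h : ∀ x, g x = f x + smear g x) : g = resolvent f := by
  have h0 := smear_fixed_eq_zero (hg.sub hf.resolvent) fun x => by
    rw [smear_sub hg hf.resolvent, h x, resolvent_eq hf x]
    ring
  ext x
  have := congrFun h0 x
  simpa [sub_eq_zero] using this

/-- The constant is `1 / (1 - 1/2)`. Feeding any bound `B` into the fixed point equation `n` times
improves it to `2M + 2⁻ⁿ B`. -/
lemma abs_resolvent_le {f : E3 → ℝ} (hf : IsPC f) {M : ℝ} (hM : ∀ x, |f x| ≤ M) (x : E3) :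
    |resolvent f x| ≤ 2 * M := by
  obtain ⟨B, hB0, hB⟩ := hf.resolvent.exists_bound
  have hn : ∀ (n : ℕ) x, |resolvent f x| ≤ 2 * M + (1 / 2) ^ n * B := by
    intro n
    induction n with
    | zero =>
      intro x
      have := (abs_nonneg _).trans (hM x)
      simpa using (hB x).trans (by linarith)
    | succ n ih =>
      intro x
      rw [resolvent_eq hf x]
      refine (abs_add_le _ _).trans ((add_le_add (hM x)
        (abs_smear_le hf.resolvent ih x)).trans (le_of_eq ?_))
      ring
  have ht : Filter.Tendsto (fun n : ℕ => 2 * M + (1 / 2 : ℝ) ^ n * B) Filter.atTop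
      (nhds (2 * M)) := by
    simpa using ((tendsto_pow_atTop_nhds_zero_of_lt_one (by norm_num)
      (by norm_num : (1 / 2 : ℝ) < 1)).mul_const B).const_add (2 * M)
  exact ge_of_tendsto' ht fun n => hn n x

lemma resolvent_add {f g : E3 → ℝ} (hf : IsPC f) (hg : IsPC g) :
    resolvent (fun x => f x + g x) = fun x => resolvent f x + resolvent g x :=
  (eq_resolvent (hf.add hg) (hf.resolvent.add hg.resolvent) fun x => by
    rw [smear_add hf.resolvent hg.resolvent]
    conv_lhs => rw [resolvent_eq hf, resolvent_eq hg]
    ring).symm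

lemma resolvent_const_mul (c : ℝ) {f : E3 → ℝ} (hf : IsPC f) :
    resolvent (fun x => c * f x) = fun x => c * resolvent f x :=
  (eq_resolvent (hf.const_mul c) (hf.resolvent.const_mul c) fun x => by
    rw [smear_const_mul]
    conv_lhs => rw [resolvent_eq hf]
    ring).symm

/-- The operator `1 - smear` is symmetric because the mollifier is even, and the inverse of a
symmetric operator is symmetric. -/
lemma setIntegral_resolvent_mul {f g : E3 → ℝ} (hf : IsPC f) (hg : IsPC g) :
    ∫ x in cell, resolvent f x * g x = ∫ x in cell, f x * resolvent g x := by
  have h1 : ∫ x in cell, resolvent f x * g x = (∫ x in cell, resolvent f x * resolvent g x) -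
      ∫ x in cell, resolvent f x * smear (resolvent g) x := by
    rw [← integral_sub (hf.resolvent.mul hg.resolvent).integrableOn
      (hf.resolvent.mul hg.resolvent.smear).integrableOn]
    refine integral_congr_ae (Filter.Eventually.of_forall fun x => ?_)
    simp only
    rw [resolvent_eq hg x]
    ring
  have h2 : ∫ x in cell, f x * resolvent g x = (∫ x in cell, resolvent f x * resolvent g x) -
      ∫ x in cell, smear (resolvent f) x * resolvent g x := by
    rw [← integral_sub (hf.resolvent.mul hg.resolvent).integrableOn
      (hf.resolvent.smear.mul hg.resolvent).integrableOn]
    refine integral_congr_ae (Filter.Eventually.of_forall fun x => ?_)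
    simp only
    rw [resolvent_eq hf x]
    ring
  rw [h1, h2, setIntegral_smear_mul hf.resolvent hg.resolvent]

lemma resolvent_mem_test {f : E3 → ℝ} (hf : f ∈ TestFunction) : resolvent f ∈ TestFunction := by
  have hpc := IsPC.of_test hf
  have : resolvent f = f + smear (resolvent f) := funext fun x => resolvent_eq hpc x
  rw [this]
  exact TestFunction.add_mem hf (smear_mem_test hpc.resolvent)

lemma pderiv_resolvent {f : E3 → ℝ} (hf : f ∈ TestFunction) (i : Fin 3) :
    pderiv i (resolvent f) = resolvent (pderiv i f) := by
  have hpc := IsPC.of_test hf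
  have hr := resolvent_mem_test hf
  refine eq_resolvent (IsPC.of_test (pderiv_mem i hf)) (IsPC.of_test (pderiv_mem i hr))
    fun x => ?_
  have : resolvent f = fun x => f x + smear (resolvent f) x := funext fun x => resolvent_eq hpc x
  conv_lhs => rw [this]
  rw [pderiv_add (hf.1.differentiable (by simp))
    ((smear_mem_test hpc.resolvent).1.differentiable (by simp)), pderiv_smear hr]

lemma mean_smear {f : E3 → ℝ} (hf : IsPC f) : mean (smear f) = 0 := by
  have h := mean_sub (hf.scaledConv isKernel_mollifier baseScale) (IsPC.const (mean f))
  rw [mean_const] at h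
  have h2 : mean (scaledConv mollifier f baseScale) = mean f := by
    rw [mean, setIntegral_scaledConv isKernel_mollifier hf, integral_mollifier, one_mul, mean]
  rw [h2, sub_self] at h
  exact h

lemma mean_resolvent {f : E3 → ℝ} (hf : IsPC f) : mean (resolvent f) = mean f := by
  have h := mean_add hf hf.resolvent.smear
  rw [mean_smear hf.resolvent, add_zero] at h
  rw [← h]
  exact congrArg mean (funext fun x => resolvent_eq hf x)

/-! ### The dyadic potential and the inverse Laplacian -/

lemma differentiable_tsum_pderiv {f : ℕ → E3 → ℝ} {u v : ℕ → ℝ} (hu : Summable u)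
    (hv : Summable v) (hd : ∀ k, Differentiable ℝ (f k)) (hf : ∀ k x, |f k x| ≤ u k)
    (hp : ∀ k i x, |pderiv i (f k) x| ≤ v k) :
    Differentiable ℝ (fun x => ∑' k, f k x) ∧
      ∀ i, pderiv i (fun x => ∑' k, f k x) = fun x => ∑' k, pderiv i (f k) x := by
  have hs : ∀ x, Summable fun k => f k x := fun x =>
    Summable.of_norm_bounded hu fun k => hf k x
  have hb : ∀ k x, ‖fderiv ℝ (f k) x‖ ≤ 3 * v k := fun k x => norm_fderiv_le fun i => hp k i x
  have hv3 := hv.mul_left 3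
  have h : ∀ x, HasFDerivAt (fun x => ∑' k, f k x) (∑' k, fderiv ℝ (f k) x) x := fun x =>
    hasFDerivAt_tsum hv3 (fun k y => (hd k y).hasFDerivAt) hb (hs 0) x
  refine ⟨fun x => (h x).differentiableAt, fun i => funext fun x => ?_⟩
  have hsum : Summable fun k => fderiv ℝ (f k) x := Summable.of_norm_bounded hv3 fun k => hb k x
  rw [pderiv, (h x).fderiv]
  exact (ContinuousLinearMap.apply ℝ ℝ (e i)).map_tsum hsum

/-- The dyadic scales. -/
def dyadicScale (k : ℕ) : ℝ := baseScale * (1 / 2) ^ k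

lemma dyadicScale_pos (k : ℕ) : 0 < dyadicScale k := mul_pos baseScale_pos (by positivity)

lemma dyadicScale_succ (k : ℕ) : dyadicScale (k + 1) = dyadicScale k / 2 := by
  rw [dyadicScale, dyadicScale]
  ring

lemma dyadicScale_rpow (θ : ℝ) (k : ℕ) :
    dyadicScale k ^ θ = baseScale ^ θ * ((1 / 2 : ℝ) ^ θ) ^ k := by
  rw [dyadicScale, Real.mul_rpow baseScale_pos.le (by positivity), ← Real.rpow_natCast,
    ← Real.rpow_natCast, ← Real.rpow_mul (by norm_num), ← Real.rpow_mul (by norm_num), mul_comm θ]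

lemma summable_dyadicScale_rpow {θ : ℝ} (hθ : 0 < θ) : Summable fun k => dyadicScale k ^ θ := by
  simp only [dyadicScale_rpow]
  exact (summable_geometric_of_lt_one (by positivity)
    (Real.rpow_lt_one (by norm_num) (by norm_num) hθ)).mul_left _

lemma summable_dyadicScale_sq : Summable fun k => dyadicScale k ^ 2 := by
  simpa using summable_dyadicScale_rpow (θ := 2) (by norm_num)

/-- Convolution with the truncated Newtonian potential, as a sum over dyadic scales. -/
def potential (f : E3 → ℝ) (x : E3) : ℝ :=
  ∑' k, dyadicScale k ^ 2 * scaledConv potentialPiece f (dyadicScale k) x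

/-- A bound for the norm of the potential operator. -/
def potentialBound : ℝ := ∑' k, dyadicScale k ^ 2 * l1Norm potentialPiece

lemma abs_potential_term_le {f : E3 → ℝ} {M : ℝ} (hM : ∀ x, |f x| ≤ M) (k : ℕ) (x : E3) :
    |dyadicScale k ^ 2 * scaledConv potentialPiece f (dyadicScale k) x| ≤
      dyadicScale k ^ 2 * l1Norm potentialPiece * M := by
  rw [abs_mul, abs_of_nonneg (sq_nonneg (dyadicScale k)), mul_assoc]
  exact mul_le_mul_of_nonneg_left (abs_scaledConv_le isKernel_potentialPiece hM _ _) (sq_nonneg _)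

lemma summable_potential_bound (M : ℝ) :
    Summable fun k => dyadicScale k ^ 2 * l1Norm potentialPiece * M :=
  (summable_dyadicScale_sq.mul_right _).mul_right _

lemma IsPC.summable_potential {f : E3 → ℝ} (hf : IsPC f) (x : E3) :
    Summable fun k => dyadicScale k ^ 2 * Torus3.scaledConv potentialPiece f (dyadicScale k) x := by
  obtain ⟨M, -, hM⟩ := hf.exists_bound
  exact Summable.of_norm_bounded (summable_potential_bound M)
    fun k => abs_potential_term_le hM k x

lemma abs_potential_le {f : E3 → ℝ} {M : ℝ} (hM : ∀ x, |f x| ≤ M) (x : E3) :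
    |potential f x| ≤ potentialBound * M := by
  have h := tsum_of_norm_bounded (summable_potential_bound M).hasSum
    (f := fun k => dyadicScale k ^ 2 * scaledConv potentialPiece f (dyadicScale k) x)
    fun k => abs_potential_term_le hM k x
  rwa [tsum_mul_right] at h

lemma IsPC.potential_term {f : E3 → ℝ} (hf : IsPC f) (k : ℕ) :
    IsPC fun x => dyadicScale k ^ 2 * Torus3.scaledConv potentialPiece f (dyadicScale k) x :=
  (hf.scaledConv isKernel_potentialPiece _).const_mul _

lemma IsPC.potential {f : E3 → ℝ} (hf : IsPC f) : IsPC (potential f) := by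
  obtain ⟨M, -, hM⟩ := hf.exists_bound
  exact IsPC.tsum hf.potential_term (summable_potential_bound M)
    fun k x => abs_potential_term_le hM k x

lemma potential_add {f g : E3 → ℝ} (hf : IsPC f) (hg : IsPC g) :
    potential (fun x => f x + g x) = fun x => potential f x + potential g x := by
  ext x
  rw [potential, potential, potential, ← (hf.summable_potential x).tsum_add
    (hg.summable_potential x)]
  refine tsum_congr fun k => ?_
  rw [scaledConv_add isKernel_potentialPiece hf.continuous hg.continuous, mul_add]

lemma potential_const_mul (c : ℝ) (f : E3 → ℝ) :
    potential (fun x => c * f x) = fun x => c * potential f x := by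
  ext x
  rw [potential, potential, ← tsum_mul_left]
  refine tsum_congr fun k => ?_
  rw [scaledConv_const_mul]
  ring

lemma TestFunction.contDiff_one {f : E3 → ℝ} (hf : f ∈ TestFunction) : ContDiff ℝ 1 f :=
  hf.1.of_le (by simp)

lemma TestFunction.differentiable {f : E3 → ℝ} (hf : f ∈ TestFunction) : Differentiable ℝ f :=
  hf.1.differentiable (by simp)

/-- On a test function the derivative can fall on `f`, so the differentiated series has the same
summable majorant with another constant. -/
lemma potential_differentiable {f : E3 → ℝ} (hf : f ∈ TestFunction) :
    Differentiable ℝ (potential f) ∧ ∀ i, pderiv i (potential f) = potential (pderiv i f) := by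
  have hpc := IsPC.of_test hf
  obtain ⟨A, hA0, hA⟩ := hpc.exists_bound
  have hB : ∃ B, ∀ i x, |pderiv i f x| ≤ B := by
    obtain ⟨B, hB⟩ := hpc.exists_fderiv_bound (TestFunction.contDiff_one hf)
    exact ⟨B, fun i x => (abs_pderiv_le f i x).trans (hB x)⟩
  obtain ⟨B, hB⟩ := hB
  have hd : ∀ k, Differentiable ℝ
      (scaledConv potentialPiece f (dyadicScale k)) := fun k =>
    differentiable_scaledConv isKernel_potentialPiece hpc.continuous (dyadicScale_pos k).ne'
  have hpd : ∀ k i, pderiv i (fun x => dyadicScale k ^ 2 *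
      scaledConv potentialPiece f (dyadicScale k) x) = fun x => dyadicScale k ^ 2 *
      scaledConv potentialPiece (pderiv i f) (dyadicScale k) x := fun k i => by
    rw [pderiv_const_mul (hd k), pderiv_scaledConv isKernel_potentialPiece hpc
      (TestFunction.contDiff_one hf)]
  have h := differentiable_tsum_pderiv (summable_potential_bound A) (summable_potential_bound B)
    (fun k => (hd k).const_mul _) (fun k x => abs_potential_term_le hA k x) (fun k i x => by
      rw [hpd]
      exact abs_potential_term_le (hB i) k x)
  refine ⟨h.1, fun i => (h.2 i).trans (funext fun x => tsum_congr fun k => ?_)⟩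
  rw [hpd]

lemma potential_mem_test {f : E3 → ℝ} (hf : f ∈ TestFunction) : potential f ∈ TestFunction := by
  refine ⟨contDiff_of_stable (S := {u | ∃ g ∈ TestFunction, u = potential g}) ?_ ?_ ⟨f, hf, rfl⟩,
    (IsPC.of_test hf).potential.periodic⟩
  · rintro _ ⟨g, hg, rfl⟩
    exact (potential_differentiable hg).1
  · rintro _ ⟨g, hg, rfl⟩ i
    exact ⟨pderiv i g, pderiv_mem i hg, (potential_differentiable hg).2 i⟩

lemma tendsto_scaledConv_mollifier {f : E3 → ℝ} (hf : f ∈ TestFunction) (x : E3) :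
    Filter.Tendsto (fun k => scaledConv mollifier f (dyadicScale k) x) Filter.atTop
      (nhds (f x)) := by
  obtain ⟨B, hB⟩ := (IsPC.of_test hf).exists_fderiv_bound (TestFunction.contDiff_one hf)
  have hlip := abs_sub_le_of_pderiv_le (TestFunction.differentiable hf)
    fun i x => (abs_pderiv_le f i x).trans (hB x)
  have hB0 : 0 ≤ B := (norm_nonneg _).trans (hB 0)
  rw [tendsto_iff_dist_tendsto_zero]
  refine squeeze_zero (fun _ => dist_nonneg) (g := fun k =>
    l1Norm mollifier * (3 * B * dyadicScale k)) (fun k => ?_) ?_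
  · have h : scaledConv mollifier f (dyadicScale k) x - f x =
        ∫ y, mollifier y * (f (x - dyadicScale k • y) - f x) := by
      simp only [mul_sub]
      rw [integral_sub (isKernel_mollifier.integrable_conv hf.1.continuous _ _)
        (isKernel_mollifier.integrable.mul_const _), integral_mul_const, integral_mollifier,
        one_mul, scaledConv]
    rw [Real.dist_eq, h]
    refine isKernel_mollifier.abs_integral_le fun y hy => (hlip _ _).trans ?_
    rw [show x - dyadicScale k • y - x = -(dyadicScale k • y) by abel, norm_neg, norm_smul,
      Real.norm_eq_abs, abs_of_pos (dyadicScale_pos k)]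
    have := dyadicScale_pos k
    exact mul_le_mul_of_nonneg_left (by nlinarith) (by positivity)
  · have h0 : Filter.Tendsto dyadicScale Filter.atTop (nhds 0) := by
      simpa using (summable_dyadicScale_rpow one_pos).tendsto_atTop_zero
    simpa using ((h0.const_mul (3 * B)).const_mul (l1Norm mollifier))

lemma scaledConv_two_smul {κ f : E3 → ℝ} (r : ℝ) (x : E3) :
    ∫ y, 8 * κ ((2 : ℝ) • y) * f (x - r • y) = scaledConv κ f (r / 2) x := by
  have h := Measure.integral_comp_smul (volume : Measure E3)
    (fun y => κ y * f (x - (r / 2) • y)) 2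
  rw [scaledConv]
  simp only [mul_assoc, integral_const_mul]
  simp only [smul_smul, div_mul_cancel₀ r (two_ne_zero)] at h
  rw [h]
  simp
  norm_num
  rw [← mul_assoc]
  norm_num

/-- Moving both derivatives to the kernel costs `r⁻²`, which the weight `r²` absorbs. The Laplacian
of the kernel is then a difference of mollifiers at scales `r/2` and `r`. -/
lemma scaledConv_laplacian {f : E3 → ℝ} (hf : f ∈ TestFunction) {r : ℝ} (hr : r ≠ 0) (x : E3) :
    ∑ i, r ^ 2 * scaledConv potentialPiece (pderiv i (pderiv i f)) r x =
      scaledConv mollifier f (r / 2) x - scaledConv mollifier f r x := by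
  have hk := isKernel_potentialPiece
  have hpc := IsPC.of_test hf
  have h1 : ∀ i, r ^ 2 * scaledConv potentialPiece (pderiv i (pderiv i f)) r x =
      scaledConv (pderiv i (pderiv i potentialPiece)) f r x := by
    intro i
    have hp := pderiv_mem i hf
    rw [← pderiv_scaledConv hk (IsPC.of_test hp) (TestFunction.contDiff_one hp),
      ← pderiv_scaledConv hk hpc (TestFunction.contDiff_one hf),
      pderiv_scaledConv_kernel hk hpc.continuous hr, pderiv_const_mul
        (differentiable_scaledConv (hk.pderiv i) hpc.continuous hr),
      pderiv_scaledConv_kernel (hk.pderiv i) hpc.continuous hr]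
    field_simp
  have hint : Integrable fun y => 8 * mollifier ((2 : ℝ) • y) * f (x - r • y) := by
    have hc := isKernel_mollifier.smooth.continuous
    have hfc := hpc.continuous
    refine Continuous.integrable_of_hasCompactSupport (by fun_prop) ?_
    refine HasCompactSupport.intro (isCompact_closedBall (0 : E3) 1) fun y hy => ?_
    rw [isKernel_mollifier.eq_zero]
    · simp
    · have hy1 : 1 < ‖y‖ := by simpa using hy
      rw [norm_smul, Real.norm_eq_abs, abs_of_pos two_pos]
      linarith
  simp only [h1]
  simp only [scaledConv]
  rw [← integral_finsetSum _ fun i _ => ((hk.pderiv i).pderiv i).integrable_conv hpc.continuous r x]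
  simp only [← Finset.sum_mul, laplacian_potentialPiece, sub_mul]
  rw [integral_sub hint (isKernel_mollifier.integrable_conv hpc.continuous r x),
    scaledConv_two_smul, scaledConv]

/-- Since `r_k / 2 = r_{k+1}`, the series telescopes. Its limit end is `f`, as mollification at
vanishing scale tends to the identity. -/
lemma laplacian_potential {f : E3 → ℝ} (hf : f ∈ TestFunction) (x : E3) :
    ∑ i, potential (pderiv i (pderiv i f)) x = f x - scaledConv mollifier f baseScale x := by
  have hs : ∀ i, Summable fun k => dyadicScale k ^ 2 *
      scaledConv potentialPiece (pderiv i (pderiv i f)) (dyadicScale k) x := fun i =>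
    (IsPC.of_test (pderiv_mem i (pderiv_mem i hf))).summable_potential x
  have hs' := hasSum_sum fun i (_ : i ∈ (Finset.univ : Finset (Fin 3))) => (hs i).hasSum
  have h := hs'.tendsto_sum_nat
  simp only [scaledConv_laplacian hf (dyadicScale_pos _).ne', ← dyadicScale_succ] at h
  simp only [Finset.sum_range_sub fun k => scaledConv mollifier f (dyadicScale k) x] at h
  have h0 : dyadicScale 0 = baseScale := by simp [dyadicScale]
  rw [h0] at h
  exact tendsto_nhds_unique h ((tendsto_scaledConv_mollifier hf x).sub_const _)

/-- The inverse Laplacian on functions of mean zero. -/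
def invLap (f : E3 → ℝ) : E3 → ℝ := potential (resolvent f)

lemma invLap_mem_test {f : E3 → ℝ} (hf : f ∈ TestFunction) : invLap f ∈ TestFunction :=
  potential_mem_test (resolvent_mem_test hf)

lemma pderiv_invLap {f : E3 → ℝ} (hf : f ∈ TestFunction) (i : Fin 3) :
    pderiv i (invLap f) = invLap (pderiv i f) := by
  rw [invLap, (potential_differentiable (resolvent_mem_test hf)).2, pderiv_resolvent hf, invLap]

/-- With `g = resolvent f`, the previous identity gives `g - ρ_R * g`, while `f = g - smear g = g -
ρ_R * g + mean g` and `mean g = mean f`. -/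
lemma laplacian_invLap {f : E3 → ℝ} (hf : f ∈ TestFunction) (x : E3) :
    ∑ i, invLap (pderiv i (pderiv i f)) x = f x - mean f := by
  have hpc := IsPC.of_test hf
  simp only [invLap]
  have h1 : ∀ i, resolvent (pderiv i (pderiv i f)) = pderiv i (pderiv i (resolvent f)) := fun i => by
    rw [pderiv_resolvent hf, pderiv_resolvent (pderiv_mem i hf)]
  simp only [h1, laplacian_potential (resolvent_mem_test hf)]
  have h2 := resolvent_eq hpc x
  rw [smear, mean_resolvent hpc] at h2
  linarith

lemma abs_invLap_le {f : E3 → ℝ} (hf : IsPC f) {M : ℝ} (hM : ∀ x, |f x| ≤ M) (x : E3) :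
    |invLap f x| ≤ potentialBound * (2 * M) :=
  abs_potential_le (abs_resolvent_le hf hM) x

lemma invLap_add {f g : E3 → ℝ} (hf : IsPC f) (hg : IsPC g) :
    invLap (fun x => f x + g x) = fun x => invLap f x + invLap g x := by
  rw [invLap, resolvent_add hf hg, potential_add hf.resolvent hg.resolvent]
  rfl

lemma invLap_const_mul (c : ℝ) {f : E3 → ℝ} (hf : IsPC f) :
    invLap (fun x => c * f x) = fun x => c * invLap f x := by
  rw [invLap, resolvent_const_mul c hf, potential_const_mul]
  rfl

/-- The inverse Laplacian as a linear map on test functions. -/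
def testInvLap : TestFunction →ₗ[ℝ] TestFunction where
  toFun φ := ⟨invLap φ.1, invLap_mem_test φ.2⟩
  map_add' φ ψ := Subtype.ext (invLap_add (IsPC.of_test φ.2) (IsPC.of_test ψ.2))
  map_smul' c φ := Subtype.ext (invLap_const_mul c (IsPC.of_test φ.2))

lemma testD_testInvLap (i : Fin 3) (φ : TestFunction) :
    testD i (testInvLap φ) = testInvLap (testD i φ) :=
  Subtype.ext (pderiv_invLap φ.2 i)

lemma testLap_apply (φ : TestFunction) (x : E3) :
    (testLap φ).1 x = ∑ i, pderiv i (pderiv i φ.1) x := by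
  simp [testLap, testD]

lemma testLap_testInvLap (φ : TestFunction) :
    testLap (testInvLap φ) = φ - mean φ.1 • testOne := by
  refine Subtype.ext (funext fun x => ?_)
  rw [testLap_apply]
  have h : ∀ i, pderiv i (pderiv i (testInvLap φ).1) = invLap (pderiv i (pderiv i φ.1)) := by
    intro i
    change pderiv i (pderiv i (invLap φ.1)) = _
    rw [pderiv_invLap φ.2, pderiv_invLap (pderiv_mem i φ.2)]
  simp only [h, laplacian_invLap φ.2]
  simp [testOne]

lemma testInvLap_testLap (φ : TestFunction) :
    testInvLap (testLap φ) = φ - mean φ.1 • testOne := by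
  rw [← testLap_testInvLap, testLap, testLap, map_sum]
  simp only [testD_testInvLap]

/-! ### Iterated partial derivatives -/

/-- The iterated partial derivative along a list of directions. -/
def pderivs (l : List (Fin 3)) (f : E3 → ℝ) : E3 → ℝ := l.foldr pderiv f

lemma pderivs_cons (i : Fin 3) (l : List (Fin 3)) (f : E3 → ℝ) :
    pderivs (i :: l) f = pderiv i (pderivs l f) := rfl

/-- The iterated partial derivative of a test function along a list of directions. -/
def testDs (l : List (Fin 3)) (φ : TestFunction) : TestFunction := l.foldr testD φ

lemma testDs_coe (l : List (Fin 3)) (φ : TestFunction) : (testDs l φ).1 = pderivs l φ.1 := by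
  induction l with
  | nil => rfl
  | cons i l ih =>
    rw [pderivs_cons, ← ih]
    rfl

lemma pderivs_mem (l : List (Fin 3)) {f : E3 → ℝ} (hf : f ∈ TestFunction) :
    pderivs l f ∈ TestFunction := by
  rw [show pderivs l f = (testDs l ⟨f, hf⟩).1 from (testDs_coe l ⟨f, hf⟩).symm]
  exact (testDs l ⟨f, hf⟩).2

lemma testDs_testInvLap (l : List (Fin 3)) (φ : TestFunction) :
    testDs l (testInvLap φ) = testInvLap (testDs l φ) := by
  induction l with
  | nil => rfl
  | cons i l ih =>
    change testD i (testDs l (testInvLap φ)) = testInvLap (testD i (testDs l φ))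
    rw [ih, testD_testInvLap]

lemma testD_testOne (i : Fin 3) : testD i testOne = 0 :=
  Subtype.ext (pderiv_const 1 i)

lemma testD_add (i : Fin 3) (φ ψ : TestFunction) : testD i (φ + ψ) = testD i φ + testD i ψ :=
  Subtype.ext (pderiv_add (TestFunction.differentiable φ.2) (TestFunction.differentiable ψ.2) i)

lemma testD_smul (i : Fin 3) (c : ℝ) (φ : TestFunction) : testD i (c • φ) = c • testD i φ :=
  Subtype.ext (pderiv_const_mul (TestFunction.differentiable φ.2) c i)

lemma testDs_add (l : List (Fin 3)) (φ ψ : TestFunction) :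
    testDs l (φ + ψ) = testDs l φ + testDs l ψ := by
  induction l with
  | nil => rfl
  | cons i l ih =>
    change testD i (testDs l (φ + ψ)) = testD i (testDs l φ) + testD i (testDs l ψ)
    rw [ih, testD_add]

lemma testDs_smul (l : List (Fin 3)) (c : ℝ) (φ : TestFunction) :
    testDs l (c • φ) = c • testDs l φ := by
  induction l with
  | nil => rfl
  | cons i l ih =>
    change testD i (testDs l (c • φ)) = c • testD i (testDs l φ)
    rw [ih, testD_smul]

lemma testDs_testOne {l : List (Fin 3)} (hl : l ≠ []) : testDs l testOne = 0 := by
  induction l with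
  | nil => exact absurd rfl hl
  | cons i l ih =>
    change testD i (testDs l testOne) = 0
    rcases eq_or_ne l [] with rfl | h
    · exact testD_testOne i
    · rw [ih h]
      simpa using testD_smul i 0 0

lemma abs_pderivs_le (l : List (Fin 3)) {f : E3 → ℝ} (hf : ContDiff ℝ ∞ f) (x : E3) :
    |pderivs l f x| ≤ ‖iteratedFDeriv ℝ l.length f x‖ := by
  -- The induction on the list must carry an arbitrary order `n`, since peeling off one direction
  -- raises that order by one.
  have key : ∀ (n : ℕ) (l : List (Fin 3)), ContDiff ℝ ∞ (pderivs l f) ∧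
      ‖iteratedFDeriv ℝ n (pderivs l f) x‖ ≤ ‖iteratedFDeriv ℝ (n + l.length) f x‖ := by
    intro n l
    induction l generalizing n with
    | nil => exact ⟨hf, le_rfl⟩
    | cons i l ih =>
      have hs := (ih 0).1
      refine ⟨contDiff_pderiv hs i, ?_⟩
      have h1 : pderivs (i :: l) f =
          (ContinuousLinearMap.apply ℝ ℝ (e i)) ∘ fderiv ℝ (pderivs l f) := rfl
      have h2 : ContDiff ℝ ∞ (fderiv ℝ (pderivs l f)) := hs.fderiv_right (m := ∞) (by simp)
      have h3 := (ContinuousLinearMap.apply ℝ ℝ (e i)).norm_iteratedFDeriv_comp_left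
        (h2.contDiffAt (x := x)) (n := n) (by exact_mod_cast le_top)
      have h4 : ‖ContinuousLinearMap.apply ℝ ℝ (e i)‖ ≤ 1 :=
        ContinuousLinearMap.opNorm_le_bound _ zero_le_one fun A => by
          simpa [e] using A.le_opNorm (e i)
      rw [h1]
      refine h3.trans ((mul_le_of_le_one_left (norm_nonneg _) h4).trans ?_)
      rw [norm_iteratedFDeriv_fderiv]
      refine ((ih (n + 1)).2).trans (le_of_eq ?_)
      rw [List.length_cons, add_assoc, add_comm 1]
  have h := (key 0 l).2
  rwa [norm_iteratedFDeriv_zero, zero_add] at h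

lemma IsKernel.pderivs {κ : E3 → ℝ} (hκ : IsKernel κ) (l : List (Fin 3)) :
    IsKernel (pderivs l κ) := by
  induction l with
  | nil => exact hκ
  | cons i l ih => exact ih.pderiv i

lemma pderiv_pderivs_comm {f : E3 → ℝ} (hf : IsKernel f) (i : Fin 3) (l : List (Fin 3)) :
    pderiv i (pderivs l f) = pderivs l (pderiv i f) := by
  induction l with
  | nil => rfl
  | cons j l ih => rw [pderivs_cons, pderivs_cons, pderiv_comm (hf.pderivs l).smooth, ih]

lemma scaledConv_pderivs {κ f : E3 → ℝ} (hκ : IsKernel κ) (hf : f ∈ TestFunction) {r : ℝ}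
    (hr : r ≠ 0) (l : List (Fin 3)) :
    scaledConv κ (pderivs l f) r = fun x => (r⁻¹) ^ l.length * scaledConv (pderivs l κ) f r x := by
  induction l generalizing κ with
  | nil => simp [pderivs]
  | cons i l ih =>
    have hp := pderivs_mem l hf
    rw [pderivs_cons, ← pderiv_scaledConv hκ (IsPC.of_test hp) (TestFunction.contDiff_one hp),
      ih hκ, pderiv_const_mul (differentiable_scaledConv (hκ.pderivs l) hf.1.continuous hr),
      pderiv_scaledConv_kernel (hκ.pderivs l) hf.1.continuous hr]
    ext x
    rw [List.length_cons, pow_succ, pderivs_cons]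
    ring

lemma potential_pderivs {f : E3 → ℝ} (hf : f ∈ TestFunction) (l : List (Fin 3)) :
    pderivs l (potential f) = potential (pderivs l f) := by
  induction l with
  | nil => rfl
  | cons i l ih => rw [pderivs_cons, ih, (potential_differentiable (pderivs_mem l hf)).2, pderivs_cons]

/-! ### The Poisson equation with a right-hand side in divergence form -/

section Divergence

variable {ι : Type} [Fintype ι] {a : ι → E3 → ℝ} {l : ι → List (Fin 3)} {m : ℕ}

/-- The functional `φ ↦ ∫ ∑ a_α ∂^{l_α} φ`. -/
def divFunctional (a : ι → E3 → ℝ) (l : ι → List (Fin 3)) (φ : TestFunction) : ℝ :=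
  ∫ x in cell, ∑ α, a α x * (testDs (l α) φ).1 x

lemma divFunctional_integrable (ha : ∀ α, IsPC (a α)) (φ : TestFunction) :
    IntegrableOn (fun x => ∑ α, a α x * (testDs (l α) φ).1 x) cell :=
  (IsPC.sum _ fun α _ => (ha α).mul (IsPC.of_test (testDs (l α) φ).2)).integrableOn

lemma divFunctional_add (ha : ∀ α, IsPC (a α)) (φ ψ : TestFunction) :
    divFunctional a l (φ + ψ) = divFunctional a l φ + divFunctional a l ψ := by
  rw [divFunctional, divFunctional, divFunctional, ← integral_add (divFunctional_integrable ha φ)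
    (divFunctional_integrable ha ψ)]
  simp only [testDs_add, ← Finset.sum_add_distrib, ← mul_add]
  rfl

lemma divFunctional_smul (c : ℝ) (φ : TestFunction) :
    divFunctional a l (c • φ) = c * divFunctional a l φ := by
  rw [divFunctional, divFunctional, ← integral_const_mul]
  simp only [testDs_smul, Finset.mul_sum]
  refine integral_congr_ae (Filter.Eventually.of_forall fun x => Finset.sum_congr rfl fun α _ => ?_)
  change a α x * (c * _) = _
  ring

lemma divFunctional_testOne (hl : ∀ α, l α ≠ []) : divFunctional a l testOne = 0 := by
  simp [divFunctional, testDs_testOne (hl _)]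

/-- Derivatives commute with `invLap`, so only its sup norm bound is used. This gives the continuity
of the solution as a distribution, of order at most `m`. -/
lemma abs_divFunctional_testInvLap_le (ha : ∀ α, IsPC (a α)) (hm : ∀ α, (l α).length = m) :
    ∃ C : ℝ, ∀ (φ : TestFunction) (M : ℝ),
      (∀ n ≤ m, ∀ x, ‖iteratedFDeriv ℝ n φ.1 x‖ ≤ M) →
      |divFunctional a l (testInvLap φ)| ≤ C * M := by
  choose A hA0 hA using fun α => (ha α).exists_bound
  refine ⟨(∑ α, A α * (potentialBound * 2)) * volume.real cell, fun φ M hM => ?_⟩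
  have h1 : ∀ x ∈ cell, ‖∑ α, a α x * (testDs (l α) (testInvLap φ)).1 x‖ ≤
      ∑ α, A α * (potentialBound * (2 * M)) := by
    intro x _
    refine (norm_sum_le _ _).trans (Finset.sum_le_sum fun α _ => ?_)
    rw [Real.norm_eq_abs, abs_mul, testDs_testInvLap]
    refine mul_le_mul (hA α x) ?_ (abs_nonneg _) (hA0 α)
    refine abs_invLap_le (IsPC.of_test (testDs (l α) φ).2) (fun y => ?_) x
    rw [testDs_coe]
    exact (abs_pderivs_le _ φ.2.1 y).trans (hM _ (hm α).le y)
  refine (norm_setIntegral_le_of_norm_le_const volume_cell_lt_top h1).trans (le_of_eq ?_)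
  simp only [Finset.sum_mul]
  exact Finset.sum_congr rfl fun α _ => by ring

/-- A zero-average solution of `Δ P = s · divFunctional a l`, as a distribution. -/
structure SolvesDiv (a : ι → E3 → ℝ) (l : ι → List (Fin 3)) (s : ℝ) (P : PeriodicDistribution) :
    Prop where
  average : P.toFun testOne = 0
  eqn : ∀ φ, P.toFun (testLap φ) = s * divFunctional a l φ

/-- Testing the equation with `invLap φ` recovers `φ` up to a constant, which `P` annihilates. This
is uniqueness, and also the formula that defines the solution. -/
lemma SolvesDiv.eq {s : ℝ} {P : PeriodicDistribution} (h : SolvesDiv a l s P) (φ : TestFunction) :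
    P.toFun φ = s * divFunctional a l (testInvLap φ) := by
  have h1 := h.eqn (testInvLap φ)
  rw [testLap_testInvLap, map_sub, map_smul, h.average, smul_zero, sub_zero] at h1
  exact h1

lemma existsUnique_solvesDiv (ha : ∀ α, IsPC (a α)) (hl : ∀ α, l α ≠ [])
    (hm : ∀ α, (l α).length = m) (s : ℝ) : ∃! P : PeriodicDistribution, SolvesDiv a l s P := by
  obtain ⟨C, hC⟩ := abs_divFunctional_testInvLap_le ha hm
  have h1 : ∀ φ, testInvLap (testLap φ) = φ + (-mean φ.1) • testOne := fun φ => by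
    rw [testInvLap_testLap]
    refine Subtype.ext (funext fun x => ?_)
    change φ.1 x - mean φ.1 * 1 = φ.1 x + (-mean φ.1) * 1
    ring
  refine ⟨⟨⟨⟨fun φ => s * divFunctional a l (testInvLap φ), fun φ ψ => ?_⟩, fun c φ => ?_⟩,
    m, |s| * C, fun φ M hM => ?_⟩, ⟨?_, fun φ => ?_⟩, fun P hP => ?_⟩
  · rw [map_add, divFunctional_add ha, mul_add]
  · simp only [map_smul, divFunctional_smul, RingHom.id_apply, smul_eq_mul]
    ring
  · change |s * _| ≤ _
    rw [abs_mul, mul_assoc]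
    exact mul_le_mul_of_nonneg_left (hC φ M hM) (abs_nonneg _)
  · change s * divFunctional a l (testInvLap testOne) = 0
    simp [divFunctional, testDs_testInvLap, testDs_testOne (hl _)]
  · change s * divFunctional a l (testInvLap (testLap φ)) = _
    rw [h1, divFunctional_add ha, divFunctional_smul, divFunctional_testOne hl]
    simp
  · ext φ
    exact hP.eq φ

/-- The convolution of the coefficients with the derivatives of a kernel. -/
def divConv (a : ι → E3 → ℝ) (l : ι → List (Fin 3)) (κ : E3 → ℝ) (r : ℝ) (x : E3) : ℝ :=
  ∑ α, scaledConv (pderivs (l α) κ) (a α) r x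

lemma isPC_divConv (ha : ∀ α, IsPC (a α)) {κ : E3 → ℝ} (hκ : IsKernel κ) (r : ℝ) :
    IsPC (divConv a l κ r) :=
  IsPC.sum _ fun α _ => (ha α).scaledConv (hκ.pderivs _) r

lemma differentiable_divConv (ha : ∀ α, IsPC (a α)) {κ : E3 → ℝ} (hκ : IsKernel κ) {r : ℝ}
    (hr : r ≠ 0) : Differentiable ℝ (divConv a l κ r) :=
  Differentiable.fun_sum fun α _ =>
    differentiable_scaledConv (hκ.pderivs _) (ha α).continuous hr

/-- Differentiation only replaces the kernel and keeps the divergence structure, so a cancellation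
bound valid for all kernels also controls derivatives. -/
lemma pderiv_divConv (ha : ∀ α, IsPC (a α)) {κ : E3 → ℝ} (hκ : IsKernel κ) {r : ℝ}
    (hr : r ≠ 0) (i : Fin 3) :
    pderiv i (divConv a l κ r) = fun x => r⁻¹ * divConv a l (pderiv i κ) r x := by
  have h := pderiv_sum Finset.univ (f := fun α => scaledConv (pderivs (l α) κ) (a α) r)
    (fun α _ => differentiable_scaledConv (hκ.pderivs _) (ha α).continuous hr) i
  refine h.trans (funext fun x => ?_)
  rw [divConv, Finset.mul_sum]
  refine Finset.sum_congr rfl fun α _ => ?_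
  rw [pderiv_scaledConv_kernel (hκ.pderivs _) (ha α).continuous hr, pderiv_pderivs_comm hκ]

/-- The dyadic pieces of a solution, up to the resolvent. -/
def dyadicPiece (a : ι → E3 → ℝ) (l : ι → List (Fin 3)) (m : ℕ) (s : ℝ) (k : ℕ) (x : E3) : ℝ :=
  s * (dyadicScale k ^ 2 * (dyadicScale k)⁻¹ ^ m) * divConv a l potentialPiece (-dyadicScale k) x

lemma isPC_dyadicPiece (ha : ∀ α, IsPC (a α)) (s : ℝ) (k : ℕ) : IsPC (dyadicPiece a l m s k) :=
  (isPC_divConv ha isKernel_potentialPiece _).const_mul _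

lemma hasSum_setIntegral_cell {f : ℕ → E3 → ℝ} {u : ℕ → ℝ} (hf : ∀ k, IsPC (f k))
    (hu : Summable u) (h : ∀ k x, |f k x| ≤ u k) :
    HasSum (fun k => ∫ x in cell, f k x) (∫ x in cell, ∑' k, f k x) := by
  refine hasSum_integral_of_summable_integral_norm (fun k => (hf k).integrableOn)
    (Summable.of_nonneg_of_le (fun k => integral_nonneg fun _ => norm_nonneg _) (fun k => ?_)
      (hu.mul_right (volume.real cell)))
  refine (le_abs_self _).trans ?_
  exact norm_setIntegral_le_of_norm_le_const volume_cell_lt_top (f := fun x => ‖f k x‖)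
    fun x _ => by simpa using h k x

/-- The negative scale in `dyadicPiece` is the reflection produced by taking the adjoint, and its
factor `r⁻ᵐ` comes from moving `m` derivatives between the test function and the kernel. -/
lemma setIntegral_dyadicPiece_mul (ha : ∀ α, IsPC (a α)) (hm : ∀ α, (l α).length = m) (s : ℝ)
    (k : ℕ) {g : E3 → ℝ} (hg : g ∈ TestFunction) :
    ∫ x in cell, dyadicPiece a l m s k x * g x =
      s * ∫ x in cell, ∑ α, a α x * (dyadicScale k ^ 2 *
        scaledConv potentialPiece (pderivs (l α) g) (dyadicScale k) x) := by
  have hk := isKernel_potentialPiece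
  have hgp := IsPC.of_test hg
  set r := dyadicScale k with hr
  have hr0 : r ≠ 0 := (dyadicScale_pos k).ne'
  have h1 : ∀ α, IsPC fun x => scaledConv (pderivs (l α) potentialPiece) (a α) (-r) x * g x :=
    fun α => ((ha α).scaledConv (hk.pderivs _) _).mul hgp
  have h2 : ∀ α, IsPC fun x => a α x * (r ^ 2 * scaledConv potentialPiece (pderivs (l α) g) r x) :=
    fun α => (ha α).mul (((IsPC.of_test (pderivs_mem (l α) hg)).scaledConv hk r).const_mul _)
  simp only [dyadicPiece, divConv, mul_assoc, Finset.sum_mul, integral_const_mul]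
  rw [integral_finsetSum _ fun α _ => (h1 α).integrableOn,
    integral_finsetSum _ fun α _ => (h2 α).integrableOn, Finset.mul_sum, Finset.mul_sum]
  congr 1
  refine Finset.sum_congr rfl fun α _ => ?_
  rw [setIntegral_scaledConv_mul (hk.pderivs _) (ha α) hgp, neg_neg, scaledConv_pderivs hk hg hr0,
    hm α, ← integral_const_mul, ← integral_const_mul]
  congr 1 with x
  ring

/-- The value `P φ` pairs the coefficients with derivatives of `potential (resolvent φ)`.
Transposing each dyadic term, then `resolvent`, moves everything onto the coefficients; summability
of the pieces allows the sum to pass through the integral. -/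
lemma SolvesDiv.isFunction {s : ℝ} {P : PeriodicDistribution} (h : SolvesDiv a l s P)
    (ha : ∀ α, IsPC (a α)) (hm : ∀ α, (l α).length = m) {u : ℕ → ℝ} (hu : Summable u)
    (hb : ∀ k x, |dyadicPiece a l m s k x| ≤ u k) :
    P.IsFunction (resolvent fun x => ∑' k, dyadicPiece a l m s k x) := by
  have hF : IsPC fun x => ∑' k, dyadicPiece a l m s k x :=
    IsPC.tsum (isPC_dyadicPiece ha s) hu hb
  refine ⟨hF.resolvent.continuous, hF.resolvent.periodic, fun φ => ?_⟩
  set g := resolvent φ.1 with hg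
  have hgt : g ∈ TestFunction := resolvent_mem_test φ.2
  have hgp := IsPC.of_test hgt
  obtain ⟨M, hM0, hM⟩ := hgp.exists_bound
  rw [h.eq, setIntegral_resolvent_mul hF (IsPC.of_test φ.2), ← hg]
  have hs1 := hasSum_setIntegral_cell (f := fun k x => dyadicPiece a l m s k x * g x)
    (fun k => (isPC_dyadicPiece ha s k).mul hgp) (hu.mul_right M) fun k x => by
      rw [abs_mul]
      exact mul_le_mul (hb k x) (hM x) (abs_nonneg _) ((abs_nonneg _).trans (hb k x))
  simp only [tsum_mul_right, setIntegral_dyadicPiece_mul ha hm s _ hgt] at hs1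
  choose A hA0 hA using fun α => (ha α).exists_bound
  choose B hB0 hB using fun α => (IsPC.of_test (pderivs_mem (l α) hgt)).exists_bound
  have hs2 := (hasSum_setIntegral_cell (f := fun k x => ∑ α, a α x * (dyadicScale k ^ 2 *
        scaledConv potentialPiece (pderivs (l α) g) (dyadicScale k) x))
    (u := fun k => ∑ α, A α * (dyadicScale k ^ 2 * l1Norm potentialPiece * B α))
    (fun k => IsPC.sum _ fun α _ => (ha α).mul
      (IsPC.potential_term (IsPC.of_test (pderivs_mem (l α) hgt)) k))
    (summable_sum fun α _ => (summable_potential_bound (B α)).mul_left _) fun k x => by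
      refine (Finset.abs_sum_le_sum_abs _ _).trans (Finset.sum_le_sum fun α _ => ?_)
      rw [abs_mul]
      exact mul_le_mul (hA α x) (abs_potential_term_le (hB α) k x) (abs_nonneg _)
        (hA0 α)).mul_left s
  -- `hs1` and `hs2` sum the same numerical series, once with the kernels on the coefficients and
  -- once on the test function.
  rw [hs1.unique hs2, divFunctional]
  congr 1
  refine integral_congr_ae (Filter.Eventually.of_forall fun x => ?_)
  have hs3 : ∀ α, Summable fun k => a α x * (dyadicScale k ^ 2 *
      scaledConv potentialPiece (pderivs (l α) g) (dyadicScale k) x) := fun α =>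
    ((IsPC.of_test (pderivs_mem (l α) hgt)).summable_potential x).mul_left _
  simp only
  rw [Summable.tsum_finsetSum fun α _ => hs3 α]
  refine Finset.sum_congr rfl fun α _ => ?_
  rw [tsum_mul_left, testDs_coe]
  change a α x * pderivs (l α) (potential g) x = _
  rw [potential_pderivs hgt]
  rfl

end Divergence

/-! ### Hölder bounds for dyadic sums -/

lemma exists_dyadicScale_le {d : ℝ} (hd : 0 < d) : ∃ k, dyadicScale k ≤ d := by
  have h0 : Filter.Tendsto dyadicScale Filter.atTop (nhds 0) := by
    simpa using (summable_dyadicScale_rpow one_pos).tendsto_atTop_zero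
  obtain ⟨k, hk⟩ := (h0.eventually (gt_mem_nhds hd)).exists
  exact ⟨k, hk.le⟩

lemma dyadicScale_add (j k : ℕ) : dyadicScale (j + k) = dyadicScale k * (1 / 2) ^ j := by
  rw [dyadicScale, dyadicScale, pow_add]
  ring

/-- The sum is split at the scale comparable to `d`: the size bound serves the finer scales and the
Lipschitz bound the coarser ones. Both parts are geometric and dominated by their terms next to the
split, because `0 < θ < 1`. -/
lemma abs_tsum_le_of_dyadic {θ : ℝ} (hθ : θ ∈ Set.Ioo (0 : ℝ) 1) {g : ℕ → ℝ} {A B d : ℝ}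
    (hA : 0 ≤ A) (hB : 0 ≤ B) (hd : 0 < d) (h1 : ∀ k, |g k| ≤ A * dyadicScale k ^ θ)
    (h2 : ∀ k, |g k| ≤ B * dyadicScale k ^ (θ - 1) * d) :
    |∑' k, g k| ≤ (A * (1 - (1 / 2 : ℝ) ^ θ)⁻¹ + B * (1 - (1 / 2 : ℝ) ^ (1 - θ))⁻¹) * d ^ θ := by
  classical
  have hq0 : 0 ≤ (1 / 2 : ℝ) ^ θ := by positivity
  have hq1 : (1 / 2 : ℝ) ^ θ < 1 := Real.rpow_lt_one (by norm_num) (by norm_num) hθ.1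
  have hp0 : 0 ≤ (1 / 2 : ℝ) ^ (1 - θ) := by positivity
  have hp1 : (1 / 2 : ℝ) ^ (1 - θ) < 1 :=
    Real.rpow_lt_one (by norm_num) (by norm_num) (by linarith [hθ.2])
  set q := (1 / 2 : ℝ) ^ θ
  set p := (1 / 2 : ℝ) ^ (1 - θ)
  have hs : Summable g :=
    Summable.of_norm_bounded ((summable_dyadicScale_rpow hθ.1).mul_left A) h1
  have hex := exists_dyadicScale_le hd
  set N := Nat.find hex with hN
  have hNle : dyadicScale N ≤ d := Nat.find_spec hex
  have hNgt : ∀ k, k < N → d < dyadicScale k := fun k hk => not_le.1 (Nat.find_min hex hk)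
  rw [← hs.sum_add_tsum_nat_add N, add_mul, add_comm]
  refine (abs_add_le _ _).trans (add_le_add ?_ ?_)
  · have hgeo := (hasSum_geometric_of_lt_one hq0 hq1).mul_left (A * d ^ θ)
    refine (tsum_of_norm_bounded (f := fun i => g (i + N)) hgeo fun j => ?_).trans
      (le_of_eq (by ring))
    refine (h1 (j + N)).trans ?_
    rw [mul_assoc]
    refine mul_le_mul_of_nonneg_left ?_ hA
    rw [dyadicScale_add, Real.mul_rpow (dyadicScale_pos N).le (by positivity),
      ← Real.rpow_natCast, ← Real.rpow_mul (by norm_num), mul_comm (j : ℝ) θ,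
      Real.rpow_mul (by norm_num), Real.rpow_natCast]
    exact mul_le_mul_of_nonneg_right
      (Real.rpow_le_rpow (dyadicScale_pos N).le hNle hθ.1.le) (by positivity)
  · have hterm : ∀ k ∈ Finset.range N, |g k| ≤ B * d ^ θ * p ^ (N - 1 - k) := by
      intro k hk
      have hkN : k < N := Finset.mem_range.1 hk
      refine (h2 k).trans ?_
      rw [mul_assoc, mul_assoc]
      refine mul_le_mul_of_nonneg_left ?_ hB
      -- Coarse scales are measured from `N - 1`, the last one exceeding `d`, so the geometric sum
      -- runs backwards in `k`. Membership `k < N` guarantees that `N - 1` is a genuine predecessor.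
      have hj : (N - 1 - k) + k = N - 1 := by omega
      have hlast := hNgt (N - 1) (by omega)
      rw [← hj, dyadicScale_add] at hlast
      set j := N - 1 - k
      have hhalf : (0 : ℝ) < (1 / 2) ^ j := by positivity
      have hk2 : d * ((1 / 2 : ℝ) ^ j)⁻¹ ≤ dyadicScale k := by
        rw [← div_eq_mul_inv, div_le_iff₀ hhalf]
        exact hlast.le
      have h3 : dyadicScale k ^ (θ - 1) ≤ (d * ((1 / 2 : ℝ) ^ j)⁻¹) ^ (θ - 1) :=
        Real.rpow_le_rpow_of_nonpos (by positivity) hk2 (by linarith [hθ.2])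
      refine (mul_le_mul_of_nonneg_right h3 hd.le).trans (le_of_eq ?_)
      rw [Real.mul_rpow hd.le (by positivity), Real.rpow_sub_one hd.ne', Real.inv_rpow hhalf.le,
        ← Real.rpow_neg hhalf.le, neg_sub, ← Real.rpow_natCast, ← Real.rpow_mul (by norm_num),
        mul_comm (j : ℝ), Real.rpow_mul (by norm_num), Real.rpow_natCast]
      field_simp
      rfl
    refine (Finset.abs_sum_le_sum_abs _ _).trans ((Finset.sum_le_sum hterm).trans ?_)
    rw [← Finset.mul_sum, Finset.sum_range_reflect (fun j => p ^ j) N]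
    have hle : ∑ j ∈ Finset.range N, p ^ j ≤ (1 - p)⁻¹ :=
      sum_le_hasSum _ (fun j _ => by positivity) (hasSum_geometric_of_lt_one hp0 hp1)
    refine (mul_le_mul_of_nonneg_left hle (by positivity)).trans (le_of_eq (by ring))

/-- The sup norm and the Hölder seminorm of exponent `θ` are at most `M`. -/
def HolderBound (θ M : ℝ) (f : E3 → ℝ) : Prop :=
  (∀ x, |f x| ≤ M) ∧ ∀ x y, |f x - f y| ≤ M * ‖x - y‖ ^ θ

lemma HolderBound.mono {θ M M' : ℝ} {f : E3 → ℝ} (h : HolderBound θ M f) (hM : M ≤ M') :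
    HolderBound θ M' f :=
  ⟨fun x => (h.1 x).trans hM, fun x y => (h.2 x y).trans
    (mul_le_mul_of_nonneg_right hM (by positivity))⟩

lemma HolderBound.add {θ M N : ℝ} {f g : E3 → ℝ} (hf : HolderBound θ M f)
    (hg : HolderBound θ N g) : HolderBound θ (M + N) fun x => f x + g x := by
  refine ⟨fun x => (abs_add_le _ _).trans (add_le_add (hf.1 x) (hg.1 x)), fun x y => ?_⟩
  rw [add_sub_add_comm, add_mul]
  exact (abs_add_le _ _).trans (add_le_add (hf.2 x y) (hg.2 x y))

/-- Points at distance at most `1` are handled by the Lipschitz bound `3B`, the others by the sup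
norm, which gives `2A`. -/
lemma holderBound_of_pderiv {θ : ℝ} (hθ : θ ∈ Set.Ioo (0 : ℝ) 1) {f : E3 → ℝ} {A B : ℝ}
    (hf : Differentiable ℝ f) (hA : ∀ x, |f x| ≤ A) (hB : ∀ i x, |pderiv i f x| ≤ B) :
    HolderBound θ (2 * A + 3 * B) f := by
  have hA0 : 0 ≤ A := (abs_nonneg _).trans (hA 0)
  have hB0 : 0 ≤ B := (abs_nonneg _).trans (hB 0 0)
  refine ⟨fun x => (hA x).trans (by linarith), fun x y => ?_⟩
  have h0 : 0 ≤ ‖x - y‖ ^ θ := by positivity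
  rcases le_total ‖x - y‖ 1 with h | h
  · have h1 : ‖x - y‖ ≤ ‖x - y‖ ^ θ := by
      rcases (norm_nonneg (x - y)).eq_or_lt with hz | hz
      · rw [← hz, Real.zero_rpow hθ.1.ne']
      · simpa using Real.rpow_le_rpow_of_exponent_ge hz h hθ.2.le
    refine (abs_sub_le_of_pderiv_le hf hB x y).trans ?_
    nlinarith
  · have h1 : 1 ≤ ‖x - y‖ ^ θ := Real.one_le_rpow h hθ.1.le
    refine ((abs_sub _ _).trans (add_le_add (hA x) (hA y))).trans ?_
    nlinarith

/-- The easy half of the Littlewood–Paley description of Hölder spaces: size `r^θ` with gradient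
`r^{θ-1}` at each dyadic scale gives a `C^θ` sum. -/
lemma exists_holderBound_tsum {θ : ℝ} (hθ : θ ∈ Set.Ioo (0 : ℝ) 1) :
    ∃ C, 0 ≤ C ∧ ∀ (f : ℕ → E3 → ℝ) (M : ℝ), 0 ≤ M → (∀ k, Differentiable ℝ (f k)) →
      (∀ k x, |f k x| ≤ M * dyadicScale k ^ θ) →
      (∀ k i x, |pderiv i (f k) x| ≤ M * dyadicScale k ^ (θ - 1)) →
      HolderBound θ (C * M) fun x => ∑' k, f k x := by
  have hq1 : (1 / 2 : ℝ) ^ θ < 1 := Real.rpow_lt_one (by norm_num) (by norm_num) hθ.1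
  have hp1 : (1 / 2 : ℝ) ^ (1 - θ) < 1 :=
    Real.rpow_lt_one (by norm_num) (by norm_num) (by linarith [hθ.2])
  set C1 := ∑' k, dyadicScale k ^ θ with hC1
  set C2 := 2 * (1 - (1 / 2 : ℝ) ^ θ)⁻¹ + 3 * (1 - (1 / 2 : ℝ) ^ (1 - θ))⁻¹ with hC2
  have hC10 : 0 ≤ C1 := tsum_nonneg fun k => Real.rpow_nonneg (dyadicScale_pos k).le _
  have hC20 : 0 ≤ C2 := by
    have h1 := inv_nonneg.2 (sub_nonneg.2 hq1.le)
    have h2 := inv_nonneg.2 (sub_nonneg.2 hp1.le)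
    positivity
  refine ⟨C1 + C2, by positivity, fun f M hM hd hf hp => ⟨fun x => ?_, fun x y => ?_⟩⟩
  · have hsum := (summable_dyadicScale_rpow hθ.1).mul_left M
    refine (tsum_of_norm_bounded (f := fun k => f k x) hsum.hasSum fun k => hf k x).trans ?_
    rw [tsum_mul_left]
    nlinarith
  · have hs : ∀ x, Summable fun k => f k x := fun x =>
      Summable.of_norm_bounded ((summable_dyadicScale_rpow hθ.1).mul_left M) fun k => hf k x
    rcases eq_or_ne x y with rfl | hxy
    · simp only [sub_self, abs_zero]
      positivity
    rw [← (hs x).tsum_sub (hs y)]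
    have hd0 : 0 < ‖x - y‖ := norm_pos_iff.2 (sub_ne_zero.2 hxy)
    refine (abs_tsum_le_of_dyadic hθ (A := 2 * M) (B := 3 * M) (by positivity) (by positivity) hd0
      (fun k => ?_) (fun k => ?_)).trans ?_
    · exact ((abs_sub _ _).trans (add_le_add (hf k x) (hf k y))).trans (le_of_eq (by ring))
    · exact (abs_sub_le_of_pderiv_le (hd k) (hp k) x y).trans (le_of_eq (by ring))
    · refine mul_le_mul_of_nonneg_right ?_ (by positivity)
      rw [show 2 * M * (1 - (1 / 2 : ℝ) ^ θ)⁻¹ + 3 * M * (1 - (1 / 2 : ℝ) ^ (1 - θ))⁻¹ = C2 * M by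
        rw [hC2]; ring]
      exact mul_le_mul_of_nonneg_right (by linarith) hM

/-! ### Regularity of the resolvent of a dyadic sum -/

lemma exists_smear_bound : ∃ C, 0 ≤ C ∧ ∀ (f : E3 → ℝ) (M : ℝ), IsPC f → (∀ x, |f x| ≤ M) →
    (∀ x, |smear f x| ≤ C * M) ∧ (∀ i x, |pderiv i (smear f) x| ≤ C * M) ∧
    ∀ i j x, |pderiv j (pderiv i (smear f)) x| ≤ C * M := by
  set R := baseScale⁻¹ with hR
  have hR0 : 0 < R := inv_pos.2 baseScale_pos
  set C1 := ∑ i, l1Norm (pderiv i mollifier) with hC1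
  set C2 := ∑ i, ∑ j, l1Norm (pderiv j (pderiv i mollifier)) with hC2
  have hC10 : 0 ≤ C1 := Finset.sum_nonneg fun i _ => l1Norm_nonneg _
  have hC20 : 0 ≤ C2 := Finset.sum_nonneg fun i _ => Finset.sum_nonneg fun j _ => l1Norm_nonneg _
  have h1 : ∀ i, l1Norm (pderiv i mollifier) ≤ C1 := fun i =>
    Finset.single_le_sum (f := fun i => l1Norm (pderiv i mollifier))
      (fun i _ => l1Norm_nonneg _) (Finset.mem_univ i)
  have h2 : ∀ i j, l1Norm (pderiv j (pderiv i mollifier)) ≤ C2 := fun i j =>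
    (Finset.single_le_sum (f := fun j => l1Norm (pderiv j (pderiv i mollifier)))
      (fun i _ => l1Norm_nonneg _) (Finset.mem_univ j)).trans
    (Finset.single_le_sum (f := fun i => ∑ j, l1Norm (pderiv j (pderiv i mollifier)))
      (fun i _ => Finset.sum_nonneg fun j _ => l1Norm_nonneg _) (Finset.mem_univ i))
  have hk := isKernel_mollifier
  refine ⟨1 / 2 + R * C1 + R * (R * C2), by positivity, fun f M hf hM => ?_⟩
  have hM0 : 0 ≤ M := (abs_nonneg _).trans (hM 0)
  have hp1 : ∀ i, pderiv i (smear f) = fun x =>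
      R * scaledConv (pderiv i mollifier) f baseScale x := by
    intro i
    have h := pderiv_sub (differentiable_scaledConv hk hf.continuous baseScale_pos.ne')
      (differentiable_const (mean f)) i
    rw [pderiv_const, pderiv_scaledConv_kernel hk hf.continuous baseScale_pos.ne'] at h
    refine Eq.trans h (funext fun x => ?_)
    rw [sub_zero]
  have hp2 : ∀ i j, pderiv j (pderiv i (smear f)) = fun x =>
      R * (R * scaledConv (pderiv j (pderiv i mollifier)) f baseScale x) := by
    intro i j
    rw [hp1, pderiv_const_mul (differentiable_scaledConv (hk.pderiv i) hf.continuous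
      baseScale_pos.ne'), pderiv_scaledConv_kernel (hk.pderiv i) hf.continuous baseScale_pos.ne']
  have hb0 : 0 ≤ R * C1 * M := by positivity
  have hb1 : 0 ≤ R * (R * C2) * M := by positivity
  refine ⟨fun x => (abs_smear_le hf hM x).trans (by nlinarith), fun i x => ?_, fun i j x => ?_⟩
  · rw [hp1, abs_mul, abs_of_pos hR0]
    have h3 := (abs_scaledConv_le (hk.pderiv i) hM baseScale x).trans
      (mul_le_mul_of_nonneg_right (h1 i) hM0)
    have h4 := mul_le_mul_of_nonneg_left h3 hR0.le
    nlinarith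
  · rw [hp2, abs_mul, abs_mul, abs_of_pos hR0]
    have h3 := (abs_scaledConv_le ((hk.pderiv i).pderiv j) hM baseScale x).trans
      (mul_le_mul_of_nonneg_right (h2 i j) hM0)
    have h4 := mul_le_mul_of_nonneg_left (mul_le_mul_of_nonneg_left h3 hR0.le) hR0.le
    nlinarith

/-- Writing `resolvent F = F + smear (resolvent F)`, the first term is a dyadic sum, and the second
is smooth with derivatives controlled by the sup norm of `F`. -/
lemma exists_holderBound_resolvent {θ : ℝ} (hθ : θ ∈ Set.Ioo (0 : ℝ) 1) :
    ∃ C, 0 ≤ C ∧ ∀ (f : ℕ → E3 → ℝ) (M : ℝ), 0 ≤ M → (∀ k, IsPC (f k)) →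
      (∀ k, Differentiable ℝ (f k)) → (∀ k x, |f k x| ≤ M * dyadicScale k ^ θ) →
      (∀ k i x, |pderiv i (f k) x| ≤ M * dyadicScale k ^ (θ - 1)) →
      HolderBound θ (C * M) (resolvent fun x => ∑' k, f k x) := by
  obtain ⟨C, hC0, hC⟩ := exists_holderBound_tsum hθ
  obtain ⟨D, hD0, hD⟩ := exists_smear_bound
  refine ⟨C + (2 * (D * (2 * C)) + 3 * (D * (2 * C))), by positivity,
    fun f M hM hpc hd hf hp => ?_⟩
  have hF := hC f M hM hd hf hp
  have hFpc : IsPC fun x => ∑' k, f k x :=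
    IsPC.tsum hpc ((summable_dyadicScale_rpow hθ.1).mul_left M) hf
  obtain ⟨h1, h2, -⟩ := hD _ _ hFpc.resolvent (abs_resolvent_le hFpc hF.1)
  have h := hF.add (holderBound_of_pderiv hθ
    (TestFunction.differentiable (smear_mem_test hFpc.resolvent)) h1 h2)
  rw [show (resolvent fun x => ∑' k, f k x) = _ from funext (resolvent_eq hFpc)]
  exact h.mono (le_of_eq (by ring))

/-- With one more power of the scale the series may be differentiated term by term, and each
differentiated series is a dyadic sum of exponent `θ`. The smeared remainder now needs two
derivatives. -/
lemma exists_c1HolderBound_resolvent {θ : ℝ} (hθ : θ ∈ Set.Ioo (0 : ℝ) 1) :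
    ∃ C, 0 ≤ C ∧ ∀ (f : ℕ → E3 → ℝ) (M : ℝ), 0 ≤ M → (∀ k, IsPC (f k)) →
      (∀ k, ContDiff ℝ 1 (f k)) → (∀ k i, Differentiable ℝ (pderiv i (f k))) →
      (∀ k x, |f k x| ≤ M * dyadicScale k ^ (θ + 1)) →
      (∀ k i x, |pderiv i (f k) x| ≤ M * dyadicScale k ^ θ) →
      (∀ k i j x, |pderiv j (pderiv i (f k)) x| ≤ M * dyadicScale k ^ (θ - 1)) →
      ContDiff ℝ 1 (resolvent fun x => ∑' k, f k x) ∧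
      (∀ x, |resolvent (fun x => ∑' k, f k x) x| ≤ C * M) ∧
      ∀ i, HolderBound θ (C * M) (pderiv i (resolvent fun x => ∑' k, f k x)) := by
  obtain ⟨C, hC0, hC⟩ := exists_holderBound_tsum hθ
  obtain ⟨D, hD0, hD⟩ := exists_smear_bound
  have hθ1 : 0 < θ + 1 := by linarith [hθ.1]
  set C1 := ∑' k, dyadicScale k ^ (θ + 1) with hC1
  have hC10 : 0 ≤ C1 := tsum_nonneg fun k => Real.rpow_nonneg (dyadicScale_pos k).le _
  refine ⟨2 * C1 + (C + (2 * (D * (2 * C1)) + 3 * (D * (2 * C1)))), by positivity,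
    fun f M hM hpc hd hd2 hf hp hpp => ?_⟩
  have hsum := (summable_dyadicScale_rpow hθ1).mul_left M
  have hsum' := (summable_dyadicScale_rpow hθ.1).mul_left M
  have hFpc : IsPC fun x => ∑' k, f k x := IsPC.tsum hpc hsum hf
  have hFb : ∀ x, |∑' k, f k x| ≤ C1 * M := fun x => by
    refine (tsum_of_norm_bounded (f := fun k => f k x) hsum.hasSum fun k => hf k x).trans (le_of_eq ?_)
    rw [tsum_mul_left, mul_comm]
  have hres := abs_resolvent_le hFpc hFb
  obtain ⟨h1, h2, h3⟩ := hD _ _ hFpc.resolvent hres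
  have hsm := smear_mem_test hFpc.resolvent
  obtain ⟨hFd, hFp⟩ := differentiable_tsum_pderiv hsum hsum'
    (fun k => (hd k).differentiable one_ne_zero) hf hp
  have heq : (resolvent fun x => ∑' k, f k x) = _ := funext (resolvent_eq hFpc)
  have hpd : ∀ i, pderiv i (resolvent fun x => ∑' k, f k x) = fun x =>
      (∑' k, pderiv i (f k) x) + pderiv i (smear (resolvent fun x => ∑' k, f k x)) x := fun i => by
    conv_lhs => rw [heq]
    rw [pderiv_add hFd (TestFunction.differentiable hsm), hFp]
  have hFc : ∀ i, Continuous fun x => ∑' k, pderiv i (f k) x := fun i =>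
    continuous_tsum (fun k => (hd2 k i).continuous) hsum' fun k x => hp k i x
  refine ⟨contDiff_one_of_pderiv ?_ fun i => ?_, fun x => (hres x).trans ?_, fun i => ?_⟩
  · rw [heq]
    exact hFd.fun_add (TestFunction.differentiable hsm)
  · rw [hpd]
    exact (hFc i).add (pderiv_mem i hsm).1.continuous
  · have : 0 ≤ (C + (2 * (D * (2 * C1)) + 3 * (D * (2 * C1)))) * M := by positivity
    linarith
  · rw [hpd]
    refine ((hC (fun k => pderiv i (f k)) M hM (fun k => hd2 k i) (fun k x => hp k i x)
      (fun k j x => hpp k i j x)).add (holderBound_of_pderiv hθ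
      (TestFunction.differentiable (pderiv_mem i hsm)) (h2 i) (h3 i))).mono ?_
    have : 0 ≤ 2 * C1 * M := by positivity
    linarith

/-! ### Cancellation for solenoidal fields -/

lemma IsSolenoidal.isPC {v : E3 → E3} (hv : IsSolenoidal v) (i : Fin 3) :
    IsPC fun x => v x i := by
  refine ⟨?_, fun j x => by rw [hv.periodic]⟩
  have := hv.continuous
  fun_prop

/-- Up to a power of `r` the sum `u` is the divergence of a mollified `v`. Its squared `L²` norm,
after passing to the adjoint, is `v` paired with the gradient of the test function `scaledConv η u
(-r)`, hence zero. -/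
lemma IsSolenoidal.sum_scaledConv_eq_zero {v : E3 → E3} (hv : IsSolenoidal v) {η : E3 → ℝ}
    (hη : IsKernel η) {r : ℝ} (hr : r ≠ 0) (x : E3) :
    ∑ i, scaledConv (pderiv i η) (fun z => v z i) r x = 0 := by
  set u : E3 → ℝ := fun x => ∑ i, scaledConv (pderiv i η) (fun z => v z i) r x with hu
  have hupc : IsPC u := IsPC.sum _ fun i _ => (hv.isPC i).scaledConv (hη.pderiv i) r
  have hr' : -r ≠ 0 := neg_ne_zero.2 hr
  have hψ := scaledConv_mem_test hη hupc hr'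
  have h0 := hv.div_eq_zero ⟨_, hψ⟩
  have h1 : ∀ i x, scaledConv (pderiv i η) u (-r) x = -r * pderiv i (scaledConv η u (-r)) x := by
    intro i x
    rw [pderiv_scaledConv_kernel hη hupc.continuous hr']
    field_simp
  have h2 : ∫ x in cell, u x * u x = 0 := by
    calc ∫ x in cell, u x * u x
        = ∑ i, ∫ x in cell, scaledConv (pderiv i η) (fun z => v z i) r x * u x := by
          rw [← integral_finsetSum _ fun i _ =>
            (((hv.isPC i).scaledConv (hη.pderiv i) r).mul hupc).integrableOn]
          simp only [← Finset.sum_mul]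
          rfl
      _ = ∑ i, ∫ x in cell, -r * (v x i * pderiv i (scaledConv η u (-r)) x) := by
          refine Finset.sum_congr rfl fun i _ => ?_
          rw [setIntegral_scaledConv_mul (hη.pderiv i) (hv.isPC i) hupc]
          simp only [h1]
          congr 1 with x
          ring
      _ = -r * ∫ x in cell, ∑ i, v x i * pderiv i (scaledConv η u (-r)) x := by
          rw [integral_finsetSum _ fun i _ =>
            ((hv.isPC i).mul (IsPC.of_test (pderiv_mem i hψ))).integrableOn, Finset.mul_sum]
          simp only [integral_const_mul]
      _ = 0 := by
          rw [show ∫ x in cell, ∑ i, v x i * pderiv i (scaledConv η u (-r)) x = 0 from h0, mul_zero]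
  exact congrFun (hupc.eq_zero_of_integral_sq h2) x

lemma scaledConv_affine {κ : E3 → ℝ} (hκ : IsKernel κ) {f G a b c : E3 → ℝ} (hG : Continuous G)
    (ha : Continuous a) (hb : Continuous b) (hc : Continuous c) {c₁ c₂ c₃ c₄ : ℝ}
    (hf : ∀ z, f z = G z + (c₁ * a z + (c₂ * b z + (c₃ * c z + c₄)))) (r : ℝ) (x : E3) :
    scaledConv κ f r x = scaledConv κ G r x + (c₁ * scaledConv κ a r x +
      (c₂ * scaledConv κ b r x + (c₃ * scaledConv κ c r x + c₄ * ∫ y, κ y))) := by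
  rw [funext hf, scaledConv_add hκ hG (by fun_prop), scaledConv_add hκ (by fun_prop) (by fun_prop),
    scaledConv_add hκ (by fun_prop) (by fun_prop), scaledConv_add hκ (by fun_prop) (by fun_prop),
    scaledConv_const_mul, scaledConv_const_mul, scaledConv_const_mul, scaledConv_const]

lemma abs_scaledConv_le_local {κ : E3 → ℝ} (hκ : IsKernel κ) {G : E3 → ℝ} {M r : ℝ} {x : E3}
    (h : ∀ z, ‖z - x‖ ≤ |r| → |G z| ≤ M) : |scaledConv κ G r x| ≤ l1Norm κ * M := by
  refine hκ.abs_integral_le fun y hy => h _ ?_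
  rw [show x - r • y - x = -(r • y) by abel, norm_neg, norm_smul, Real.norm_eq_abs]
  exact mul_le_of_le_one_right (abs_nonneg r) hy

/-- Componentwise Hölder continuity of exponent `θ` with constant `V`. -/
def HolderField (θ V : ℝ) (v : E3 → E3) : Prop :=
  ∀ i x y, |v x i - v y i| ≤ V * ‖x - y‖ ^ θ

lemma HolderField.abs_sub_le {θ V : ℝ} {v : E3 → E3} (hv : HolderField θ V v) (hθ : 0 ≤ θ)
    (hV : 0 ≤ V) {x z : E3} {r : ℝ} (h : ‖z - x‖ ≤ |r|) (i : Fin 3) :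
    |v z i - v x i| ≤ V * |r| ^ θ :=
  (hv i z x).trans (mul_le_mul_of_nonneg_left
    (Real.rpow_le_rpow (norm_nonneg _) h hθ) hV)

/-- The coefficients of `div div (v ⊗ w)`. -/
def doubleCoeff (v w : E3 → E3) (α : Fin 3 × Fin 3) (x : E3) : ℝ := v x α.1 * w x α.2

/-- The directions of differentiation in `div div (v ⊗ w)`. -/
def doubleDirs (α : Fin 3 × Fin 3) : List (Fin 3) := [α.2, α.1]

/-- The coefficients of `div div div (v ⊗ w ⊗ z)`. -/
def tripleCoeff (v w z : E3 → E3) (α : Fin 3 × Fin 3 × Fin 3) (x : E3) : ℝ :=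
  v x α.1 * w x α.2.1 * z x α.2.2

/-- The directions of differentiation in `div div div (v ⊗ w ⊗ z)`. -/
def tripleDirs (α : Fin 3 × Fin 3 × Fin 3) : List (Fin 3) := [α.2.2, α.2.1, α.1]

/-- The sum of the `L¹` norms of the derivatives of a kernel. -/
def divBound {ι : Type} [Fintype ι] (l : ι → List (Fin 3)) (κ : E3 → ℝ) : ℝ :=
  ∑ α, l1Norm (pderivs (l α) κ)

/-- Freezing `v` and `w` at `x` leaves only the product of increments: the linear terms vanish by
solenoidality, the constant one because a derivative of a kernel has integral zero. This is where
exponents `β` and `γ` add up. -/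
lemma abs_divConv_double_le {v w : E3 → E3} (hv : IsSolenoidal v) (hw : IsSolenoidal w)
    {β γ V W : ℝ} (hβ : 0 < β) (hγ : 0 < γ) (hV : 0 ≤ V) (hW : 0 ≤ W) (hvV : HolderField β V v)
    (hwW : HolderField γ W w) {κ : E3 → ℝ} (hκ : IsKernel κ) {r : ℝ} (hr : r ≠ 0) (x : E3) :
    |divConv (doubleCoeff v w) doubleDirs κ r x| ≤
      divBound doubleDirs κ * (V * W * |r| ^ (β + γ)) := by
  have hr0 : 0 < |r| := abs_pos.2 hr
  set G : Fin 3 × Fin 3 → E3 → ℝ := fun α z => (v z α.1 - v x α.1) * (w z α.2 - w x α.2) with hG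
  have hGc : ∀ α, Continuous (G α) := fun α =>
    ((hv.isPC _).continuous.sub continuous_const).mul ((hw.isPC _).continuous.sub continuous_const)
  -- The derivatives are reordered so that the one contracted with the remaining field is outermost,
  -- and the inner ones become part of the kernel.
  have h1 : ∀ α, scaledConv (pderivs (doubleDirs α) κ) (doubleCoeff v w α) r x =
      scaledConv (pderivs (doubleDirs α) κ) (G α) r x +
      (w x α.2 * scaledConv (pderiv α.1 (pderiv α.2 κ)) (fun z => v z α.1) r x +
      v x α.1 * scaledConv (pderiv α.2 (pderiv α.1 κ)) (fun z => w z α.2) r x) := by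
    intro α
    have h := scaledConv_affine (hκ.pderivs (doubleDirs α)) (hGc α) (hv.isPC α.1).continuous
      (hw.isPC α.2).continuous continuous_const (f := doubleCoeff v w α) (c₁ := w x α.2)
      (c₂ := v x α.1) (c₃ := 0) (c := fun _ => 0) (c₄ := -(v x α.1 * w x α.2))
      (fun z => by simp only [doubleCoeff, hG]; ring) r x
    have h0 : ∫ y, pderivs (doubleDirs α) κ y = 0 := (hκ.pderiv α.1).integral_pderiv α.2
    rw [h, h0, pderiv_comm hκ.smooth α.1 α.2]
    change _ + (_ * scaledConv (pderiv α.2 (pderiv α.1 κ)) _ _ _ +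
      (_ * scaledConv (pderiv α.2 (pderiv α.1 κ)) _ _ _ + _)) = _
    ring
  have h2 : ∑ α : Fin 3 × Fin 3,
      w x α.2 * scaledConv (pderiv α.1 (pderiv α.2 κ)) (fun z => v z α.1) r x = 0 := by
    rw [Fintype.sum_prod_type_right]
    refine Finset.sum_eq_zero fun j _ => ?_
    dsimp only
    rw [← Finset.mul_sum, hv.sum_scaledConv_eq_zero (hκ.pderiv j) hr, mul_zero]
  have h3 : ∑ α : Fin 3 × Fin 3,
      v x α.1 * scaledConv (pderiv α.2 (pderiv α.1 κ)) (fun z => w z α.2) r x = 0 := by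
    rw [Fintype.sum_prod_type]
    refine Finset.sum_eq_zero fun i _ => ?_
    dsimp only
    rw [← Finset.mul_sum, hw.sum_scaledConv_eq_zero (hκ.pderiv i) hr, mul_zero]
  rw [divConv, Finset.sum_congr rfl fun α _ => h1 α, Finset.sum_add_distrib,
    Finset.sum_add_distrib, h2, h3, add_zero, add_zero, divBound, Finset.sum_mul]
  refine (Finset.abs_sum_le_sum_abs _ _).trans (Finset.sum_le_sum fun α _ => ?_)
  refine abs_scaledConv_le_local (hκ.pderivs _) fun z hz => ?_
  rw [abs_mul, Real.rpow_add hr0,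
    show V * W * (|r| ^ β * |r| ^ γ) = (V * |r| ^ β) * (W * |r| ^ γ) by ring]
  exact mul_le_mul (hvV.abs_sub_le hβ.le hV hz _) (hwW.abs_sub_le hγ.le hW hz _) (abs_nonneg _)
    (by positivity)

/-- The middle increment carries two bounds: `B'` (exponent `β`) when paired with `c`, `B''`
(exponent `γ`) when paired with `a`. In the cubic term it is bounded crudely by `2B`, which turns
the coefficient of `A' C' B` into `3`. -/
lemma abs_triple_remainder_le {a b c a₀ b₀ c₀ A B C A' B' B'' C' : ℝ} (ha₀ : |a₀| ≤ A)
    (hb₀ : |b₀| ≤ B) (hb : |b| ≤ B) (hc₀ : |c₀| ≤ C) (ha' : |a - a₀| ≤ A') (hb' : |b - b₀| ≤ B')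
    (hb'' : |b - b₀| ≤ B'') (hc' : |c - c₀| ≤ C') :
    |(a - a₀) * (b - b₀) * c₀ + (a - a₀) * (c - c₀) * b₀ + (b - b₀) * (c - c₀) * a₀ +
      (a - a₀) * (b - b₀) * (c - c₀)| ≤ A' * B'' * C + 3 * (A' * C' * B) + B' * C' * A := by
  have hA' := (abs_nonneg _).trans ha'
  have hB' := (abs_nonneg _).trans hb'
  have hB'' := (abs_nonneg _).trans hb''
  have hC' := (abs_nonneg _).trans hc'
  have hbb : |b - b₀| ≤ 2 * B := (abs_sub _ _).trans (by linarith)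
  have e1 : |(a - a₀) * (b - b₀) * c₀| ≤ A' * B'' * C := by
    rw [abs_mul, abs_mul]; gcongr
  have e2 : |(a - a₀) * (c - c₀) * b₀| ≤ A' * C' * B := by
    rw [abs_mul, abs_mul]; gcongr
  have e3 : |(b - b₀) * (c - c₀) * a₀| ≤ B' * C' * A := by
    rw [abs_mul, abs_mul]; gcongr
  have e4 : |(a - a₀) * (b - b₀) * (c - c₀)| ≤ A' * (2 * B) * C' := by
    have hB : 0 ≤ B := (abs_nonneg _).trans hb
    rw [abs_mul, abs_mul]; gcongr
  have t1 := abs_add_le ((a - a₀) * (b - b₀) * c₀ + (a - a₀) * (c - c₀) * b₀ +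
    (b - b₀) * (c - c₀) * a₀) ((a - a₀) * (b - b₀) * (c - c₀))
  have t2 := abs_add_le ((a - a₀) * (b - b₀) * c₀ + (a - a₀) * (c - c₀) * b₀)
    ((b - b₀) * (c - c₀) * a₀)
  have t3 := abs_add_le ((a - a₀) * (b - b₀) * c₀) ((a - a₀) * (c - c₀) * b₀)
  linarith

/-- As for two factors, the constant and linear terms of the expansion at `x` drop out. Products
with a single frozen factor remain, so the gain is again `|r| ^ (β + γ)`, though there are now three
derivatives. -/
lemma abs_divConv_triple_le {v w z : E3 → E3} (hv : IsSolenoidal v) (hw : IsSolenoidal w)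
    (hz : IsSolenoidal z) {β γ V₀ V W₀ Wβ Wγ Z₀ Z : ℝ} (hβ : 0 < β) (hγ : 0 < γ)
    (hV : 0 ≤ V) (hWβ : 0 ≤ Wβ) (hWγ : 0 ≤ Wγ) (hZ : 0 ≤ Z)
    (hv₀ : ∀ i x, |v x i| ≤ V₀) (hw₀ : ∀ i x, |w x i| ≤ W₀) (hz₀ : ∀ i x, |z x i| ≤ Z₀)
    (hvV : HolderField β V v) (hwβ : HolderField β Wβ w) (hwγ : HolderField γ Wγ w)
    (hzZ : HolderField γ Z z) {κ : E3 → ℝ} (hκ : IsKernel κ) {r : ℝ} (hr : r ≠ 0) (x : E3) :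
    |divConv (tripleCoeff v w z) tripleDirs κ r x| ≤
      divBound tripleDirs κ * (3 * (V₀ * Wβ * Z + V * (W₀ * Z + Wγ * Z₀)) * |r| ^ (β + γ)) := by
  have hr0 : 0 < |r| := abs_pos.2 hr
  set G : Fin 3 × Fin 3 × Fin 3 → E3 → ℝ := fun α y =>
    (v y α.1 - v x α.1) * (w y α.2.1 - w x α.2.1) * z x α.2.2 +
    (v y α.1 - v x α.1) * (z y α.2.2 - z x α.2.2) * w x α.2.1 +
    (w y α.2.1 - w x α.2.1) * (z y α.2.2 - z x α.2.2) * v x α.1 +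
    (v y α.1 - v x α.1) * (w y α.2.1 - w x α.2.1) * (z y α.2.2 - z x α.2.2) with hG
  have hGc : ∀ α, Continuous (G α) := fun α => by
    have h1 := (hv.isPC α.1).continuous
    have h2 := (hw.isPC α.2.1).continuous
    have h3 := (hz.isPC α.2.2).continuous
    have d1 := h1.sub (continuous_const (y := v x α.1))
    have d2 := h2.sub (continuous_const (y := w x α.2.1))
    have d3 := h3.sub (continuous_const (y := z x α.2.2))
    exact ((((d1.mul d2).mul continuous_const).add ((d1.mul d3).mul continuous_const)).add
      ((d2.mul d3).mul continuous_const)).add ((d1.mul d2).mul d3)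
  have hsm := fun i => (hκ.pderiv i).smooth
  have h1 : ∀ α, scaledConv (pderivs (tripleDirs α) κ) (tripleCoeff v w z α) r x =
      scaledConv (pderivs (tripleDirs α) κ) (G α) r x +
      (w x α.2.1 * z x α.2.2 * scaledConv (pderiv α.1 (pderiv α.2.1 (pderiv α.2.2 κ)))
        (fun y => v y α.1) r x +
      (v x α.1 * z x α.2.2 * scaledConv (pderiv α.2.1 (pderiv α.1 (pderiv α.2.2 κ)))
        (fun y => w y α.2.1) r x +
      v x α.1 * w x α.2.1 * scaledConv (pderiv α.2.2 (pderiv α.2.1 (pderiv α.1 κ)))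
        (fun y => z y α.2.2) r x)) := by
    intro α
    -- The constant is `1 - 3 = -2`: each of the three linear increments subtracts one copy of the
    -- frozen product.
    have h := scaledConv_affine (hκ.pderivs (tripleDirs α)) (hGc α) (hv.isPC α.1).continuous
      (hw.isPC α.2.1).continuous (hz.isPC α.2.2).continuous (f := tripleCoeff v w z α)
      (c₁ := w x α.2.1 * z x α.2.2) (c₂ := v x α.1 * z x α.2.2) (c₃ := v x α.1 * w x α.2.1)
      (c₄ := -2 * (v x α.1 * w x α.2.1 * z x α.2.2))
      (fun y => by simp only [tripleCoeff, hG]; ring) r x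
    have h0 : ∫ y, pderivs (tripleDirs α) κ y = 0 :=
      ((hκ.pderiv α.1).pderiv α.2.1).integral_pderiv α.2.2
    have hc1 : pderiv α.2.1 (pderiv α.1 (pderiv α.2.2 κ)) = pderivs (tripleDirs α) κ := by
      rw [pderiv_comm hκ.smooth α.1 α.2.2, pderiv_comm (hsm α.1) α.2.1 α.2.2]
      rfl
    have hc2 : pderiv α.1 (pderiv α.2.1 (pderiv α.2.2 κ)) = pderivs (tripleDirs α) κ := by
      rw [pderiv_comm (hsm α.2.2) α.1 α.2.1, hc1]
    rw [h, h0, hc1, hc2]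
    change _ = _ + (_ + (_ + _ * scaledConv (pderivs (tripleDirs α) κ) _ r x))
    ring
  have h2 : ∑ α : Fin 3 × Fin 3 × Fin 3, w x α.2.1 * z x α.2.2 *
      scaledConv (pderiv α.1 (pderiv α.2.1 (pderiv α.2.2 κ))) (fun y => v y α.1) r x = 0 := by
    rw [Fintype.sum_prod_type_right]
    refine Finset.sum_eq_zero fun j _ => ?_
    dsimp only
    rw [← Finset.mul_sum, hv.sum_scaledConv_eq_zero ((hκ.pderiv j.2).pderiv j.1) hr, mul_zero]
  have h3 : ∑ α : Fin 3 × Fin 3 × Fin 3, v x α.1 * z x α.2.2 *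
      scaledConv (pderiv α.2.1 (pderiv α.1 (pderiv α.2.2 κ))) (fun y => w y α.2.1) r x = 0 := by
    rw [Fintype.sum_prod_type]
    refine Finset.sum_eq_zero fun i _ => ?_
    rw [Fintype.sum_prod_type_right]
    refine Finset.sum_eq_zero fun k _ => ?_
    dsimp only
    rw [← Finset.mul_sum, hw.sum_scaledConv_eq_zero ((hκ.pderiv k).pderiv i) hr, mul_zero]
  have h4 : ∑ α : Fin 3 × Fin 3 × Fin 3, v x α.1 * w x α.2.1 *
      scaledConv (pderiv α.2.2 (pderiv α.2.1 (pderiv α.1 κ))) (fun y => z y α.2.2) r x = 0 := by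
    rw [Fintype.sum_prod_type]
    refine Finset.sum_eq_zero fun i _ => ?_
    rw [Fintype.sum_prod_type]
    refine Finset.sum_eq_zero fun j _ => ?_
    dsimp only
    rw [← Finset.mul_sum, hz.sum_scaledConv_eq_zero ((hκ.pderiv i).pderiv j) hr, mul_zero]
  rw [divConv, Finset.sum_congr rfl fun α _ => h1 α, Finset.sum_add_distrib,
    Finset.sum_add_distrib, Finset.sum_add_distrib, h2, h3, h4, add_zero, add_zero, add_zero,
    divBound, Finset.sum_mul]
  refine (Finset.abs_sum_le_sum_abs _ _).trans (Finset.sum_le_sum fun α _ => ?_)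
  refine abs_scaledConv_le_local (hκ.pderivs _) fun y hy => ?_
  refine (abs_triple_remainder_le (hv₀ α.1 x) (hw₀ α.2.1 x) (hw₀ α.2.1 y) (hz₀ α.2.2 x)
    (hvV.abs_sub_le hβ.le hV hy α.1) (hwβ.abs_sub_le hβ.le hWβ hy α.2.1)
    (hwγ.abs_sub_le hγ.le hWγ hy α.2.1) (hzZ.abs_sub_le hγ.le hZ hy α.2.2)).trans ?_
  have hV₀ : 0 ≤ V₀ := (abs_nonneg _).trans (hv₀ 0 0)
  have hZ₀ : 0 ≤ Z₀ := (abs_nonneg _).trans (hz₀ 0 0)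
  rw [Real.rpow_add hr0]
  -- Only the term with `W₀` needs the factor `3`; these nonnegative quantities pad the other two up
  -- to the common factor.
  have p1 : 0 ≤ V * Wγ * Z₀ * (|r| ^ β * |r| ^ γ) := by positivity
  have p2 : 0 ≤ V₀ * Wβ * Z * (|r| ^ β * |r| ^ γ) := by positivity
  linarith

/-! ### Bounds for the dyadic pieces -/

lemma divBound_nonneg {ι : Type} [Fintype ι] (l : ι → List (Fin 3)) (κ : E3 → ℝ) :
    0 ≤ divBound l κ := Finset.sum_nonneg fun _ _ => l1Norm_nonneg _

lemma contDiff_dyadicPiece {ι : Type} [Fintype ι] {a : ι → E3 → ℝ} (ha : ∀ α, IsPC (a α))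
    (l : ι → List (Fin 3)) (m : ℕ) (s : ℝ) (k : ℕ) : ContDiff ℝ ∞ (dyadicPiece a l m s k) :=
  contDiff_const.mul (ContDiff.sum fun α _ => contDiff_scaledConv
    (isKernel_potentialPiece.pderivs _) (ha α).continuous (neg_ne_zero.2 (dyadicScale_pos k).ne'))

/-- The hypothesis is required for every kernel so that it applies to `potentialPiece` and to its
first and second derivatives alike. Its constant depends on `l` alone, which keeps the final
constant independent of the fields. -/
lemma exists_dyadicPiece_bound {ι : Type} [Fintype ι] (l : ι → List (Fin 3)) :
    ∃ C, 0 ≤ C ∧ ∀ (a : ι → E3 → ℝ) (m : ℕ) (s K σ : ℝ), (∀ α, IsPC (a α)) → |s| = 1 → 0 ≤ K →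
      (∀ κ, IsKernel κ → ∀ r, r ≠ 0 → ∀ x,
        |divConv a l κ r x| ≤ divBound l κ * (K * |r| ^ σ)) → ∀ k,
      (∀ x, |dyadicPiece a l m s k x| ≤ C * K * dyadicScale k ^ (σ + 2 - m)) ∧
      (∀ i x, |pderiv i (dyadicPiece a l m s k) x| ≤ C * K * dyadicScale k ^ (σ + 2 - m - 1)) ∧
      ∀ i j x, |pderiv j (pderiv i (dyadicPiece a l m s k)) x| ≤
        C * K * dyadicScale k ^ (σ + 2 - m - 1 - 1) := by
  have hk := isKernel_potentialPiece
  set h := potentialPiece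
  set C0 := divBound l h
  set C1 := ∑ i, divBound l (pderiv i h) with hC1
  set C2 := ∑ i, ∑ j, divBound l (pderiv j (pderiv i h)) with hC2
  have hC00 : 0 ≤ C0 := divBound_nonneg _ _
  have hC10 : 0 ≤ C1 := Finset.sum_nonneg fun i _ => divBound_nonneg _ _
  have hC20 : 0 ≤ C2 := Finset.sum_nonneg fun i _ => Finset.sum_nonneg fun j _ => divBound_nonneg _ _
  have h1 : ∀ i, divBound l (pderiv i h) ≤ C1 := fun i =>
    Finset.single_le_sum (f := fun i => divBound l (pderiv i h))
      (fun i _ => divBound_nonneg _ _) (Finset.mem_univ i)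
  have h2 : ∀ i j, divBound l (pderiv j (pderiv i h)) ≤ C2 := fun i j =>
    (Finset.single_le_sum (f := fun j => divBound l (pderiv j (pderiv i h)))
      (fun i _ => divBound_nonneg _ _) (Finset.mem_univ j)).trans
    (Finset.single_le_sum (f := fun i => ∑ j, divBound l (pderiv j (pderiv i h)))
      (fun i _ => Finset.sum_nonneg fun j _ => divBound_nonneg _ _) (Finset.mem_univ i))
  have hC0h : divBound l h ≤ C0 := le_rfl
  clear_value C0 C1 C2
  refine ⟨C0 + C1 + C2, by positivity, fun a m s K σ ha hs hK hb k => ?_⟩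
  set r := dyadicScale k with hr
  have hr0 : 0 < r := dyadicScale_pos k
  have hrn : -r ≠ 0 := neg_ne_zero.2 hr0.ne'
  set c := s * (r ^ 2 * r⁻¹ ^ m) with hc
  have hcabs : |c| = r ^ (2 - m : ℝ) := by
    rw [hc, abs_mul, hs, one_mul, abs_of_pos (by positivity), Real.rpow_sub hr0,
      Real.rpow_natCast, inv_pow, div_eq_mul_inv]
    norm_num
  have hconv : ∀ κ, IsKernel κ → divBound l κ ≤ C0 + C1 + C2 → ∀ x,
      |divConv a l κ (-r) x| ≤ (C0 + C1 + C2) * K * r ^ σ := fun κ hκ hle x => by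
    refine (hb κ hκ (-r) hrn x).trans ?_
    rw [abs_neg, abs_of_pos hr0, mul_assoc]
    exact mul_le_mul_of_nonneg_right hle (by positivity)
  have hp0 : ∀ x, dyadicPiece a l m s k x = c * divConv a l h (-r) x := fun x => rfl
  have hp1 : ∀ i, pderiv i (dyadicPiece a l m s k) = fun x =>
      c * ((-r)⁻¹ * divConv a l (pderiv i h) (-r) x) := fun i => by
    refine (pderiv_const_mul (differentiable_divConv ha hk hrn) c i).trans ?_
    rw [pderiv_divConv ha hk hrn]
  have hp2 : ∀ i j, pderiv j (pderiv i (dyadicPiece a l m s k)) = fun x =>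
      c * ((-r)⁻¹ * ((-r)⁻¹ * divConv a l (pderiv j (pderiv i h)) (-r) x)) := fun i j => by
    have hd := differentiable_divConv (l := l) ha (hk.pderiv i) hrn
    rw [hp1, pderiv_const_mul (hd.const_mul _), pderiv_const_mul hd,
      pderiv_divConv ha (hk.pderiv i) hrn]
  clear_value c
  have habs : |(-r)⁻¹| = r⁻¹ := by rw [abs_inv, abs_neg, abs_of_pos hr0]
  have e0 : r ^ (σ + 2 - m) = r ^ (2 - m : ℝ) * r ^ σ := by
    rw [← Real.rpow_add hr0]
    ring_nf
  refine ⟨fun x => ?_, fun i x => ?_, fun i j x => ?_⟩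
  · rw [hp0, abs_mul, hcabs, e0, mul_left_comm]
    exact mul_le_mul_of_nonneg_left (hconv h hk (by linarith) x) (by positivity)
  · rw [hp1, abs_mul, abs_mul, hcabs, habs, Real.rpow_sub_one hr0.ne', e0]
    refine (mul_le_mul_of_nonneg_left (mul_le_mul_of_nonneg_left
      (hconv _ (hk.pderiv i) ((h1 i).trans (by linarith)) x) (by positivity))
      (by positivity)).trans (le_of_eq ?_)
    rw [div_eq_mul_inv]
    ring
  · rw [hp2, abs_mul, abs_mul, abs_mul, hcabs, habs, Real.rpow_sub_one hr0.ne',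
      Real.rpow_sub_one hr0.ne', e0]
    refine (mul_le_mul_of_nonneg_left (mul_le_mul_of_nonneg_left (mul_le_mul_of_nonneg_left
      (hconv _ ((hk.pderiv i).pderiv j) ((h2 i j).trans (by linarith)) x) (by positivity))
      (by positivity)) (by positivity)).trans (le_of_eq ?_)
    rw [div_eq_mul_inv, div_eq_mul_inv]
    ring

/-! ### Extended norms -/

lemma supNorm_le {f : E3 → ℝ} {M : ℝ} (h : ∀ x, |f x| ≤ M) : supNorm f ≤ ENNReal.ofReal M :=
  iSup_le fun x => by
    rw [Real.enorm_eq_ofReal_abs]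
    exact ENNReal.ofReal_le_ofReal (h x)

lemma enorm_sub_rpow {θ : ℝ} (hθ : 0 ≤ θ) (x y : E3) :
    ‖x - y‖ₑ ^ θ = ENNReal.ofReal (‖x - y‖ ^ θ) := by
  rw [← ofReal_norm, ENNReal.ofReal_rpow_of_nonneg (norm_nonneg _) hθ]

lemma holderSeminorm_le {θ : ℝ} (hθ : 0 ≤ θ) {f : E3 → ℝ} {M : ℝ} (hM : 0 ≤ M)
    (h : ∀ x y, |f x - f y| ≤ M * ‖x - y‖ ^ θ) : holderSeminorm θ f ≤ ENNReal.ofReal M :=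
  iSup_le fun x => iSup_le fun y => iSup_le fun _ => ENNReal.div_le_of_le_mul (by
    rw [Real.enorm_eq_ofReal_abs, enorm_sub_rpow hθ, ← ENNReal.ofReal_mul hM]
    exact ENNReal.ofReal_le_ofReal (h x y))

lemma HolderBound.holderNorm_le {θ M : ℝ} (hθ : 0 ≤ θ) {f : E3 → ℝ} (h : HolderBound θ M f) :
    holderNorm θ f ≤ ENNReal.ofReal (2 * M) := by
  have hM : 0 ≤ M := (abs_nonneg _).trans (h.1 0)
  rw [two_mul, ENNReal.ofReal_add hM hM]
  exact add_le_add (supNorm_le h.1) (holderSeminorm_le hθ hM h.2)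

lemma c1HolderNorm_le {θ M : ℝ} (hθ : 0 ≤ θ) {f : E3 → ℝ} (h : ∀ x, |f x| ≤ M)
    (hp : ∀ i, HolderBound θ M (pderiv i f)) : c1HolderNorm θ f ≤ ENNReal.ofReal (3 * M) := by
  have hM : 0 ≤ M := (abs_nonneg _).trans (h 0)
  rw [show 3 * M = M + M + M by ring, ENNReal.ofReal_add (by positivity) hM,
    ENNReal.ofReal_add hM hM]
  exact add_le_add (add_le_add (supNorm_le h) (iSup_le fun i => supNorm_le (hp i).1))
    (iSup_le fun i => holderSeminorm_le hθ hM (hp i).2)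

lemma supNorm_lt_top {θ : ℝ} {v : E3 → E3} (h : holderNorm θ v < ⊤) : supNorm v < ⊤ :=
  lt_of_le_of_lt le_self_add h

lemma abs_apply_le_supNorm {v : E3 → E3} (h : supNorm v < ⊤) (i : Fin 3) (x : E3) :
    |v x i| ≤ (supNorm v).toReal := by
  have h1 : |v x i| ≤ ‖v x‖ := by simpa using PiLp.norm_apply_le (v x) i
  refine h1.trans ?_
  rw [← toReal_enorm]
  exact ENNReal.toReal_mono h.ne (le_iSup (fun x => ‖v x‖ₑ) x)

lemma holderField_toReal {θ : ℝ} (hθ : 0 < θ) {v : E3 → E3} (h : holderNorm θ v < ⊤) :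
    HolderField θ (holderNorm θ v).toReal v := by
  intro i x y
  rcases eq_or_ne x y with rfl | hxy
  · simp only [sub_self, abs_zero]
    positivity
  have h1 : |v x i - v y i| ≤ ‖v x - v y‖ := by simpa using PiLp.norm_apply_le (v x - v y) i
  have h2 : ‖v x - v y‖ₑ / ‖x - y‖ₑ ^ θ ≤ holderNorm θ v :=
    (le_iSup_of_le x (le_iSup_of_le y (le_iSup (fun _ : x ≠ y => ‖v x - v y‖ₑ / ‖x - y‖ₑ ^ θ) hxy))).trans le_add_self
  have hpos : 0 < ‖x - y‖ ^ θ := Real.rpow_pos_of_pos (norm_pos_iff.2 (sub_ne_zero.2 hxy)) _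
  rw [enorm_sub_rpow hθ.le, ENNReal.div_le_iff (by simpa using hpos) ENNReal.ofReal_ne_top] at h2
  refine h1.trans ?_
  rw [← toReal_enorm]
  have h3 := ENNReal.toReal_mono (ENNReal.mul_ne_top h.ne ENNReal.ofReal_ne_top) h2
  rwa [ENNReal.toReal_mul, ENNReal.toReal_ofReal hpos.le] at h3

/-! ### Double divergences -/

lemma isPC_doubleCoeff {v w : E3 → E3} (hv : IsSolenoidal v) (hw : IsSolenoidal w)
    (α : Fin 3 × Fin 3) : IsPC (doubleCoeff v w α) :=
  (hv.isPC α.1).mul (hw.isPC α.2)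

lemma isPC_tripleCoeff {v w z : E3 → E3} (hv : IsSolenoidal v) (hw : IsSolenoidal w)
    (hz : IsSolenoidal z) (α : Fin 3 × Fin 3 × Fin 3) : IsPC (tripleCoeff v w z α) :=
  ((hv.isPC α.1).mul (hw.isPC α.2.1)).mul (hz.isPC α.2.2)

/-- The sign is `-1` here because two integrations by parts leave no sign to offset that of `-Δ`;
for three derivatives the signs cancel. -/
lemma isDoubleSolution_iff {v w : E3 → E3} {P : PeriodicDistribution} :
    IsDoubleSolution v w P ↔ SolvesDiv (doubleCoeff v w) doubleDirs (-1) P := by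
  have h : ∀ φ, divFunctional (doubleCoeff v w) doubleDirs φ =
      ∫ x in cell, ∑ i, ∑ j, v x i * w x j * (testD j (testD i φ)).1 x := fun φ => by
    simp only [divFunctional, Fintype.sum_prod_type]
    rfl
  refine ⟨fun hP => ⟨hP.average, fun φ => ?_⟩, fun hP => ⟨hP.average, fun φ => ?_⟩⟩
  · rw [h, ← hP.eqn]
    ring
  · rw [hP.eqn, h]
    ring

lemma isTripleSolution_iff {v w z : E3 → E3} {Q : PeriodicDistribution} :
    IsTripleSolution v w z Q ↔ SolvesDiv (tripleCoeff v w z) tripleDirs 1 Q := by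
  have h : ∀ φ, divFunctional (tripleCoeff v w z) tripleDirs φ =
      ∫ x in cell, ∑ i, ∑ j, ∑ k, v x i * w x j * z x k *
        (testD k (testD j (testD i φ))).1 x := fun φ => by
    simp only [divFunctional, Fintype.sum_prod_type]
    rfl
  refine ⟨fun hQ => ⟨hQ.average, fun φ => ?_⟩, fun hQ => ⟨hQ.average, fun φ => ?_⟩⟩
  · rw [h, one_mul, ← neg_inj, hQ.eqn]
  · rw [hQ.eqn, h, one_mul]

variable {β γ : ℝ}

lemma double_estimate (hβ : 0 < β) (hγ : 0 < γ) (hβγ : β + γ < 1) :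
    ∃ C : ℝ≥0, ∀ v w : E3 → E3, IsSolenoidal v → IsSolenoidal w →
      holderNorm β v < ⊤ → holderNorm γ w < ⊤ →
      ∀ P : PeriodicDistribution, IsDoubleSolution v w P →
        ∃ p : E3 → ℝ, P.IsFunction p ∧
          holderNorm (β + γ) p ≤ C * holderNorm β v * holderNorm γ w := by
  have hσ : β + γ ∈ Set.Ioo (0 : ℝ) 1 := ⟨by positivity, hβγ⟩
  obtain ⟨C₁, hC₁0, hC₁⟩ := exists_dyadicPiece_bound doubleDirs
  obtain ⟨C₂, hC₂0, hC₂⟩ := exists_holderBound_resolvent hσ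
  refine ⟨(2 * (C₂ * C₁)).toNNReal, fun v w hv hw hvn hwn P hP => ?_⟩
  set V := (holderNorm β v).toReal with hV
  set W := (holderNorm γ w).toReal with hW
  have hV0 : 0 ≤ V := ENNReal.toReal_nonneg
  have hW0 : 0 ≤ W := ENNReal.toReal_nonneg
  have ha := isPC_doubleCoeff hv hw
  have hb := hC₁ (doubleCoeff v w) 2 (-1) (V * W) (β + γ) ha (by simp) (by positivity)
    fun κ hκ r hr x => abs_divConv_double_le hv hw hβ hγ hV0 hW0 (holderField_toReal hβ hvn)
      (holderField_toReal hγ hwn) hκ hr x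
  -- The two powers of the scale gained by inverting the Laplacian compensate the two derivatives
  -- exactly.
  rw [show β + γ + 2 - ((2 : ℕ) : ℝ) = β + γ by push_cast; ring] at hb
  refine ⟨_, (isDoubleSolution_iff.1 hP).isFunction ha (m := 2) (fun _ => rfl)
    ((summable_dyadicScale_rpow hσ.1).mul_left _) fun k => (hb k).1, ?_⟩
  have hH := hC₂ (dyadicPiece (doubleCoeff v w) doubleDirs 2 (-1)) (C₁ * (V * W)) (by positivity)
    (isPC_dyadicPiece ha _) (fun k => (contDiff_dyadicPiece ha _ _ _ k).differentiable (by simp))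
    (fun k => (hb k).1) (fun k => (hb k).2.1)
  refine (hH.holderNorm_le hσ.1.le).trans (le_of_eq ?_)
  rw [show 2 * (C₂ * (C₁ * (V * W))) = 2 * (C₂ * C₁) * V * W by ring,
    ENNReal.ofReal_mul (by positivity), ENNReal.ofReal_mul (by positivity), hV, hW,
    ENNReal.ofReal_toReal hvn.ne, ENNReal.ofReal_toReal hwn.ne]
  rfl

lemma double_estimate_c1 (hβ : β ∈ Set.Ioo (0 : ℝ) 1) (hγ : γ ∈ Set.Ioo (0 : ℝ) 1)
    (hβγ : 1 < β + γ) :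
    ∃ C : ℝ≥0, ∀ v w : E3 → E3, IsSolenoidal v → IsSolenoidal w →
      holderNorm β v < ⊤ → holderNorm γ w < ⊤ →
      ∀ P : PeriodicDistribution, IsDoubleSolution v w P →
        ∃ p : E3 → ℝ, P.IsFunction p ∧ ContDiff ℝ 1 p ∧
          c1HolderNorm (β + γ - 1) p ≤ C * holderNorm β v * holderNorm γ w := by
  have hσ : β + γ - 1 ∈ Set.Ioo (0 : ℝ) 1 := ⟨by linarith, by linarith [hβ.2, hγ.2]⟩
  have hσ1 : β + γ - 1 + 1 = β + γ := by ring
  obtain ⟨C₁, hC₁0, hC₁⟩ := exists_dyadicPiece_bound doubleDirs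
  obtain ⟨C₂, hC₂0, hC₂⟩ := exists_c1HolderBound_resolvent hσ
  refine ⟨(3 * (C₂ * C₁)).toNNReal, fun v w hv hw hvn hwn P hP => ?_⟩
  set V := (holderNorm β v).toReal with hV
  set W := (holderNorm γ w).toReal with hW
  have hV0 : 0 ≤ V := ENNReal.toReal_nonneg
  have hW0 : 0 ≤ W := ENNReal.toReal_nonneg
  have ha := isPC_doubleCoeff hv hw
  have hb := hC₁ (doubleCoeff v w) 2 (-1) (V * W) (β + γ) ha (by simp) (by positivity)
    fun κ hκ r hr x => abs_divConv_double_le hv hw hβ.1 hγ.1 hV0 hW0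
      (holderField_toReal hβ.1 hvn) (holderField_toReal hγ.1 hwn) hκ hr x
  rw [show β + γ + 2 - ((2 : ℕ) : ℝ) = β + γ by push_cast; ring] at hb
  have hsm := fun k => contDiff_dyadicPiece ha doubleDirs 2 (-1) k
  obtain ⟨h1, h2, h3⟩ := hC₂ (dyadicPiece (doubleCoeff v w) doubleDirs 2 (-1)) (C₁ * (V * W))
    (by positivity) (isPC_dyadicPiece ha _) (fun k => (hsm k).of_le (by simp))
    (fun k i => (contDiff_pderiv (hsm k) i).differentiable (by simp))
    (fun k => by rw [hσ1]; exact (hb k).1) (fun k => (hb k).2.1) (fun k => (hb k).2.2)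
  refine ⟨_, (isDoubleSolution_iff.1 hP).isFunction ha (m := 2) (fun _ => rfl)
    ((summable_dyadicScale_rpow (by linarith)).mul_left _) fun k => (hb k).1, h1, ?_⟩
  refine (c1HolderNorm_le hσ.1.le h2 h3).trans (le_of_eq ?_)
  rw [show 3 * (C₂ * (C₁ * (V * W))) = 3 * (C₂ * C₁) * V * W by ring,
    ENNReal.ofReal_mul (by positivity), ENNReal.ofReal_mul (by positivity), hV, hW,
    ENNReal.ofReal_toReal hvn.ne, ENNReal.ofReal_toReal hwn.ne]
  rfl

lemma triple_estimate (hβ : β ∈ Set.Ioo (0 : ℝ) 1) (hγ : γ ∈ Set.Ioo (0 : ℝ) 1)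
    (hβγ : 1 < β + γ) :
    ∃ C : ℝ≥0, ∀ v w z : E3 → E3, IsSolenoidal v → IsSolenoidal w → IsSolenoidal z →
      holderNorm β v < ⊤ → holderNorm β w < ⊤ → holderNorm γ w < ⊤ → holderNorm γ z < ⊤ →
      ∀ Q : PeriodicDistribution, IsTripleSolution v w z Q →
        ∃ q : E3 → ℝ, Q.IsFunction q ∧
          holderNorm (β + γ - 1) q ≤
            C * supNorm v * holderNorm β w * holderNorm γ z +
            C * holderNorm β v * (supNorm w * holderNorm γ z + holderNorm γ w * supNorm z) := by
  have hσ : β + γ - 1 ∈ Set.Ioo (0 : ℝ) 1 := ⟨by linarith, by linarith [hβ.2, hγ.2]⟩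
  obtain ⟨C₁, hC₁0, hC₁⟩ := exists_dyadicPiece_bound tripleDirs
  obtain ⟨C₂, hC₂0, hC₂⟩ := exists_holderBound_resolvent hσ
  refine ⟨(2 * (C₂ * C₁) * 3).toNNReal, fun v w z hv hw hz hvn hwβ hwγ hzn Q hQ => ?_⟩
  have hv₀ := supNorm_lt_top hvn
  have hw₀ := supNorm_lt_top hwβ
  have hz₀ := supNorm_lt_top hzn
  set V₀ := (supNorm v).toReal with hV₀
  set W₀ := (supNorm w).toReal with hW₀
  set Z₀ := (supNorm z).toReal with hZ₀
  set V := (holderNorm β v).toReal with hV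
  set Wβ := (holderNorm β w).toReal with hWβ
  set Wγ := (holderNorm γ w).toReal with hWγ
  set Z := (holderNorm γ z).toReal with hZ
  have hV₀0 : 0 ≤ V₀ := ENNReal.toReal_nonneg
  have hW₀0 : 0 ≤ W₀ := ENNReal.toReal_nonneg
  have hZ₀0 : 0 ≤ Z₀ := ENNReal.toReal_nonneg
  have hV0 : 0 ≤ V := ENNReal.toReal_nonneg
  have hWβ0 : 0 ≤ Wβ := ENNReal.toReal_nonneg
  have hWγ0 : 0 ≤ Wγ := ENNReal.toReal_nonneg
  have hZ0 : 0 ≤ Z := ENNReal.toReal_nonneg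
  set K := 3 * (V₀ * Wβ * Z + V * (W₀ * Z + Wγ * Z₀)) with hK
  have hK0 : 0 ≤ K := by positivity
  have ha := isPC_tripleCoeff hv hw hz
  have hb := hC₁ (tripleCoeff v w z) 3 1 K (β + γ) ha (by simp) hK0
    fun κ hκ r hr x => abs_divConv_triple_le hv hw hz hβ.1 hγ.1 hV0 hWβ0 hWγ0 hZ0
      (abs_apply_le_supNorm hv₀) (abs_apply_le_supNorm hw₀) (abs_apply_le_supNorm hz₀)
      (holderField_toReal hβ.1 hvn) (holderField_toReal hβ.1 hwβ) (holderField_toReal hγ.1 hwγ)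
      (holderField_toReal hγ.1 hzn) hκ hr x
  -- Three derivatives against a gain of two: one power is lost, and summability over the scales is
  -- where `1 < β + γ` enters.
  rw [show β + γ + 2 - ((3 : ℕ) : ℝ) = β + γ - 1 by push_cast; ring] at hb
  refine ⟨_, (isTripleSolution_iff.1 hQ).isFunction ha (m := 3) (fun _ => rfl)
    ((summable_dyadicScale_rpow hσ.1).mul_left _) fun k => (hb k).1, ?_⟩
  have hH := hC₂ (dyadicPiece (tripleCoeff v w z) tripleDirs 3 1) (C₁ * K) (by positivity)
    (isPC_dyadicPiece ha _) (fun k => (contDiff_dyadicPiece ha _ _ _ k).differentiable (by simp))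
    (fun k => (hb k).1) (fun k => (hb k).2.1)
  refine (hH.holderNorm_le hσ.1.le).trans (le_of_eq ?_)
  set D := 2 * (C₂ * C₁) * 3 with hD
  have hD0 : 0 ≤ D := by positivity
  have e : 2 * (C₂ * (C₁ * K)) = D * V₀ * Wβ * Z + D * V * (W₀ * Z + Wγ * Z₀) := by
    rw [hK, hD]
    ring
  clear_value D
  rw [e, ENNReal.ofReal_add (by positivity) (by positivity), ENNReal.ofReal_mul (by positivity),
    ENNReal.ofReal_mul (by positivity), ENNReal.ofReal_mul (by positivity),
    ENNReal.ofReal_mul (by positivity), ENNReal.ofReal_mul (by positivity),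
    ENNReal.ofReal_add (by positivity) (by positivity), ENNReal.ofReal_mul (by positivity),
    ENNReal.ofReal_mul (by positivity), hV₀, hW₀, hZ₀, hV, hWβ, hWγ, hZ,
    ENNReal.ofReal_toReal hvn.ne, ENNReal.ofReal_toReal hwβ.ne, ENNReal.ofReal_toReal hwγ.ne,
    ENNReal.ofReal_toReal hzn.ne, ENNReal.ofReal_toReal hv₀.ne, ENNReal.ofReal_toReal hw₀.ne,
    ENNReal.ofReal_toReal hz₀.ne]
  rfl

end Torus3

end

/-! ### Well-posedness and the three Hölder estimates -/

open Torus3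
theorem corollary3p3 :
    -- existence and uniqueness of the zero-average solutions
    (∀ v w : E3 → E3, IsSolenoidal v → IsSolenoidal w →
      ∃! P : PeriodicDistribution, IsDoubleSolution v w P) ∧
    (∀ v w z : E3 → E3, IsSolenoidal v → IsSolenoidal w → IsSolenoidal z →
      ∃! Q : PeriodicDistribution, IsTripleSolution v w z Q) ∧
    -- the estimates
    ∀ β ∈ Set.Ioo (0 : ℝ) 1, ∀ γ ∈ Set.Ioo (0 : ℝ) 1, ∃ C : ℝ≥0, 0 < C ∧
      (β + γ < 1 →
        ∀ v w : E3 → E3, IsSolenoidal v → IsSolenoidal w →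
          holderNorm β v < ⊤ → holderNorm γ w < ⊤ →
          ∀ P : PeriodicDistribution, IsDoubleSolution v w P →
            ∃ p : E3 → ℝ, P.IsFunction p ∧
              holderNorm (β + γ) p ≤ C * holderNorm β v * holderNorm γ w) ∧
      (1 < β + γ →
        ∀ v w : E3 → E3, IsSolenoidal v → IsSolenoidal w →
          holderNorm β v < ⊤ → holderNorm γ w < ⊤ →
          ∀ P : PeriodicDistribution, IsDoubleSolution v w P →
            ∃ p : E3 → ℝ, P.IsFunction p ∧ ContDiff ℝ 1 p ∧
              c1HolderNorm (β + γ - 1) p ≤ C * holderNorm β v * holderNorm γ w) ∧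
      (1 < β + γ →
        ∀ v w z : E3 → E3, IsSolenoidal v → IsSolenoidal w → IsSolenoidal z →
          holderNorm β v < ⊤ → holderNorm β w < ⊤ → holderNorm γ w < ⊤ → holderNorm γ z < ⊤ →
          ∀ Q : PeriodicDistribution, IsTripleSolution v w z Q →
            ∃ q : E3 → ℝ, Q.IsFunction q ∧
              holderNorm (β + γ - 1) q ≤
                C * supNorm v * holderNorm β w * holderNorm γ z +
                C * holderNorm β v *
                  (supNorm w * holderNorm γ z + holderNorm γ w * supNorm z)) := by
  refine ⟨fun v w hv hw => ?_, fun v w z hv hw hz => ?_, fun β hβ γ hγ => ?_⟩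
  · simp only [isDoubleSolution_iff]
    exact existsUnique_solvesDiv (isPC_doubleCoeff hv hw) (m := 2) (fun _ => by simp [doubleDirs])
      (fun _ => rfl) (-1)
  · simp only [isTripleSolution_iff]
    exact existsUnique_solvesDiv (isPC_tripleCoeff hv hw hz) (m := 3)
      (fun _ => by simp [tripleDirs]) (fun _ => rfl) 1
  rcases lt_or_ge (β + γ) 1 with h | h
  · obtain ⟨C, hC⟩ := double_estimate hβ.1 hγ.1 h
    refine ⟨C + 1, by positivity, fun _ v w hv hw hvn hwn P hP => ?_, fun h' => absurd h' h.not_gt,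
      fun h' => absurd h' h.not_gt⟩
    obtain ⟨p, hp, hle⟩ := hC v w hv hw hvn hwn P hP
    exact ⟨p, hp, hle.trans (by gcongr; simp)⟩
  -- At the borderline `β + γ = 1` nothing is claimed, so any positive constant does.
  rcases h.eq_or_lt with h | h
  · exact ⟨1, one_pos, fun h' => absurd h h'.ne', fun h' => absurd h h'.ne,
      fun h' => absurd h h'.ne⟩
  · obtain ⟨C, hC⟩ := double_estimate_c1 hβ hγ h
    obtain ⟨D, hD⟩ := triple_estimate hβ hγ h
    -- One constant must serve both estimates and be positive.
    refine ⟨C + D + 1, by positivity, fun h' => absurd h' h.not_gt,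
      fun _ v w hv hw hvn hwn P hP => ?_,
      fun _ v w z hv hw hz hvn hwβ hwγ hzn Q hQ => ?_⟩
    · obtain ⟨p, hp, hp1, hle⟩ := hC v w hv hw hvn hwn P hP
      have hCle : C ≤ C + D + 1 := by rw [add_assoc]; exact le_self_add
      exact ⟨p, hp, hp1, hle.trans (by gcongr)⟩
    · obtain ⟨q, hq, hle⟩ := hD v w z hv hw hz hvn hwβ hwγ hzn Q hQ
      have hDle : D ≤ C + D + 1 := le_add_self.trans le_self_add
      exact ⟨q, hq, hle.trans (by gcongr)⟩
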